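/- Work in homotopy type theory: intensional Martin-Löf type theory with a cumulative hierarchy of universes $\mathcal U_0,\mathcal U_1,\dots$, function extensionality, univalence and propositional truncation $\|{-}\|$, with neither excluded middle nor any choice principle nor propositional resizing, and with the quotient inductive-inductive type $\mathsf{Brw}:\mathcal U_0$ of Brouwer trees. The latter is generated, simultaneously with a proposition-valued relation $\le$ on it, by $\mathsf{zero}$, $\mathsf{suc}$ and limits $\mathsf{lim}\,f$ of sequences $f:\mathbb N\to\mathsf{Brw}$ with $\mathsf{suc}(f_n)\le f_{n+1}$ for all $n$; $\mathsf{Brw}$ is a set, and $\mathsf{lim}\,f=\mathsf{lim}\,g$ whenever $\forall k.\exists n.\,f_k\le g_n$ and $\forall k.\exists n.\,g_k\le f_n$; the relation $\le$ is transitive, $\mathsf{zero}$ is minimal, $\mathsf{suc}$ is monotone, $x\le f_k$ implies $x\le\mathsf{lim}\,f$, and $\forall k.\,f_k\le x$ implies $\mathsf{lim}\,f\le x$. Here $\exists x.\,B(x)$ means $\|\Sigma x.\,B(x)\|$. Let $\omega^2:=\mathsf{lim}(n\mapsto\omega\cdot n)$, where $\omega\cdot 0=\mathsf{zero}$ and $\omega\cdot(n+1)=\mathsf{lim}(k\mapsto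 \mathsf{suc}^k(\omega\cdot n))$. Fix a universe $\mathcal U=\mathcal U_i$ of any level $i$, and let $\mathsf{Prop}$ be its subtype of propositions. For $\alpha:\mathsf{Brw}$, a proposition $P$ is $\alpha$-decidable if $\exists y:\mathsf{Brw}.\,(P\leftrightarrow\alpha\le y)$, and semidecidable if $\exists s:\mathbb N\to\mathbf 2.\,(P\leftrightarrow\exists k.\,s_k=1)$. Countable choice (for $\mathcal U$) states that $(\forall n.\,\|B(n)\|)\to\|\Pi(n:\mathbb N).\,B(n)\|$ for every $B:\mathbb N\to\mathcal U$. **Theorem.** The following are provable in homotopy type theory. 1. Assuming countable choice, for every $\omega^2$-decidable $P:\mathsf{Prop}$ there exists a family $Q:\mathbb N\to\mathsf{Prop}$ of semidecidable propositions such that $P\leftrightarrow\forall n.\,Q_n$. 2. Assuming countable choice, if $P:\mathbb N\to\mathsf{Prop}$ is a family of $\omega^2$-decidable propositions, then $\forall n.\,P_n$ is $\omega^2$-decidable. -/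

import Mathlib

/-!
Constructive mathematics is represented here by homotopy type theory itself. Lean serves only as
the metalanguage: raw terms, the typing judgment and judgmental equality of homotopy type theory
are defined inductively, and "the theory proves `A`" means that some term has the closed type `A`
in the empty context. No form of excluded middle or choice is part of the theory.

The theory is intensional Martin-Löf type theory with a cumulative hierarchy of universes,
dependent functions (with `β` and `η`), dependent pairs, coproducts, the empty type, the unit
type, natural numbers, identity types, function extensionality, univalence, propositional
truncation, and the quotient inductive-inductive type of Brouwer trees with its order relation.
Apart from universes and dependent functions, everything is given by primitive constants with
closed types, together with judgmental computation rules. There is no propositional resizing.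
-/

namespace HoTT

/-! ### Raw terms -/

/-- Primitive constants. The natural numbers `i` and `j` are universe levels. -/
inductive Const : Type
  | id (i : ℕ) | refl (i : ℕ) | idElim (i j : ℕ)
  | sigma (i : ℕ) | pair (i : ℕ) | sigmaElim (i j : ℕ)
  | sum (i : ℕ) | inl (i : ℕ) | inr (i : ℕ) | sumElim (i j : ℕ)
  | empty | emptyElim (j : ℕ)
  | unit | star | unitElim (j : ℕ)
  | nat | zero | succ | natElim (j : ℕ)
  | funext (i : ℕ) | univalence (i : ℕ)
  | trunc (i : ℕ) | tr (i : ℕ) | squash (i : ℕ) | truncRec (i j : ℕ)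
  | brw | le
  | bzero | bsuc | blim | bisim | brwSet
  | leZero | leTrans | leSuc | leCocone | leLimiting | leProp
  | brwElim (j : ℕ) | leElim (j : ℕ)
  deriving DecidableEq

/-- Raw terms, with de Bruijn indices. `pi A B` and `lam A b` bind one variable in the second
argument; `univ i` is the universe of level `i`. -/
inductive Term : Type
  | var (n : ℕ)
  | univ (i : ℕ)
  | pi (A B : Term)
  | lam (A b : Term)
  | app (f a : Term)
  | const (c : Const)
  deriving DecidableEq

/-- Extend a renaming under a binder. -/
def upRen (ρ : ℕ → ℕ) : ℕ → ℕ
  | 0 => 0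
  | n + 1 => ρ n + 1

/-- Apply a renaming of variables. -/
def Term.rename (ρ : ℕ → ℕ) : Term → Term
  | .var n => .var (ρ n)
  | .univ i => .univ i
  | .pi A B => .pi (A.rename ρ) (B.rename (upRen ρ))
  | .lam A b => .lam (A.rename ρ) (b.rename (upRen ρ))
  | .app f a => .app (f.rename ρ) (a.rename ρ)
  | .const c => .const c

/-- Weakening by one variable. -/
def Term.shift (t : Term) : Term := t.rename Nat.succ

/-- Extend a substitution under a binder. -/
def upSub (σ : ℕ → Term) : ℕ → Term
  | 0 => .var 0
  | n + 1 => (σ n).shift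

/-- Apply a simultaneous substitution. -/
def Term.subst (σ : ℕ → Term) : Term → Term
  | .var n => σ n
  | .univ i => .univ i
  | .pi A B => .pi (A.subst σ) (B.subst (upSub σ))
  | .lam A b => .lam (A.subst σ) (b.subst (upSub σ))
  | .app f a => .app (f.subst σ) (a.subst σ)
  | .const c => .const c

/-- The substitution that replaces the variable `0` by `a` and lowers all the others. -/
def instSub (a : Term) : ℕ → Term
  | 0 => a
  | n + 1 => .var n

/-- `b.inst a` is `b[a]`: the variable `0` is replaced by `a`. -/
def Term.inst (b a : Term) : Term := b.subst (instSub a)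

/-! ### Writing terms with named variables

`Tm` is a term that may be placed under any number of binders: it maps the number of enclosing
binders to a raw term. This allows object-level binders to be written with Lean functions; a
variable bound at depth `d` has index `e - (d + 1)` when it is used at depth `e`. -/

/-- Terms as a function of the number of enclosing binders. -/
def Tm : Type := ℕ → Term

/-- The raw term of a closed term. -/
def Tm.close (t : Tm) : Term := t 0

/-- The universe of level `i`. -/
def U (i : ℕ) : Tm := fun _ => .univ i

/-- A primitive constant. -/
def con (c : Const) : Tm := fun _ => .const c

/-- Application. -/
def app (f a : Tm) : Tm := fun d => .app (f d) (a d)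

/-- Dependent function type. -/
def pi (A : Tm) (B : Tm → Tm) : Tm :=
  fun d => .pi (A d) (B (fun e => .var (e - (d + 1))) (d + 1))

/-- Function abstraction. -/
def lam (A : Tm) (b : Tm → Tm) : Tm :=
  fun d => .lam (A d) (b (fun e => .var (e - (d + 1))) (d + 1))

/-- Non-dependent function type. -/
def arr (A B : Tm) : Tm := pi A fun _ => B

infixl:80 " ⬝ " => HoTT.app
infixr:60 " ⇒ " => HoTT.arr

/-! ### Abbreviations for the basic type formers -/

/-- Identity type of `a` and `b` in the type `A` of level `i`. -/
def eq (i : ℕ) (A a b : Tm) : Tm := con (.id i) ⬝ A ⬝ a ⬝ b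

def refl (i : ℕ) (A a : Tm) : Tm := con (.refl i) ⬝ A ⬝ a

/-- `Σ (x : A), B x`. -/
def sig (i : ℕ) (A : Tm) (B : Tm → Tm) : Tm := con (.sigma i) ⬝ A ⬝ lam A B

/-- Pair, as an element of `Σ (x : A), B x`. -/
def pair (i : ℕ) (A : Tm) (B : Tm → Tm) (a b : Tm) : Tm := con (.pair i) ⬝ A ⬝ lam A B ⬝ a ⬝ b

/-- First projection out of `Σ (x : A), B x`. -/
def fst (i : ℕ) (A : Tm) (B : Tm → Tm) (p : Tm) : Tm :=
  con (.sigmaElim i i) ⬝ A ⬝ lam A B ⬝ (lam (sig i A B) fun _ => A) ⬝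
    (lam A fun a => lam (B a) fun _ => a) ⬝ p

/-- Second projection out of `Σ (x : A), B x`. -/
def snd (i : ℕ) (A : Tm) (B : Tm → Tm) (p : Tm) : Tm :=
  con (.sigmaElim i i) ⬝ A ⬝ lam A B ⬝ (lam (sig i A B) fun q => B (fst i A B q)) ⬝
    (lam A fun a => lam (B a) fun b => b) ⬝ p

/-- Binary product. -/
def prod (i : ℕ) (A B : Tm) : Tm := sig i A fun _ => B

/-- Logical equivalence. -/
def iff (i : ℕ) (A B : Tm) : Tm := prod i (A ⇒ B) (B ⇒ A)

def sum (i : ℕ) (A B : Tm) : Tm := con (.sum i) ⬝ A ⬝ B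

def empty : Tm := con .empty

def unit : Tm := con .unit

def star : Tm := con .star

def nat : Tm := con .nat

def zero : Tm := con .zero

def succ (n : Tm) : Tm := con .succ ⬝ n

/-- The function on the natural numbers, applied to `n`, with value `z` at `0` and `s k y` at
`k + 1`, where `y` is the value at `k`; `C` is the family in which the values lie. -/
def natRec (j : ℕ) (C : Tm → Tm) (z : Tm) (s : Tm → Tm → Tm) (n : Tm) : Tm :=
  con (.natElim j) ⬝ lam nat C ⬝ z ⬝ (lam nat fun k => lam (C k) fun y => s k y) ⬝ n

/-- Propositional truncation. -/
def trunc (i : ℕ) (A : Tm) : Tm := con (.trunc i) ⬝ A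

/-- Mere existence: the truncation of `Σ (x : A), B x`. -/
def ex (i : ℕ) (A : Tm) (B : Tm → Tm) : Tm := trunc i (sig i A B)

/-- Being a proposition: any two elements are equal. -/
def isProp (i : ℕ) (A : Tm) : Tm := pi A fun x => pi A fun y => eq i A x y

/-- Being a set: all identity types are propositions. -/
def isSet (i : ℕ) (A : Tm) : Tm := pi A fun x => pi A fun y => isProp i (eq i A x y)

/-- Transport in the family `P` (level `j`) along `p : eq i A x y`, applied to `u : P x`. -/
def transport (i j : ℕ) (A P x y p u : Tm) : Tm :=
  con (.idElim i j) ⬝ A ⬝ x ⬝ (lam A fun z => lam (eq i A x z) fun _ => P ⬝ z) ⬝ u ⬝ y ⬝ p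

/-! ### Equivalences -/

/-- Right inverses of `f : A ⇒ B`. -/
def rinv (i : ℕ) (A B f : Tm) : Tm :=
  sig i (B ⇒ A) fun g => pi B fun y => eq i B (f ⬝ (g ⬝ y)) y

/-- Left inverses of `f : A ⇒ B`. -/
def linv (i : ℕ) (A B f : Tm) : Tm :=
  sig i (B ⇒ A) fun h => pi A fun x => eq i A (h ⬝ (f ⬝ x)) x

/-- Being an equivalence: having a right inverse and a left inverse. -/
def isEquiv (i : ℕ) (A B f : Tm) : Tm := prod i (rinv i A B f) (linv i A B f)

/-- The type of equivalences. -/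
def equiv (i : ℕ) (A B : Tm) : Tm := sig i (A ⇒ B) fun f => isEquiv i A B f

/-- The identity equivalence. -/
def idEquiv (i : ℕ) (A : Tm) : Tm :=
  let idf : Tm := lam A fun x => x
  let reflf : Tm := lam A fun x => refl i A x
  pair i (A ⇒ A) (fun f => isEquiv i A A f) idf
    (pair i (rinv i A A idf) (fun _ => linv i A A idf)
      (pair i (A ⇒ A) (fun g => pi A fun y => eq i A (idf ⬝ (g ⬝ y)) y) idf reflf)
      (pair i (A ⇒ A) (fun h => pi A fun x => eq i A (h ⬝ (idf ⬝ x)) x) idf reflf))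

/-- The canonical map from `A = B` to equivalences, for `A` and `B` in the universe `U i`. -/
def idToEquiv (i : ℕ) (A B : Tm) : Tm :=
  lam (eq (i + 1) (U i) A B) fun p =>
    con (.idElim (i + 1) i) ⬝ U i ⬝ A ⬝
      (lam (U i) fun X => lam (eq (i + 1) (U i) A X) fun _ => equiv i A X) ⬝ idEquiv i A ⬝ B ⬝ p

/-- The canonical map from `f = g` to pointwise equality, for dependent functions. -/
def happly (i : ℕ) (A B f g : Tm) : Tm :=
  let F : Tm := pi A fun x => B ⬝ x
  lam (eq i F f g) fun p =>
    con (.idElim i i) ⬝ F ⬝ f ⬝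
      (lam F fun h => lam (eq i F f h) fun _ => pi A fun x => eq i (B ⬝ x) (f ⬝ x) (h ⬝ x)) ⬝
      (lam A fun x => refl i (B ⬝ x) (f ⬝ x)) ⬝ g ⬝ p

/-! ### Brouwer trees -/

def brw : Tm := con .brw

/-- The order relation on Brouwer trees. -/
def le (x y : Tm) : Tm := con .le ⬝ x ⬝ y

def bzero : Tm := con .bzero

def bsuc (x : Tm) : Tm := con .bsuc ⬝ x

/-- The limit of the sequence `f`, with a proof `u` that `f` is strictly increasing. -/
def blim (f u : Tm) : Tm := con .blim ⬝ f ⬝ u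

/-- The sequence `f` is strictly increasing. -/
def increasing (f : Tm) : Tm := pi nat fun n => le (bsuc (f ⬝ n)) (f ⬝ succ n)

/-- The sequence `f` is simulated by `g`. Two sequences are bisimilar when each of them is
simulated by the other. -/
def simulated (f g : Tm) : Tm := pi nat fun k => ex 0 nat fun n => le (f ⬝ k) (g ⬝ n)

/-- A binder of the object language: `pi` or `lam`. -/
abbrev Binder : Type := Tm → (Tm → Tm) → Tm

/-- The motives and methods of the simultaneous elimination principle for Brouwer trees and
their order. -/
structure Methods where
  C : Tm
  D : Tm
  zero : Tm
  suc : Tm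
  lim : Tm
  bisim : Tm
  isSet : Tm
  leZero : Tm
  leTrans : Tm
  leSuc : Tm
  leCocone : Tm
  leLimiting : Tm
  leProp : Tm

/-- `c` is a family over the terms of the sequence `f`. -/
def overSeq (C f : Tm) : Tm := pi nat fun n => C ⬝ (f ⬝ n)

/-- The family `c` over the sequence `f` is strictly increasing in the sense of the motive `D`
(over the proof `u` that `f` is strictly increasing). -/
def overIncreasing (D s f u c : Tm) : Tm :=
  pi nat fun n =>
    D ⬝ bsuc (f ⬝ n) ⬝ (f ⬝ succ n) ⬝ (s ⬝ (f ⬝ n) ⬝ (c ⬝ n)) ⬝ (c ⬝ succ n) ⬝ (u ⬝ n)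

/-- The family `c` over the sequence `f` is simulated by the family `d` over `g`, in the sense of
the motive `D`. -/
def overSimulated (j : ℕ) (D f g c d : Tm) : Tm :=
  pi nat fun k => ex j nat fun n => sig j (le (f ⬝ k) (g ⬝ n)) fun r =>
    D ⬝ (f ⬝ k) ⬝ (g ⬝ n) ⬝ (c ⬝ k) ⬝ (d ⬝ n) ⬝ r

/-- The telescope of motives (with values in the universe `U j`) and methods: a family `C` over
Brouwer trees, a family `D` over the order relation, and one method for each constructor, path
constructors included. -/
def brwTel (j : ℕ) (bind : Binder) (body : Methods → Tm) : Tm :=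
  bind (brw ⇒ U j) fun C =>
  bind (pi brw fun x => pi brw fun y => C ⬝ x ⇒ C ⬝ y ⇒ le x y ⇒ U j) fun D =>
  bind (C ⬝ bzero) fun z =>
  bind (pi brw fun x => C ⬝ x ⇒ C ⬝ bsuc x) fun s =>
  bind (pi (nat ⇒ brw) fun f => pi (increasing f) fun u =>
    pi (overSeq C f) fun c => overIncreasing D s f u c ⇒ C ⬝ blim f u) fun l =>
  bind (pi (nat ⇒ brw) fun f => pi (increasing f) fun u =>
    pi (nat ⇒ brw) fun g => pi (increasing g) fun v =>
    pi (simulated f g) fun p => pi (simulated g f) fun q =>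
    pi (overSeq C f) fun c => pi (overIncreasing D s f u c) fun c' =>
    pi (overSeq C g) fun d => pi (overIncreasing D s g v d) fun d' =>
    overSimulated j D f g c d ⇒ overSimulated j D g f d c ⇒
    eq j (C ⬝ blim g v)
      (transport 0 j brw C (blim f u) (blim g v) (con .bisim ⬝ f ⬝ u ⬝ g ⬝ v ⬝ p ⬝ q)
        (l ⬝ f ⬝ u ⬝ c ⬝ c'))
      (l ⬝ g ⬝ v ⬝ d ⬝ d')) fun b =>
  bind (pi brw fun x => isSet j (C ⬝ x)) fun t =>
  bind (pi brw fun x => pi (C ⬝ x) fun c => D ⬝ bzero ⬝ x ⬝ z ⬝ c ⬝ (con .leZero ⬝ x)) fun dz =>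
  bind (pi brw fun x => pi brw fun y => pi brw fun w => pi (le x y) fun p => pi (le y w) fun q =>
    pi (C ⬝ x) fun cx => pi (C ⬝ y) fun cy => pi (C ⬝ w) fun cw =>
    D ⬝ x ⬝ y ⬝ cx ⬝ cy ⬝ p ⇒ D ⬝ y ⬝ w ⬝ cy ⬝ cw ⬝ q ⇒
    D ⬝ x ⬝ w ⬝ cx ⬝ cw ⬝ (con .leTrans ⬝ x ⬝ y ⬝ w ⬝ p ⬝ q)) fun dt =>
  bind (pi brw fun x => pi brw fun y => pi (le x y) fun p =>
    pi (C ⬝ x) fun cx => pi (C ⬝ y) fun cy => D ⬝ x ⬝ y ⬝ cx ⬝ cy ⬝ p ⇒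
    D ⬝ bsuc x ⬝ bsuc y ⬝ (s ⬝ x ⬝ cx) ⬝ (s ⬝ y ⬝ cy) ⬝ (con .leSuc ⬝ x ⬝ y ⬝ p)) fun ds =>
  bind (pi brw fun x => pi (nat ⇒ brw) fun f => pi (increasing f) fun u => pi nat fun k =>
    pi (le x (f ⬝ k)) fun p =>
    pi (C ⬝ x) fun cx => pi (overSeq C f) fun c => pi (overIncreasing D s f u c) fun c' =>
    D ⬝ x ⬝ (f ⬝ k) ⬝ cx ⬝ (c ⬝ k) ⬝ p ⇒
    D ⬝ x ⬝ blim f u ⬝ cx ⬝ (l ⬝ f ⬝ u ⬝ c ⬝ c') ⬝ (con .leCocone ⬝ x ⬝ f ⬝ u ⬝ k ⬝ p)) fun dc =>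
  bind (pi (nat ⇒ brw) fun f => pi (increasing f) fun u => pi brw fun x =>
    pi (pi nat fun k => le (f ⬝ k) x) fun p =>
    pi (overSeq C f) fun c => pi (overIncreasing D s f u c) fun c' => pi (C ⬝ x) fun cx =>
    (pi nat fun k => D ⬝ (f ⬝ k) ⬝ x ⬝ (c ⬝ k) ⬝ cx ⬝ (p ⬝ k)) ⇒
    D ⬝ blim f u ⬝ x ⬝ (l ⬝ f ⬝ u ⬝ c ⬝ c') ⬝ cx ⬝ (con .leLimiting ⬝ f ⬝ u ⬝ x ⬝ p)) fun dl =>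
  bind (pi brw fun x => pi brw fun y => pi (C ⬝ x) fun cx => pi (C ⬝ y) fun cy =>
    pi (le x y) fun p => isProp j (D ⬝ x ⬝ y ⬝ cx ⬝ cy ⬝ p)) fun dp =>
  body ⟨C, D, z, s, l, b, t, dz, dt, ds, dc, dl, dp⟩

/-- The constant `c` applied to all motives and methods. -/
def appMethods (c : Const) (m : Methods) : Tm :=
  con c ⬝ m.C ⬝ m.D ⬝ m.zero ⬝ m.suc ⬝ m.lim ⬝ m.bisim ⬝ m.isSet ⬝ m.leZero ⬝ m.leTrans ⬝
    m.leSuc ⬝ m.leCocone ⬝ m.leLimiting ⬝ m.leProp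

/-- The section of `m.C` defined by the methods, at `x`. -/
def brwElim (j : ℕ) (m : Methods) (x : Tm) : Tm := appMethods (.brwElim j) m ⬝ x

/-- The section of `m.D` defined by the methods, at `p : le x y`. -/
def leElim (j : ℕ) (m : Methods) (x y p : Tm) : Tm := appMethods (.leElim j) m ⬝ x ⬝ y ⬝ p

/-! ### Telescopes of the other eliminators -/

def idTel (i j : ℕ) (bind : Binder) (body : (A a C c : Tm) → Tm) : Tm :=
  bind (U i) fun A => bind A fun a =>
  bind (pi A fun x => eq i A a x ⇒ U j) fun C =>
  bind (C ⬝ a ⬝ refl i A a) fun c => body A a C c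

def sigmaTel (i j : ℕ) (bind : Binder) (body : (A B C g : Tm) → Tm) : Tm :=
  bind (U i) fun A => bind (A ⇒ U i) fun B =>
  bind (con (.sigma i) ⬝ A ⬝ B ⇒ U j) fun C =>
  bind (pi A fun a => pi (B ⬝ a) fun b => C ⬝ (con (.pair i) ⬝ A ⬝ B ⬝ a ⬝ b)) fun g => body A B C g

def sumTel (i j : ℕ) (bind : Binder) (body : (A B C g h : Tm) → Tm) : Tm :=
  bind (U i) fun A => bind (U i) fun B =>
  bind (sum i A B ⇒ U j) fun C =>
  bind (pi A fun a => C ⬝ (con (.inl i) ⬝ A ⬝ B ⬝ a)) fun g =>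
  bind (pi B fun b => C ⬝ (con (.inr i) ⬝ A ⬝ B ⬝ b)) fun h => body A B C g h

def unitTel (j : ℕ) (bind : Binder) (body : (C c : Tm) → Tm) : Tm :=
  bind (unit ⇒ U j) fun C => bind (C ⬝ star) fun c => body C c

def natTel (j : ℕ) (bind : Binder) (body : (C z s : Tm) → Tm) : Tm :=
  bind (nat ⇒ U j) fun C => bind (C ⬝ zero) fun z =>
  bind (pi nat fun n => C ⬝ n ⇒ C ⬝ succ n) fun s => body C z s

def truncTel (i j : ℕ) (bind : Binder) (body : (A B h f : Tm) → Tm) : Tm :=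
  bind (U i) fun A => bind (U j) fun B => bind (isProp j B) fun h =>
  bind (A ⇒ B) fun f => body A B h f

/-! ### The signature: types of the constants and computation rules -/

/-- The type of a constant. -/
def constTm : Const → Tm
  | .id i => pi (U i) fun A => A ⇒ A ⇒ U i
  | .refl i => pi (U i) fun A => pi A fun a => eq i A a a
  | .idElim i j => idTel i j pi fun A a C _ => pi A fun x => pi (eq i A a x) fun p => C ⬝ x ⬝ p
  | .sigma i => pi (U i) fun A => (A ⇒ U i) ⇒ U i
  | .pair i => pi (U i) fun A => pi (A ⇒ U i) fun B => pi A fun a => B ⬝ a ⇒ con (.sigma i) ⬝ A ⬝ B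
  | .sigmaElim i j => sigmaTel i j pi fun A B C _ => pi (con (.sigma i) ⬝ A ⬝ B) fun p => C ⬝ p
  | .sum i => U i ⇒ U i ⇒ U i
  | .inl i => pi (U i) fun A => pi (U i) fun B => A ⇒ sum i A B
  | .inr i => pi (U i) fun A => pi (U i) fun B => B ⇒ sum i A B
  | .sumElim i j => sumTel i j pi fun A B C _ _ => pi (sum i A B) fun p => C ⬝ p
  | .empty => U 0
  | .emptyElim j => pi (empty ⇒ U j) fun C => pi empty fun x => C ⬝ x
  | .unit => U 0
  | .star => unit
  | .unitElim j => unitTel j pi fun C _ => pi unit fun x => C ⬝ x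
  | .nat => U 0
  | .zero => nat
  | .succ => nat ⇒ nat
  | .natElim j => natTel j pi fun C _ _ => pi nat fun n => C ⬝ n
  | .funext i => pi (U i) fun A => pi (A ⇒ U i) fun B =>
      pi (pi A fun x => B ⬝ x) fun f => pi (pi A fun x => B ⬝ x) fun g =>
      isEquiv i (eq i (pi A fun x => B ⬝ x) f g) (pi A fun x => eq i (B ⬝ x) (f ⬝ x) (g ⬝ x))
        (happly i A B f g)
  | .univalence i => pi (U i) fun A => pi (U i) fun B =>
      isEquiv (i + 1) (eq (i + 1) (U i) A B) (equiv i A B) (idToEquiv i A B)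
  | .trunc i => U i ⇒ U i
  | .tr i => pi (U i) fun A => A ⇒ trunc i A
  | .squash i => pi (U i) fun A => isProp i (trunc i A)
  | .truncRec i j => truncTel i j pi fun A B _ _ => trunc i A ⇒ B
  | .brw => U 0
  | .le => brw ⇒ brw ⇒ U 0
  | .bzero => brw
  | .bsuc => brw ⇒ brw
  | .blim => pi (nat ⇒ brw) fun f => increasing f ⇒ brw
  | .bisim => pi (nat ⇒ brw) fun f => pi (increasing f) fun u =>
      pi (nat ⇒ brw) fun g => pi (increasing g) fun v =>
      simulated f g ⇒ simulated g f ⇒ eq 0 brw (blim f u) (blim g v)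
  | .brwSet => isSet 0 brw
  | .leZero => pi brw fun x => le bzero x
  | .leTrans => pi brw fun x => pi brw fun y => pi brw fun w => le x y ⇒ le y w ⇒ le x w
  | .leSuc => pi brw fun x => pi brw fun y => le x y ⇒ le (bsuc x) (bsuc y)
  | .leCocone => pi brw fun x => pi (nat ⇒ brw) fun f => pi (increasing f) fun u => pi nat fun k =>
      le x (f ⬝ k) ⇒ le x (blim f u)
  | .leLimiting => pi (nat ⇒ brw) fun f => pi (increasing f) fun u => pi brw fun x =>
      (pi nat fun k => le (f ⬝ k) x) ⇒ le (blim f u) x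
  | .leProp => pi brw fun x => pi brw fun y => isProp 0 (le x y)
  | .brwElim j => brwTel j pi fun m => pi brw fun x => m.C ⬝ x
  | .leElim j => brwTel j pi fun m => pi brw fun x => pi brw fun y => pi (le x y) fun p =>
      m.D ⬝ x ⬝ y ⬝ brwElim j m x ⬝ brwElim j m y ⬝ p

/-- The type of a constant, as a closed raw term. -/
def constType (c : Const) : Term := (constTm c).close

/-- The computation rules of the eliminators: `Comp l r A` is the judgmental equality `l ≡ r : A`
of closed terms, in which the parameters of the rule have been abstracted. -/
inductive Comp : Term → Term → Term → Prop
  | id (i j : ℕ) : Comp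
      (idTel i j lam fun A a C c => con (.idElim i j) ⬝ A ⬝ a ⬝ C ⬝ c ⬝ a ⬝ refl i A a).close
      (idTel i j lam fun _ _ _ c => c).close
      (idTel i j pi fun A a C _ => C ⬝ a ⬝ refl i A a).close
  | sigma (i j : ℕ) : Comp
      (sigmaTel i j lam fun A B C g => lam A fun a => lam (B ⬝ a) fun b =>
        con (.sigmaElim i j) ⬝ A ⬝ B ⬝ C ⬝ g ⬝ (con (.pair i) ⬝ A ⬝ B ⬝ a ⬝ b)).close
      (sigmaTel i j lam fun A B _ g => lam A fun a => lam (B ⬝ a) fun b => g ⬝ a ⬝ b).close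
      (sigmaTel i j pi fun A B C _ => pi A fun a => pi (B ⬝ a) fun b =>
        C ⬝ (con (.pair i) ⬝ A ⬝ B ⬝ a ⬝ b)).close
  | inl (i j : ℕ) : Comp
      (sumTel i j lam fun A B C g h => lam A fun a =>
        con (.sumElim i j) ⬝ A ⬝ B ⬝ C ⬝ g ⬝ h ⬝ (con (.inl i) ⬝ A ⬝ B ⬝ a)).close
      (sumTel i j lam fun A _ _ g _ => lam A fun a => g ⬝ a).close
      (sumTel i j pi fun A B C _ _ => pi A fun a => C ⬝ (con (.inl i) ⬝ A ⬝ B ⬝ a)).close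
  | inr (i j : ℕ) : Comp
      (sumTel i j lam fun A B C g h => lam B fun b =>
        con (.sumElim i j) ⬝ A ⬝ B ⬝ C ⬝ g ⬝ h ⬝ (con (.inr i) ⬝ A ⬝ B ⬝ b)).close
      (sumTel i j lam fun _ B _ _ h => lam B fun b => h ⬝ b).close
      (sumTel i j pi fun A B C _ _ => pi B fun b => C ⬝ (con (.inr i) ⬝ A ⬝ B ⬝ b)).close
  | unit (j : ℕ) : Comp
      (unitTel j lam fun C c => con (.unitElim j) ⬝ C ⬝ c ⬝ star).close
      (unitTel j lam fun _ c => c).close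
      (unitTel j pi fun C _ => C ⬝ star).close
  | natZero (j : ℕ) : Comp
      (natTel j lam fun C z s => con (.natElim j) ⬝ C ⬝ z ⬝ s ⬝ zero).close
      (natTel j lam fun _ z _ => z).close
      (natTel j pi fun C _ _ => C ⬝ zero).close
  | natSucc (j : ℕ) : Comp
      (natTel j lam fun C z s => lam nat fun n => con (.natElim j) ⬝ C ⬝ z ⬝ s ⬝ succ n).close
      (natTel j lam fun C z s => lam nat fun n =>
        s ⬝ n ⬝ (con (.natElim j) ⬝ C ⬝ z ⬝ s ⬝ n)).close
      (natTel j pi fun C _ _ => pi nat fun n => C ⬝ succ n).close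
  | trunc (i j : ℕ) : Comp
      (truncTel i j lam fun A B h f => lam A fun a =>
        con (.truncRec i j) ⬝ A ⬝ B ⬝ h ⬝ f ⬝ (con (.tr i) ⬝ A ⬝ a)).close
      (truncTel i j lam fun A _ _ f => lam A fun a => f ⬝ a).close
      (truncTel i j pi fun A B _ _ => A ⇒ B).close
  | brwZero (j : ℕ) : Comp
      (brwTel j lam fun m => brwElim j m bzero).close
      (brwTel j lam fun m => m.zero).close
      (brwTel j pi fun m => m.C ⬝ bzero).close
  | brwSuc (j : ℕ) : Comp
      (brwTel j lam fun m => lam brw fun x => brwElim j m (bsuc x)).close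
      (brwTel j lam fun m => lam brw fun x => m.suc ⬝ x ⬝ brwElim j m x).close
      (brwTel j pi fun m => pi brw fun x => m.C ⬝ bsuc x).close
  | brwLim (j : ℕ) : Comp
      (brwTel j lam fun m => lam (nat ⇒ brw) fun f => lam (increasing f) fun u =>
        brwElim j m (blim f u)).close
      (brwTel j lam fun m => lam (nat ⇒ brw) fun f => lam (increasing f) fun u =>
        m.lim ⬝ f ⬝ u ⬝ (lam nat fun n => brwElim j m (f ⬝ n)) ⬝
          (lam nat fun n => leElim j m (bsuc (f ⬝ n)) (f ⬝ succ n) (u ⬝ n))).close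
      (brwTel j pi fun m => pi (nat ⇒ brw) fun f => pi (increasing f) fun u =>
        m.C ⬝ blim f u).close

/-! ### The judgments

A context is a list of types, the most recent variable first. -/

/-- `Lookup Γ n A`: the variable `n` has type `A` in the context `Γ`. -/
inductive Lookup : List Term → ℕ → Term → Prop
  | here (Γ : List Term) (A : Term) : Lookup (A :: Γ) 0 A.shift
  | there (Γ : List Term) (A B : Term) (n : ℕ) : Lookup Γ n A → Lookup (B :: Γ) (n + 1) A.shift

mutual

/-- Well-formed contexts. -/
inductive WfCtx : List Term → Prop
  | nil : WfCtx []
  | cons {Γ : List Term} {A : Term} {i : ℕ} : HasType Γ A (.univ i) → WfCtx (A :: Γ)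

/-- The typing judgment `Γ ⊢ a : A`. -/
inductive HasType : List Term → Term → Term → Prop
  | var {Γ : List Term} {n : ℕ} {A : Term} : WfCtx Γ → Lookup Γ n A → HasType Γ (.var n) A
  | univ {Γ : List Term} (i : ℕ) : WfCtx Γ → HasType Γ (.univ i) (.univ (i + 1))
  | cumul {Γ : List Term} {A : Term} {i : ℕ} : HasType Γ A (.univ i) → HasType Γ A (.univ (i + 1))
  | pi {Γ : List Term} {A B : Term} {i : ℕ} : HasType Γ A (.univ i) →
      HasType (A :: Γ) B (.univ i) → HasType Γ (.pi A B) (.univ i)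
  | lam {Γ : List Term} {A b B : Term} : HasType (A :: Γ) b B → HasType Γ (.lam A b) (.pi A B)
  | app {Γ : List Term} {A B f a : Term} : HasType Γ f (.pi A B) → HasType Γ a A →
      HasType Γ (.app f a) (B.inst a)
  | const {Γ : List Term} (c : Const) : WfCtx Γ → HasType Γ (.const c) (constType c)
  | conv {Γ : List Term} {a A B : Term} {i : ℕ} : HasType Γ a A → DefEq Γ A B (.univ i) →
      HasType Γ a B
  | weaken {Γ : List Term} {a A B : Term} {i : ℕ} : HasType Γ a A → HasType Γ B (.univ i) →
      HasType (B :: Γ) a.shift A.shift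
  | subst {Γ : List Term} {a A b B : Term} : HasType (A :: Γ) b B → HasType Γ a A →
      HasType Γ (b.inst a) (B.inst a)

/-- The judgmental equality `Γ ⊢ a ≡ b : A`. -/
inductive DefEq : List Term → Term → Term → Term → Prop
  | refl {Γ : List Term} {a A : Term} : HasType Γ a A → DefEq Γ a a A
  | symm {Γ : List Term} {a b A : Term} : DefEq Γ a b A → DefEq Γ b a A
  | trans {Γ : List Term} {a b c A : Term} : DefEq Γ a b A → DefEq Γ b c A → DefEq Γ a c A
  | conv {Γ : List Term} {a b A B : Term} {i : ℕ} : DefEq Γ a b A → DefEq Γ A B (.univ i) →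
      DefEq Γ a b B
  | cumul {Γ : List Term} {A B : Term} {i : ℕ} : DefEq Γ A B (.univ i) →
      DefEq Γ A B (.univ (i + 1))
  | pi {Γ : List Term} {A A' B B' : Term} {i : ℕ} : DefEq Γ A A' (.univ i) →
      DefEq (A :: Γ) B B' (.univ i) → DefEq Γ (.pi A B) (.pi A' B') (.univ i)
  | lam {Γ : List Term} {A A' b b' B : Term} {i : ℕ} : DefEq Γ A A' (.univ i) →
      DefEq (A :: Γ) b b' B → DefEq Γ (.lam A b) (.lam A' b') (.pi A B)
  | app {Γ : List Term} {A B f f' a a' : Term} : DefEq Γ f f' (.pi A B) → DefEq Γ a a' A →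
      DefEq Γ (.app f a) (.app f' a') (B.inst a)
  | beta {Γ : List Term} {A B b a : Term} : HasType (A :: Γ) b B → HasType Γ a A →
      DefEq Γ (.app (.lam A b) a) (b.inst a) (B.inst a)
  | eta {Γ : List Term} {A B f : Term} : HasType Γ f (.pi A B) →
      DefEq Γ f (.lam A (.app f.shift (.var 0))) (.pi A B)
  | comp {Γ : List Term} {l r A : Term} : WfCtx Γ → Comp l r A → DefEq Γ l r A
  | weaken {Γ : List Term} {a b A B : Term} {i : ℕ} : DefEq Γ a b A → HasType Γ B (.univ i) →
      DefEq (B :: Γ) a.shift b.shift A.shift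
  | subst {Γ : List Term} {a A b c B : Term} : DefEq (A :: Γ) b c B → HasType Γ a A →
      DefEq Γ (b.inst a) (c.inst a) (B.inst a)

end

/-- Homotopy type theory proves the closed type `A`: some closed term has type `A`. -/
def Proves (A : Tm) : Prop := ∃ t : Term, HasType [] t A.close

/-! ### The ordinal `ω²`

`ω · n` is defined by recursion on `n`: `ω · 0` is zero, and `ω · (n + 1)` is the limit of the
sequence `k ↦ ω · n + k`; then `ω²` is the limit of the sequence `n ↦ ω · n`. Since the limit
constructor asks for a proof that the sequence is strictly increasing, a proof of `x ≤ x` is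
carried along in the recursion. -/

/-- Brouwer trees `x` together with a proof of `x ≤ x`. -/
def reflBrw : Tm := sig 0 brw fun x => le x x

/-- The Brouwer tree of an element of `reflBrw`. -/
def tree (w : Tm) : Tm := fst 0 brw (fun x => le x x) w

/-- The proof of `x ≤ x` in an element of `reflBrw`. -/
def treeRefl (w : Tm) : Tm := snd 0 brw (fun x => le x x) w

/-- `x + k` for a natural number `k`, where `x` is the tree of `w`. -/
def addNat (w k : Tm) : Tm := natRec 0 (fun _ => brw) (tree w) (fun _ y => bsuc y) k

/-- `x + k ≤ x + k`. -/
def addNatRefl (w k : Tm) : Tm :=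
  natRec 0 (fun n => le (addNat w n) (addNat w n)) (treeRefl w)
    (fun n r => con .leSuc ⬝ addNat w n ⬝ addNat w n ⬝ r) k

/-- The sequence `k ↦ x + k`. -/
def addNatSeq (w : Tm) : Tm := lam nat fun k => addNat w k

/-- The sequence `k ↦ x + k` is strictly increasing. -/
def addNatIncr (w : Tm) : Tm :=
  lam nat fun k => con .leSuc ⬝ addNat w k ⬝ addNat w k ⬝ addNatRefl w k

/-- `x + ω`, the limit of the sequence `k ↦ x + k`. -/
def addOmega (w : Tm) : Tm := blim (addNatSeq w) (addNatIncr w)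

/-- `x + ω ≤ x + ω`. -/
def addOmegaRefl (w : Tm) : Tm :=
  con .leLimiting ⬝ addNatSeq w ⬝ addNatIncr w ⬝ addOmega w ⬝
    lam nat fun k =>
      con .leCocone ⬝ addNat w k ⬝ addNatSeq w ⬝ addNatIncr w ⬝ k ⬝ addNatRefl w k

/-- `ω · n`, together with a proof of `ω · n ≤ ω · n`. -/
def omegaMulRefl (n : Tm) : Tm :=
  natRec 0 (fun _ => reflBrw) (pair 0 brw (fun x => le x x) bzero (con .leZero ⬝ bzero))
    (fun _ w => pair 0 brw (fun x => le x x) (addOmega w) (addOmegaRefl w)) n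

/-- `ω · n` for a natural number `n`. -/
def omegaMul (n : Tm) : Tm := tree (omegaMulRefl n)

/-- The sequence `n ↦ ω · n` is strictly increasing: `ω · n + 1` is a term of the sequence of which
`ω · (n + 1)` is the limit. -/
def omegaMulIncr : Tm :=
  lam nat fun n =>
    let w := omegaMulRefl n
    con .leCocone ⬝ bsuc (tree w) ⬝ addNatSeq w ⬝ addNatIncr w ⬝ succ zero ⬝
      (con .leSuc ⬝ tree w ⬝ tree w ⬝ treeRefl w)

/-- `ω²`. -/
def omegaSq : Tm := blim (lam nat fun n => omegaMul n) omegaMulIncr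

/-! ### Decidability, semidecidability and countable choice -/

/-- The type of propositions of the universe `U i`. -/
def hProp (i : ℕ) : Tm := sig (i + 1) (U i) fun A => isProp i A

/-- The underlying type of a proposition. -/
def holds (i : ℕ) (P : Tm) : Tm := fst (i + 1) (U i) (fun A => isProp i A) P

/-- The proposition `P` is `α`-decidable: there merely exists a Brouwer tree `y` such that
`P ↔ α ≤ y`. -/
def ordDec (i : ℕ) (α P : Tm) : Tm := ex i brw fun y => iff i P (le α y)

/-- The type of binary digits. -/
def two : Tm := sum 0 unit unit

/-- The digit `1`. -/
def digitOne : Tm := con (.inr 0) ⬝ unit ⬝ unit ⬝ star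

/-- The proposition `P` is semidecidable: there merely exists a binary sequence `s` such that `P`
holds if and only if some digit of `s` is `1`. -/
def semidec (i : ℕ) (P : Tm) : Tm :=
  ex i (nat ⇒ two) fun s => iff i P (ex 0 nat fun k => eq 0 two (s ⬝ k) digitOne)

/-- Countable choice for families of types in `U i`. -/
def countableChoice (i : ℕ) : Tm :=
  pi (nat ⇒ U i) fun B => (pi nat fun n => trunc i (B ⬝ n)) ⇒ trunc i (pi nat fun n => B ⬝ n)

/-- Every `ω²`-decidable proposition is a countable meet of semidecidable propositions. -/
def omegaSqDecIsMeet (i : ℕ) : Tm :=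
  pi (hProp i) fun P => ordDec i omegaSq (holds i P) ⇒
    ex (i + 1) (nat ⇒ hProp i) fun Q =>
      prod (i + 1) (pi nat fun n => semidec i (holds i (Q ⬝ n)))
        (iff (i + 1) (holds i P) (pi nat fun n => holds i (Q ⬝ n)))

/-- `ω²`-decidable propositions are closed under countable meets. -/
def omegaSqDecMeet (i : ℕ) : Tm :=
  pi (nat ⇒ hProp i) fun P => (pi nat fun n => ordDec i omegaSq (holds i (P ⬝ n))) ⇒
    ordDec i omegaSq (pi nat fun n => holds i (P ⬝ n))

end HoTT

-- Why the theorem holds. Since `ω²` is the limit of the `ω·n`, `ω² ≤ y` means that `ω·n ≤ y` for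
-- all `n`. Two facts carry both statements.
--
-- First, under countable choice each `ω·n ≤ y` is semidecidable (`omegaSemidec`), by induction on
-- `y` for all `n` at once: `ω·0 ≤ y` always holds, `ω·(n+1) ≤ 0` never does, `ω·n ≤ suc y` is
-- equivalent to `ω·n ≤ y`, and `ω·(n+1) ≤ lim f` is equivalent to `∃k. ω·n ≤ f k`. The last case is
-- a countable join of semidecidable propositions; choice picks their witnessing sequences and an
-- enumeration of pairs merges these into one. This already gives the first statement, with `Q n`
-- being `ω·n ≤ y`.
--
-- Second, for every binary matrix there is a tree `y` such that all `ω·n ≤ y` if and only if every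
-- row has an entry `1` (`omegaRows`). Read the rows in turn, leaving a row at its first `1`, and
-- let `c t` be the row that is read at time `t`. The sequence `t ↦ ω·(c t) + t` is strictly
-- increasing, and its limit is above all `ω·n` exactly when the search reaches every row. For the
-- second statement, choose trees `y n` with `P n ↔ ω² ≤ y n`; then `∀n. P n` is the meet of the
-- semidecidable `ω·m ≤ y n` over all pairs, and choice turns these into a matrix (`supMeet`).
--
-- The facts about the order come from an encode-decode argument. For fixed `X`, a family `L` of
-- propositions, to be thought of as `X < y`, is defined by recursion on `y` (`strictBelow`): it is
-- false at zero, `X ≤ y` at `suc y`, and `∃k. L (f k)` at `lim f`. Univalence makes the clauses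
-- respect bisimilar limits, and the simultaneous elimination makes `L` monotone. Hence `suc x ≤ 0`
-- is absurd, `suc` reflects the order, and `suc x ≤ lim f` gives some `k` with `suc x ≤ f k`.
--
-- How the theory is made to prove this. A type checker for raw terms is defined and proved sound
-- for the judgments. The arguments are written in a surface language, refined to raw terms by
-- untrusted heuristics whose output is rechecked, and evaluated by the kernel. Universe levels are
-- codes that may mention a parameter, so that one evaluation covers every level. The argument is
-- carried out for an abstract sequence with the order properties of `n ↦ ω·n`, and is transferred
-- to the raw term `ω²` at the end.

noncomputable section

namespace HoTT

/-! ### Efficient operations on raw terms -/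

/-- Shift by `k` the variables from the cutoff `c` on. -/
def Term.lift (k c : ℕ) (t : Term) : Term :=
  Term.rec (motive := fun _ => ℕ → Term)
    (fun n c => Bool.rec (.var n) (.var (n + k)) (Nat.ble c n))
    (fun i _ => .univ i)
    (fun _ _ A B c => .pi (A c) (B (c + 1)))
    (fun _ _ A B c => .lam (A c) (B (c + 1)))
    (fun _ _ f a c => .app (f c) (a c))
    (fun d _ => .const d) t c

/-- The term at a position of a substitution; a variable beyond its end is lowered. -/
def nthTerm : List Term → ℕ → Term
  | [], n => .var n
  | a :: _, 0 => a
  | _ :: σ, n + 1 => nthTerm σ n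

/-- Parallel substitution of the terms of `σ` for the variables from `c` on. The variables beyond
`σ` are lowered by the length of `σ`. -/
def Term.psub (σ : List Term) (c : ℕ) (t : Term) : Term :=
  Term.rec (motive := fun _ => ℕ → Term)
    (fun n c => Bool.rec (.var n) (Term.lift c 0 (nthTerm σ (n - c))) (Nat.ble c n))
    (fun i _ => .univ i)
    (fun _ _ A B c => .pi (A c) (B (c + 1)))
    (fun _ _ A B c => .lam (A c) (B (c + 1)))
    (fun _ _ f a c => .app (f c) (a c))
    (fun d _ => .const d) t c

/-- An injective code of the constants. -/
def Const.code : Const → ℕ × ℕ × ℕ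
  | .id i => (0, i, 0) | .refl i => (1, i, 0) | .idElim i j => (2, i, j)
  | .sigma i => (3, i, 0) | .pair i => (4, i, 0) | .sigmaElim i j => (5, i, j)
  | .sum i => (6, i, 0) | .inl i => (7, i, 0) | .inr i => (8, i, 0) | .sumElim i j => (9, i, j)
  | .empty => (10, 0, 0) | .emptyElim j => (11, j, 0)
  | .unit => (12, 0, 0) | .star => (13, 0, 0) | .unitElim j => (14, j, 0)
  | .nat => (15, 0, 0) | .zero => (16, 0, 0) | .succ => (17, 0, 0) | .natElim j => (18, j, 0)
  | .funext i => (19, i, 0) | .univalence i => (20, i, 0)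
  | .trunc i => (21, i, 0) | .tr i => (22, i, 0) | .squash i => (23, i, 0)
  | .truncRec i j => (24, i, j)
  | .brw => (25, 0, 0) | .le => (26, 0, 0)
  | .bzero => (27, 0, 0) | .bsuc => (28, 0, 0) | .blim => (29, 0, 0) | .bisim => (30, 0, 0)
  | .brwSet => (31, 0, 0)
  | .leZero => (32, 0, 0) | .leTrans => (33, 0, 0) | .leSuc => (34, 0, 0)
  | .leCocone => (35, 0, 0) | .leLimiting => (36, 0, 0) | .leProp => (37, 0, 0)
  | .brwElim j => (38, j, 0) | .leElim j => (39, j, 0)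

def codeBeq (p q : ℕ × ℕ × ℕ) : Bool :=
  Nat.beq p.1 q.1 && (Nat.beq p.2.1 q.2.1 && Nat.beq p.2.2 q.2.2)

/-- Whether two terms are equal. -/
def Term.eqb (t : Term) : Term → Bool :=
  Term.rec (motive := fun _ => Term → Bool)
    (fun n u => Term.rec (fun m => Nat.beq n m) (fun _ => false) (fun _ _ _ _ => false)
      (fun _ _ _ _ => false) (fun _ _ _ _ => false) (fun _ => false) u)
    (fun n u => Term.rec (fun _ => false) (fun m => Nat.beq n m) (fun _ _ _ _ => false)
      (fun _ _ _ _ => false) (fun _ _ _ _ => false) (fun _ => false) u)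
    (fun _ _ A B u => Term.rec (fun _ => false) (fun _ => false)
      (fun A' B' _ _ => Bool.rec false (B B') (A A'))
      (fun _ _ _ _ => false) (fun _ _ _ _ => false) (fun _ => false) u)
    (fun _ _ A B u => Term.rec (fun _ => false) (fun _ => false) (fun _ _ _ _ => false)
      (fun A' B' _ _ => Bool.rec false (B B') (A A'))
      (fun _ _ _ _ => false) (fun _ => false) u)
    (fun _ _ A B u => Term.rec (fun _ => false) (fun _ => false) (fun _ _ _ _ => false)
      (fun _ _ _ _ => false)
      (fun A' B' _ _ => Bool.rec false (B B') (A A')) (fun _ => false) u)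
    (fun c u => Term.rec (fun _ => false) (fun _ => false) (fun _ _ _ _ => false)
      (fun _ _ _ _ => false) (fun _ _ _ _ => false) (fun d => codeBeq c.code d.code) u) t

/-! ### Level codes -/

/-- A code below `8` is a numeral, the code `8 + k` is `i + k` for a parameter `i`. -/
def lvl (i n : ℕ) : ℕ := if n < 8 then n else i + (n - 8)

/-- Whether the level `a` is at most `b` for all values of the parameter. -/
def lvlLe (a b : ℕ) : Bool :=
  bif Nat.ble 8 a then Nat.ble a b else bif Nat.ble 8 b then Nat.ble (a + 8) b else Nat.ble a b

/-! ### A type checker -/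

/-- The result of a checker; an error carries a code and some terms for diagnosis. -/
inductive Res (α : Type) : Type
  | ok (a : α)
  | err (n : ℕ) (l : List Term)

def Res.bind {α β : Type} (x : Res α) (f : α → Res β) : Res β :=
  Res.rec f (fun n l => .err n l) x

abbrev Ctx := List Term

/-- The type of a variable, shifted by `k` more than its position. -/
def lookupAt : ℕ → Ctx → ℕ → Res Term
  | _, [], _ => .err 1 []
  | k, A :: _, 0 => .ok (A.lift (k + 1) 0)
  | k, _ :: Γ, n + 1 => lookupAt (k + 1) Γ n

/-- An upper bound of two levels. -/
def lvlMax (a b : ℕ) : Res ℕ :=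
  bif lvlLe a b then .ok b else bif lvlLe b a then .ok a else
    -- Two levels are incomparable only if one is a numeral `m` and the other is `i + k` with `k <
    -- m`; then `i + m`, whose code is `m + 8`, bounds both.
    let c := (bif Nat.ble 8 a then b else a) + 8
    bif lvlLe a c && lvlLe b c then .ok c else .err 2 [.univ a, .univ b]

/-- The code `7` has no successor: `8` would be read as the parameter. -/
def lvlSucc (a : ℕ) : Res ℕ := bif Nat.beq a 7 then .err 3 [] else .ok (a + 1)

/-- Only the type of univalence mentions the successor of a level. The call of `lvlSucc` rules out
the one code for which forming the type and interpreting the codes would not commute. -/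
def inferConst (c : Const) : Res Term :=
  match c with
  | .univalence i => (lvlSucc i).bind fun _ => .ok (constType (.univalence i))
  | c => .ok (constType c)

/-- A judgmental equality `lhs ≡ rhs : type` in the context `ctx`. -/
structure Rule where
  ctx : Ctx
  lhs : Term
  rhs : Term
  type : Term

/-- The head constant of a term together with its arguments, the last one first. -/
def Term.spine : Term → List Term → Option (Const × List Term)
  | .app f a, l => f.spine (a :: l)
  | .const c, l => some (c, l)
  | _, _ => none

/-- The mutually recursive functions of the type checker, all of which use bounded fuel. -/
structure Fns where
  infer : Ctx → Term → Res Term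
  check : Ctx → Term → Term → Res Unit
  red : Ctx → Term → Res (Option (Term × Term))
  whnf : Ctx → Term → Res (Term × Option Term)
  conv : Ctx → Term → Term → Term → Res Unit
  convI : Ctx → Term → Term → Res Term

/-- A table of computation rules: the rule for an eliminator (with its arguments but the last) and
a last argument in constructor form, and the terms to be substituted in it. -/
abbrev Rules := Const → List Term → Const → List Term → Option (Rule × List Term)

/-- The number of arguments of an eliminator before the last one. -/
def elimArity : Const → Option ℕ
  | .idElim _ _ => some 5
  | .natElim _ => some 3
  | .sigmaElim _ _ => some 4
  | .sumElim _ _ => some 5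
  | .brwElim _ => some 13
  | _ => none

/-- A reduction is accepted only if its type is a universe, because the conversion rule asks for an
equality of types. -/
def univOf (T : Term) (r : Term × Option Term) : Res ℕ :=
  match r with
  | (.univ i, some (.univ _)) => .ok i
  | _ => .err 4 [T]

def Fns.asUniv (F : Fns) (Γ : Ctx) (T : Term) : Res ℕ :=
  let other := fun _ : Unit => (F.whnf Γ T).bind (univOf T)
  Term.rec (motive := fun _ => Unit → Res ℕ) (fun _ => other) (fun i _ => .ok i)
    (fun _ _ _ _ => other) (fun _ _ _ _ => other) (fun _ _ _ _ => other) (fun _ => other) T ()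

def Fns.sort (F : Fns) (Γ : Ctx) (A : Term) : Res ℕ :=
  (F.infer Γ A).bind (F.asUniv Γ)

def piOf (T : Term) (r : Term × Option Term) : Res (Term × Term) :=
  match r with
  | (.pi A B, some (.univ _)) => .ok (A, B)
  | _ => .err 5 [T]

def Fns.asPi (F : Fns) (Γ : Ctx) (T : Term) : Res (Term × Term) :=
  let other := fun _ : Unit => (F.whnf Γ T).bind (piOf T)
  Term.rec (motive := fun _ => Unit → Res (Term × Term)) (fun _ => other) (fun _ => other)
    (fun A B _ _ _ => .ok (A, B)) (fun _ _ _ _ => other) (fun _ _ _ _ => other) (fun _ => other)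
    T ()

def Fns.convT (F : Fns) (Γ : Ctx) (A B : Term) : Res Unit :=
  (F.sort Γ A).bind fun i => (F.sort Γ B).bind fun j => (lvlMax i j).bind fun k =>
    F.conv Γ A B (.univ k)

def Fns.castUniv (F : Fns) (Γ : Ctx) (T : Term) (j : ℕ) : Res Unit :=
  (F.asUniv Γ T).bind fun i => cond (lvlLe i j) (.ok ()) (.err 17 [T, .univ j])

def Fns.castNe (F : Fns) (Γ : Ctx) (T A : Term) : Res Unit :=
  match A with
  | .univ j => F.castUniv Γ T j
  | A => F.convT Γ T A

def Fns.cast (F : Fns) (Γ : Ctx) (T A : Term) : Res Unit :=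
  Bool.rec (F.castNe Γ T A) (.ok ()) (Term.eqb T A)

/-- Parallel substitution, which does nothing for an empty list. -/
def Term.sub (σ : List Term) (t : Term) : Term :=
  List.rec t (fun _ _ _ => t.psub σ 0) σ

/-- What is known about a term: its type, its type as an application together with terms that are
to be substituted in it, and whether it has a given type. -/
structure Judge where
  infer : Ctx → Res Term
  spine : Ctx → Res (Term × List Term)
  check : Ctx → Term → Res Unit

def Fns.judgeOf (F : Fns) (x : Ctx → Res Term) : Judge where
  infer := x
  spine Γ := (x Γ).bind fun T => .ok (T, [])
  check Γ A := (x Γ).bind fun T => F.cast Γ T A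

def Fns.sortOf (F : Fns) (Γ : Ctx) (x : Res Term) : Res ℕ := x.bind (F.asUniv Γ)

def inferUniv (i : ℕ) : Res Term := (lvlSucc i).bind fun j => .ok (.univ j)

def Fns.inferPi (F : Fns) (A : Term) (x y : Judge) (Γ : Ctx) : Res Term :=
  (F.sortOf Γ (x.infer Γ)).bind fun i => (F.sortOf (A :: Γ) (y.infer (A :: Γ))).bind fun j =>
    (lvlMax i j).bind fun k => .ok (.univ k)

def Fns.inferLam (F : Fns) (A : Term) (x y : Judge) (Γ : Ctx) : Res Term :=
  (F.sortOf Γ (x.infer Γ)).bind fun _ => (y.infer (A :: Γ)).bind fun B => .ok (.pi A B)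

/-- Whether the domain `A` may replace that of a function type. -/
def Fns.domain (F : Fns) (Γ : Ctx) (A : Term) (p : Term × Term) : Res Unit :=
  bif Term.eqb A p.1 then .ok ()
  else (F.convT Γ A p.1).bind fun _ => (F.sort (A :: Γ) p.2).bind fun _ => .ok ()

def Fns.checkLam (F : Fns) (A' : Term) (x y : Judge) (Γ : Ctx) (A : Term) : Res Unit :=
  (F.asPi Γ A).bind fun p => (F.sortOf Γ (x.infer Γ)).bind fun _ =>
    (F.domain Γ A' p).bind fun _ => y.check (A' :: Γ) p.2

def Fns.judgeLam (F : Fns) (A : Term) (x y : Judge) : Judge where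
  infer := F.inferLam A x y
  spine Γ := (F.inferLam A x y Γ).bind fun T => .ok (T, [])
  check := F.checkLam A x y

/-- The codomain is kept unsubstituted together with the list of arguments, so that an iterated
application costs one parallel substitution instead of one for each argument. -/
def Judge.applyPi (y : Judge) (Γ : Ctx) (a A B : Term) (σ : List Term) :
    Res (Term × List Term) :=
  (y.check Γ (A.sub σ)).bind fun _ => .ok (B, a :: σ)

def Fns.applyTy (F : Fns) (y : Judge) (Γ : Ctx) (a T : Term) : Res (Term × List Term) :=
  (F.asPi Γ T).bind fun p => (y.check Γ p.1).bind fun _ => .ok (p.2, [a])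

def Fns.applyTo (F : Fns) (y : Judge) (Γ : Ctx) (a : Term) (q : Term × List Term) :
    Res (Term × List Term) :=
  match q.1 with
  | .pi A B => y.applyPi Γ a A B q.2
  | T => F.applyTy y Γ a (T.sub q.2)

def Fns.judgeApp (F : Fns) (a : Term) (x y : Judge) : Judge where
  infer Γ := ((x.spine Γ).bind (F.applyTo y Γ a)).bind fun q => .ok (q.1.sub q.2)
  spine Γ := (x.spine Γ).bind (F.applyTo y Γ a)
  check Γ A := ((x.spine Γ).bind (F.applyTo y Γ a)).bind fun q => F.cast Γ (q.1.sub q.2) A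

/-- The recursion is structural in `t`. Only the questions about conversion and reduction go to `F`,
so that fuel is not spent on the size of terms. -/
def Fns.judge (F : Fns) (t : Term) : Judge :=
  Term.rec (fun n => F.judgeOf fun Γ => lookupAt 0 Γ n) (fun i => F.judgeOf fun _ => inferUniv i)
    (fun A _ x y => F.judgeOf (F.inferPi A x y)) (fun A _ x y => F.judgeLam A x y)
    (fun _ a x y => F.judgeApp a x y) (fun c => F.judgeOf fun _ => inferConst c) t

/-- Check the terms `σ` against the context `Δ`. -/
def Fns.checkSub (F : Fns) (Γ : Ctx) : Ctx → List Term → Res Unit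
  | [], [] => .ok ()
  | A :: Δ, a :: σ => (F.checkSub Γ Δ σ).bind fun _ => F.check Γ a (A.psub σ 0)
  | _, _ => .err 6 []

def Fns.redS (F : Fns) (R : Rules) (Γ : Ctx) (t : Term) : Res (Option (Term × Term)) :=
  match t with
  | .app f a =>
    match f with
    | .lam A b => (F.sort Γ A).bind fun _ => (F.check Γ a A).bind fun _ =>
        (F.infer (A :: Γ) b).bind fun B => .ok (some (b.psub [a] 0, B.psub [a] 0))
    | f =>
      match f.spine [] with
      | none =>
        (F.red Γ f).bind fun r =>
          match r with
          | none => .ok none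
          | some (f', S) => (F.asPi Γ S).bind fun p => (F.check Γ a p.1).bind fun _ =>
              .ok (some (.app f' a, p.2.psub [a] 0))
      | some (c, l) =>
        match elimArity c with
        | none => .ok none
        | some n =>
          bif Nat.beq n l.length then
            -- All arguments but the last are parameters, motives and methods; a computation rule
            -- can apply only once the last argument is a constructor, so that argument is reduced
            -- first.
            (F.whnf Γ a).bind fun r =>
              match r with
              | (a', some S) =>
                (F.infer Γ f).bind fun T => (F.asPi Γ T).bind fun p =>
                  (F.cast Γ S p.1).bind fun _ => .ok (some (.app f a', p.2.psub [a] 0))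
              | (_, none) =>
                match a.spine [] with
                | none => .ok none
                | some (d, m) =>
                  match R c l d m with
                  | none => .ok none
                  | some (ρ, σ) =>
                    (F.checkSub Γ ρ.ctx σ).bind fun _ =>
                      -- The matching done by the table of rules is not trusted: the substitution
                      -- has been checked against the context of the rule, and here the instance of
                      -- the left side is compared with `t`.
                      bif Term.eqb t (ρ.lhs.psub σ 0) then
                        .ok (some (ρ.rhs.psub σ 0, ρ.type.psub σ 0))
                      else .err 7 [t, ρ.lhs.psub σ 0]
          else bif Nat.ble n l.length then
            (F.red Γ f).bind fun r =>
              match r with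
              | none => .ok none
              | some (f', S) => (F.asPi Γ S).bind fun p => (F.check Γ a p.1).bind fun _ =>
                  .ok (some (.app f' a, p.2.psub [a] 0))
          else .ok none
  | _ => .ok none

def Fns.whnfS (F : Fns) (Γ : Ctx) (t : Term) : Res (Term × Option Term) :=
  (F.red Γ t).bind fun r =>
    match r with
    | none => .ok (t, none)
    | some (t₁, T₁) =>
      (F.whnf Γ t₁).bind fun r₂ =>
        match r₂ with
        | (_, none) => .ok (t₁, some T₁)
        | (t₂, some T₂) => (F.cast Γ T₂ T₁).bind fun _ => .ok (t₂, some T₁)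

def Fns.castO (F : Fns) (Γ : Ctx) (o : Option Term) (A : Term) : Res Unit :=
  match o with
  | none => .ok ()
  | some T => F.cast Γ T A

def Fns.convS (F : Fns) (Γ : Ctx) (t u T : Term) : Res Unit :=
  bif Term.eqb t u then F.check Γ t T
  else
    (F.whnf Γ t).bind fun r => (F.castO Γ r.2 T).bind fun _ =>
    (F.whnf Γ u).bind fun s => (F.castO Γ s.2 T).bind fun _ =>
      match r.1, s.1 with
      | .pi A B, .pi A' B' =>
        match T with
        | .univ k => (F.sort Γ A).bind fun _ => (F.conv Γ A A' (.univ k)).bind fun _ =>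
            F.conv (A :: Γ) B B' (.univ k)
        | T => .err 8 [T]
      | .lam A b, .lam A' b' =>
        (F.asPi Γ T).bind fun p =>
          (F.sort Γ A).bind fun _ => (F.domain Γ A p).bind fun _ =>
            (F.convT Γ A A').bind fun _ => F.conv (A :: Γ) b b' p.2
      | t', u' => (F.convI Γ t' u').bind fun S => F.cast Γ S T

def Fns.convIS (F : Fns) (Γ : Ctx) (t u : Term) : Res Term :=
  bif Term.eqb t u then F.infer Γ t
  else
    match t, u with
    | .app f a, .app f' a' =>
      (F.convI Γ f f').bind fun S => (F.asPi Γ S).bind fun p =>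
        (F.conv Γ a a' p.1).bind fun _ => .ok (p.2.psub [a] 0)
    | t, u => .err 10 (t :: u :: Γ)

def Fns.withJudge (F : Fns) : Fns where
  infer Γ t := (F.judge t).infer Γ
  check Γ t A := (F.judge t).check Γ A
  red := F.red
  whnf := F.whnf
  conv := F.conv
  convI := F.convI

def Fns.withWhnf (F G : Fns) (R : Rules) : Fns where
  infer := F.infer
  check := F.check
  red := G.redS R
  whnf := G.whnfS
  conv := F.conv
  convI := F.convI

def Fns.withConv (F G : Fns) : Fns where
  infer := F.infer
  check := F.check
  red := F.red
  whnf := F.whnf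
  conv := G.convS
  convI := G.convIS

/-- Within one unit of outer fuel, reductions can be nested a hundred times and so can conversions;
they use the typing of `F.withJudge`, whose own conversions have less fuel. -/
def Fns.step (F : Fns) (R : Rules) : Fns :=
  let F₁ := F.withJudge
  let F₂ : Fns := Nat.rec F₁ (fun _ G => F₁.withWhnf G R) 100
  Nat.rec F₂ (fun _ G => F₂.withConv G) 100

def Fns.fail : Fns where
  infer _ _ := .err 0 []
  check _ _ _ := .err 0 []
  red _ _ := .err 0 []
  whnf _ _ := .err 0 []
  conv _ _ _ _ := .err 0 []
  convI _ _ _ := .err 0 []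

def fns (R : Rules) (n : ℕ) : Fns := Nat.rec .fail (fun _ F => F.step R) n

/-! ### Computation rules -/

def peel : Term → Ctx → Ctx × Term
  | .lam A b, Γ => peel b (A :: Γ)
  | t, Γ => (Γ, t)

def peelPi : ℕ → Term → Term
  | n + 1, .pi _ B => peelPi n B
  | _, B => B

/-- The closed terms of a computation rule `lhs ≡ rhs : type`. -/
structure Closed where
  lhs : Term
  rhs : Term
  type : Term

/-- The theory states its computation rules for closed abstractions, whereas reduction needs the
open equality, in the context of the abstracted parameters. -/
def Rule.ofComp (x : Closed) : Rule :=
  let p := peel x.lhs []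
  ⟨p.1, p.2, (peel x.rhs []).2, peelPi p.1.length x.type⟩
def idComp (i j : ℕ) : Closed where
  lhs := (idTel i j lam fun A a C c => con (.idElim i j) ⬝ A ⬝ a ⬝ C ⬝ c ⬝ a ⬝ refl i A a).close
  rhs := (idTel i j lam fun _ _ _ c => c).close
  type := (idTel i j pi fun A a C _ => C ⬝ a ⬝ refl i A a).close

def idRule (i j : ℕ) : Rule := .ofComp (idComp i j)

def natZeroComp (j : ℕ) : Closed where
  lhs := (natTel j lam fun C z s => con (.natElim j) ⬝ C ⬝ z ⬝ s ⬝ zero).close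
  rhs := (natTel j lam fun _ z _ => z).close
  type := (natTel j pi fun C _ _ => C ⬝ zero).close

def natZeroRule (j : ℕ) : Rule := .ofComp (natZeroComp j)

def natSuccComp (j : ℕ) : Closed where
  lhs := (natTel j lam fun C z s => lam nat fun n => con (.natElim j) ⬝ C ⬝ z ⬝ s ⬝ succ n).close
  rhs := (natTel j lam fun C z s => lam nat fun n =>
        s ⬝ n ⬝ (con (.natElim j) ⬝ C ⬝ z ⬝ s ⬝ n)).close
  type := (natTel j pi fun C _ _ => pi nat fun n => C ⬝ succ n).close

def natSuccRule (j : ℕ) : Rule := .ofComp (natSuccComp j)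

def sigmaComp (i j : ℕ) : Closed where
  lhs := (sigmaTel i j lam fun A B C g => lam A fun a => lam (B ⬝ a) fun b =>
        con (.sigmaElim i j) ⬝ A ⬝ B ⬝ C ⬝ g ⬝ (con (.pair i) ⬝ A ⬝ B ⬝ a ⬝ b)).close
  rhs := (sigmaTel i j lam fun A B _ g => lam A fun a => lam (B ⬝ a) fun b => g ⬝ a ⬝ b).close
  type := (sigmaTel i j pi fun A B C _ => pi A fun a => pi (B ⬝ a) fun b =>
        C ⬝ (con (.pair i) ⬝ A ⬝ B ⬝ a ⬝ b)).close

def sigmaRule (i j : ℕ) : Rule := .ofComp (sigmaComp i j)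

def inlComp (i j : ℕ) : Closed where
  lhs := (sumTel i j lam fun A B C g h => lam A fun a =>
        con (.sumElim i j) ⬝ A ⬝ B ⬝ C ⬝ g ⬝ h ⬝ (con (.inl i) ⬝ A ⬝ B ⬝ a)).close
  rhs := (sumTel i j lam fun A _ _ g _ => lam A fun a => g ⬝ a).close
  type := (sumTel i j pi fun A B C _ _ => pi A fun a => C ⬝ (con (.inl i) ⬝ A ⬝ B ⬝ a)).close

def inlRule (i j : ℕ) : Rule := .ofComp (inlComp i j)

def inrComp (i j : ℕ) : Closed where
  lhs := (sumTel i j lam fun A B C g h => lam B fun b =>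
        con (.sumElim i j) ⬝ A ⬝ B ⬝ C ⬝ g ⬝ h ⬝ (con (.inr i) ⬝ A ⬝ B ⬝ b)).close
  rhs := (sumTel i j lam fun _ B _ _ h => lam B fun b => h ⬝ b).close
  type := (sumTel i j pi fun A B C _ _ => pi B fun b => C ⬝ (con (.inr i) ⬝ A ⬝ B ⬝ b)).close

def inrRule (i j : ℕ) : Rule := .ofComp (inrComp i j)

def brwZeroComp (j : ℕ) : Closed where
  lhs := (brwTel j lam fun m => brwElim j m bzero).close
  rhs := (brwTel j lam fun m => m.zero).close
  type := (brwTel j pi fun m => m.C ⬝ bzero).close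

def brwZeroRule (j : ℕ) : Rule := .ofComp (brwZeroComp j)

def brwSucComp (j : ℕ) : Closed where
  lhs := (brwTel j lam fun m => lam brw fun x => brwElim j m (bsuc x)).close
  rhs := (brwTel j lam fun m => lam brw fun x => m.suc ⬝ x ⬝ brwElim j m x).close
  type := (brwTel j pi fun m => pi brw fun x => m.C ⬝ bsuc x).close

def brwSucRule (j : ℕ) : Rule := .ofComp (brwSucComp j)

def brwLimComp (j : ℕ) : Closed where
  lhs := (brwTel j lam fun m => lam (nat ⇒ brw) fun f => lam (increasing f) fun u =>
        brwElim j m (blim f u)).close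
  rhs := (brwTel j lam fun m => lam (nat ⇒ brw) fun f => lam (increasing f) fun u =>
        m.lim ⬝ f ⬝ u ⬝ (lam nat fun n => brwElim j m (f ⬝ n)) ⬝
          (lam nat fun n => leElim j m (bsuc (f ⬝ n)) (f ⬝ succ n) (u ⬝ n))).close
  type := (brwTel j pi fun m => pi (nat ⇒ brw) fun f => pi (increasing f) fun u =>
        m.C ⬝ blim f u).close

def brwLimRule (j : ℕ) : Rule := .ofComp (brwLimComp j)

/-- The computation rules used by the type checker. -/
def rules : Rules := fun c l d m =>
  match c with
  | .idElim i j =>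
    -- The rules are proved only at these levels. The pair `0`, `1` serves transport along
    -- equalities of trees in a family of codes of propositions.
    bif Nat.beq i j || (Nat.beq i 0 && Nat.beq j 1) then
      match d with
      -- The endpoint, which is the last argument before the path, is dropped: in the rule it is the
      -- base point, and the comparison made by `Fns.redS` enforces this.
      | .refl _ => match m with | [_, _] => some (idRule i j, l.reverse.tail) | _ => none
      | _ => none
    else none
  | .natElim j =>
    match d with
    | .zero => match m with | [] => some (natZeroRule j, l.reverse) | _ => none
    | .succ => match m with | [n] => some (natSuccRule j, n :: l.reverse) | _ => none
    | _ => none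
  | .sigmaElim i j =>
    bif Nat.beq i j then
      match d with
      | .pair _ =>
        match m with
        | [_, _, a, b] => some (sigmaRule i j, b :: a :: l.reverse)
        | _ => none
      | _ => none
    else none
  | .sumElim i j =>
    bif Nat.beq i 0 then
      match d with
      | .inl _ => match m with | [_, _, a] => some (inlRule i j, a :: l.reverse) | _ => none
      | .inr _ => match m with | [_, _, a] => some (inrRule i j, a :: l.reverse) | _ => none
      | _ => none
    else none
  | .brwElim j =>
    match d with
    | .bzero => match m with | [] => some (brwZeroRule j, l.reverse) | _ => none
    | .bsuc => match m with | [n] => some (brwSucRule j, n :: l.reverse) | _ => none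
    | .blim => match m with | [f, u] => some (brwLimRule j, u :: f :: l.reverse) | _ => none
    | _ => none
  | _ => none
/-! ### Substitution calculus -/

@[simp] theorem Term.lift_var (k c n : ℕ) :
    (Term.var n).lift k c = bif Nat.ble c n then .var (n + k) else .var n := by
  unfold Term.lift
  dsimp only
  cases Nat.ble c n <;> rfl

@[simp] theorem Term.lift_univ (k c i : ℕ) : (Term.univ i).lift k c = .univ i := rfl
@[simp] theorem Term.lift_pi (k c : ℕ) (A B : Term) :
    (Term.pi A B).lift k c = .pi (A.lift k c) (B.lift k (c + 1)) := rfl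
@[simp] theorem Term.lift_lam (k c : ℕ) (A B : Term) :
    (Term.lam A B).lift k c = .lam (A.lift k c) (B.lift k (c + 1)) := rfl
@[simp] theorem Term.lift_app (k c : ℕ) (A B : Term) :
    (Term.app A B).lift k c = .app (A.lift k c) (B.lift k c) := rfl
@[simp] theorem Term.lift_const (k c : ℕ) (d : Const) : (Term.const d).lift k c = .const d := rfl

theorem Term.lift_eq_rename (k : ℕ) (t : Term) :
    ∀ c, t.lift k c = t.rename (fun n => if c ≤ n then n + k else n) := by
  have up (c : ℕ) : upRen (fun n => if c ≤ n then n + k else n) =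
      fun n => if c + 1 ≤ n then n + k else n := by
    funext n
    cases n with
    | zero => simp [upRen]
    | succ n => by_cases h : c ≤ n <;> simp [upRen, h]; omega
  induction t with
  | var n =>
    intro c
    by_cases h : c ≤ n
    · simp [Term.rename, h, Nat.ble_eq.mpr h]
    · have : Nat.ble c n = false := by rw [← Bool.not_eq_true, Nat.ble_eq]; exact h
      simp [Term.rename, h, this]
  | univ i => intro c; rfl
  | pi A B hA hB => intro c; simp [Term.rename, hA, hB, up]
  | lam A B hA hB => intro c; simp [Term.rename, hA, hB, up]
  | app A B hA hB => intro c; simp [Term.rename, hA, hB]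
  | const d => intro c; rfl

theorem Term.lift_one (t : Term) : t.lift 1 0 = t.shift := by
  simp [Term.lift_eq_rename, Term.shift]

theorem upRen_comp (ρ τ : ℕ → ℕ) : upRen (fun n => ρ (τ n)) = fun n => upRen ρ (upRen τ n) := by
  funext n; cases n <;> rfl

theorem Term.rename_rename (t : Term) :
    ∀ ρ τ : ℕ → ℕ, (t.rename τ).rename ρ = t.rename fun n => ρ (τ n) := by
  induction t with
  | var n => intro ρ τ; rfl
  | univ i => intro ρ τ; rfl
  | pi A B hA hB => intro ρ τ; simp [Term.rename, hA, hB, upRen_comp]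
  | lam A B hA hB => intro ρ τ; simp [Term.rename, hA, hB, upRen_comp]
  | app A B hA hB => intro ρ τ; simp [Term.rename, hA, hB]
  | const d => intro ρ τ; rfl

theorem Term.lift_zero (t : Term) : t.lift 0 0 = t := by
  have up : upRen id = id := by funext n; cases n <;> rfl
  rw [Term.lift_eq_rename]
  have h : (fun n : ℕ => if 0 ≤ n then n + 0 else n) = id := by funext n; simp
  rw [h]
  induction t with
  | var n => rfl
  | univ i => rfl
  | pi A B hA hB => simp [Term.rename, hA, hB, up]
  | lam A B hA hB => simp [Term.rename, hA, hB, up]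
  | app A B hA hB => simp [Term.rename, hA, hB]
  | const d => rfl

theorem Term.lift_lift (t : Term) (k l : ℕ) : (t.lift k 0).lift l 0 = t.lift (k + l) 0 := by
  simp [Term.lift_eq_rename, Term.rename_rename, Nat.add_assoc]

theorem upSub_rename (σ : ℕ → Term) (ρ : ℕ → ℕ) :
    upSub (fun n => σ (ρ n)) = fun n => upSub σ (upRen ρ n) := by
  funext n; cases n <;> rfl

theorem Term.rename_subst (t : Term) :
    ∀ (σ : ℕ → Term) (ρ : ℕ → ℕ), (t.rename ρ).subst σ = t.subst fun n => σ (ρ n) := by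
  induction t with
  | var n => intro σ ρ; rfl
  | univ i => intro σ ρ; rfl
  | pi A B hA hB => intro σ ρ; simp [Term.rename, Term.subst, hA, hB, upSub_rename]
  | lam A B hA hB => intro σ ρ; simp [Term.rename, Term.subst, hA, hB, upSub_rename]
  | app A B hA hB => intro σ ρ; simp [Term.rename, Term.subst, hA, hB]
  | const d => intro σ ρ; rfl

theorem rename_upSub (σ : ℕ → Term) (ρ : ℕ → ℕ) :
    upSub (fun n => (σ n).rename ρ) = fun n => (upSub σ n).rename (upRen ρ) := by
  funext n
  cases n with
  | zero => rfl
  | succ n => simp [upSub, Term.shift, Term.rename_rename, upRen]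

theorem Term.subst_rename (t : Term) :
    ∀ (σ : ℕ → Term) (ρ : ℕ → ℕ), (t.subst σ).rename ρ = t.subst fun n => (σ n).rename ρ := by
  induction t with
  | var n => intro σ ρ; rfl
  | univ i => intro σ ρ; rfl
  | pi A B hA hB => intro σ ρ; simp [Term.rename, Term.subst, hA, hB, rename_upSub]
  | lam A B hA hB => intro σ ρ; simp [Term.rename, Term.subst, hA, hB, rename_upSub]
  | app A B hA hB => intro σ ρ; simp [Term.rename, Term.subst, hA, hB]
  | const d => intro σ ρ; rfl

theorem Term.shift_subst (t : Term) (σ : ℕ → Term) :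
    t.shift.subst σ = t.subst fun n => σ (n + 1) := t.rename_subst σ Nat.succ

theorem Term.shift_subst_up (t : Term) (σ : ℕ → Term) :
    t.shift.subst (upSub σ) = (t.subst σ).shift := by
  rw [Term.shift_subst, Term.shift, Term.subst_rename]; rfl

theorem upSub_subst (σ τ : ℕ → Term) :
    upSub (fun n => (σ n).subst τ) = fun n => (upSub σ n).subst (upSub τ) := by
  funext n
  cases n with
  | zero => rfl
  | succ n => exact ((σ n).shift_subst_up τ).symm

theorem Term.subst_subst (t : Term) :
    ∀ σ τ : ℕ → Term, (t.subst σ).subst τ = t.subst fun n => (σ n).subst τ := by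
  induction t with
  | var n => intro σ τ; rfl
  | univ i => intro σ τ; rfl
  | pi A B hA hB => intro σ τ; simp [Term.subst, hA, hB, upSub_subst]
  | lam A B hA hB => intro σ τ; simp [Term.subst, hA, hB, upSub_subst]
  | app A B hA hB => intro σ τ; simp [Term.subst, hA, hB]
  | const d => intro σ τ; rfl

theorem Term.subst_var (t : Term) : t.subst .var = t := by
  have up : upSub .var = .var := by funext n; cases n <;> rfl
  induction t with
  | var n => rfl
  | univ i => rfl
  | pi A B hA hB => simp [Term.subst, hA, hB, up]
  | lam A B hA hB => simp [Term.subst, hA, hB, up]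
  | app A B hA hB => simp [Term.subst, hA, hB]
  | const d => rfl

/-- Extend a substitution by one term. -/
def consSub (a : Term) (σ : ℕ → Term) : ℕ → Term
  | 0 => a
  | n + 1 => σ n

theorem Term.inst_subst (b a : Term) (σ : ℕ → Term) :
    (b.inst a).subst σ = b.subst (consSub (a.subst σ) σ) := by
  rw [Term.inst, Term.subst_subst]
  congr 1
  funext n; cases n <;> rfl

theorem Term.subst_up_inst (b a : Term) (σ : ℕ → Term) :
    (b.subst (upSub σ)).inst a = b.subst (consSub a σ) := by
  rw [Term.inst, Term.subst_subst]
  congr 1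
  funext n
  cases n with
  | zero => rfl
  | succ n => exact ((σ n).shift_subst _).trans (σ n).subst_var

theorem Term.inst_subst' (b a : Term) (σ : ℕ → Term) :
    (b.inst a).subst σ = (b.subst (upSub σ)).inst (a.subst σ) := by
  rw [Term.inst_subst, Term.subst_up_inst]

theorem Term.shift_subst_cons (t a : Term) (σ : ℕ → Term) :
    t.shift.subst (consSub a σ) = t.subst σ := t.shift_subst _

/-- The substitution performed by `Term.psub σ 0`. -/
def listSub (σ : List Term) (n : ℕ) : Term := nthTerm σ n

theorem Term.psub_eq_subst (σ : List Term) (t : Term) : ∀ c, t.psub σ c =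
    t.subst (fun n => if c ≤ n then (nthTerm σ (n - c)).lift c 0 else .var n) := by
  have up (c : ℕ) : upSub (fun n => if c ≤ n then (nthTerm σ (n - c)).lift c 0 else .var n) =
      fun n => if c + 1 ≤ n then (nthTerm σ (n - (c + 1))).lift (c + 1) 0 else .var n := by
    funext n
    cases n with
    | zero => simp [upSub]
    | succ n =>
      by_cases h : c ≤ n
      · simp [upSub, h, ← Term.lift_one, Term.lift_lift]
      · simp [upSub, h, Term.shift, Term.rename]
  induction t with
  | var n =>
    intro c
    by_cases h : c ≤ n
    · simp [Term.psub, Term.subst, h, Nat.ble_eq.mpr h]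
    · have : Nat.ble c n = false := by rw [← Bool.not_eq_true, Nat.ble_eq]; exact h
      simp [Term.psub, Term.subst, h, this]
  | univ i => intro c; rfl
  | pi A B hA hB =>
    intro c
    change Term.pi (A.psub σ c) (B.psub σ (c + 1)) = _
    simp [Term.subst, hA, hB, up]
  | lam A B hA hB =>
    intro c
    change Term.lam (A.psub σ c) (B.psub σ (c + 1)) = _
    simp [Term.subst, hA, hB, up]
  | app A B hA hB =>
    intro c
    change Term.app (A.psub σ c) (B.psub σ c) = _
    simp [Term.subst, hA, hB]
  | const d => intro c; rfl

theorem Term.psub_zero (σ : List Term) (t : Term) : t.psub σ 0 = t.subst (listSub σ) := by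
  simp [Term.psub_eq_subst, Term.lift_zero]
  rfl

theorem Term.psub_singleton (a t : Term) : t.psub [a] 0 = t.inst a := by
  rw [Term.psub_zero, Term.inst]
  congr 1
  funext n; cases n <;> rfl

theorem listSub_cons (a : Term) (σ : List Term) : listSub (a :: σ) = consSub a (listSub σ) := by
  funext n; cases n <;> rfl

/-! ### Substitution preserves typing -/

/-- Typed substitutions. -/
def SubOK (Δ : List Term) (σ : ℕ → Term) (Γ : List Term) : Prop :=
  ∀ n A, Lookup Γ n A → HasType Δ (σ n) (A.subst σ)

/-- The rule for abstractions types only the body, so the formation of the domain has to be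
recovered from the context. For this reason the types of a context carry their stability under
substitution. -/
def CtxOK : List Term → Prop
  | [] => True
  | A :: Γ => CtxOK Γ ∧ ∃ i, ∀ Δ σ, WfCtx Δ → SubOK Δ σ Γ → HasType Δ (A.subst σ) (.univ i)

theorem SubOK.cons {Δ Γ : List Term} {σ : ℕ → Term} {A a : Term} (h : SubOK Δ σ Γ)
    (ha : HasType Δ a (A.subst σ)) : SubOK Δ (consSub a σ) (A :: Γ) := by
  intro n B hB
  cases hB with
  | here => rw [Term.shift_subst_cons]; exact ha
  | there _ C _ n hn => rw [Term.shift_subst_cons]; exact h _ _ hn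

theorem SubOK.tail {Δ Γ : List Term} {σ : ℕ → Term} {A : Term} (h : SubOK Δ σ (A :: Γ)) :
    SubOK Δ (fun n => σ (n + 1)) Γ := by
  intro n B hB
  rw [← Term.shift_subst]
  exact h _ _ (.there _ _ _ _ hB)

theorem SubOK.up {Δ Γ : List Term} {σ : ℕ → Term} {A : Term} {i : ℕ} (h : SubOK Δ σ Γ)
    (hA : HasType Δ (A.subst σ) (.univ i)) : SubOK (A.subst σ :: Δ) (upSub σ) (A :: Γ) := by
  intro n B hB
  cases hB with
  | here =>
    rw [Term.shift_subst_up]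
    exact .var (.cons hA) (.here _ _)
  | there _ C _ n hn =>
    rw [Term.shift_subst_up]
    exact .weaken (h _ _ hn) hA

/-- The free variables are below `n`. -/
def Term.closedAt : ℕ → Term → Bool
  | n, .var m => Nat.ble (m + 1) n
  | _, .univ _ => true
  | n, .pi A B => A.closedAt n && B.closedAt (n + 1)
  | n, .lam A B => A.closedAt n && B.closedAt (n + 1)
  | n, .app f a => f.closedAt n && a.closedAt n
  | _, .const _ => true

theorem Term.subst_of_closedAt (t : Term) : ∀ (n : ℕ) (σ : ℕ → Term),
    (∀ m < n, σ m = .var m) → t.closedAt n = true → t.subst σ = t := by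
  have up (n : ℕ) (σ : ℕ → Term) (h : ∀ m < n, σ m = .var m) :
      ∀ m < n + 1, upSub σ m = .var m := by
    intro m hm
    cases m with
    | zero => rfl
    | succ m => simp [upSub, h m (by omega), Term.shift, Term.rename]
  induction t with
  | var m => intro n σ h hc; exact h m (Nat.le_of_ble_eq_true hc)
  | univ i => intros; rfl
  | pi A B hA hB =>
    intro n σ h hc
    simp only [Term.closedAt, Bool.and_eq_true] at hc
    simp only [Term.subst, hA n σ h hc.1, hB _ _ (up n σ h) hc.2]
  | lam A B hA hB =>
    intro n σ h hc
    simp only [Term.closedAt, Bool.and_eq_true] at hc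
    simp only [Term.subst, hA n σ h hc.1, hB _ _ (up n σ h) hc.2]
  | app A B hA hB =>
    intro n σ h hc
    simp only [Term.closedAt, Bool.and_eq_true] at hc
    simp only [Term.subst, hA n σ h hc.1, hB n σ h hc.2]
  | const d => intros; rfl

theorem Term.subst_closed {t : Term} (h : t.closedAt 0 = true) (σ : ℕ → Term) : t.subst σ = t :=
  t.subst_of_closedAt 0 σ (by simp) h

theorem constType_closed (c : Const) : (constType c).closedAt 0 = true := by
  cases c <;> rfl

theorem constType_subst (c : Const) (σ : ℕ → Term) : (constType c).subst σ = constType c :=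
  Term.subst_closed (constType_closed c) σ

theorem Comp.closed {l r A : Term} (h : Comp l r A) :
    l.closedAt 0 = true ∧ r.closedAt 0 = true ∧ A.closedAt 0 = true := by
  cases h <;> exact ⟨rfl, rfl, rfl⟩

theorem Comp.subst {l r A : Term} (h : Comp l r A) (σ : ℕ → Term) :
    l.subst σ = l ∧ r.subst σ = r ∧ A.subst σ = A :=
  ⟨Term.subst_closed h.closed.1 σ, Term.subst_closed h.closed.2.1 σ,
    Term.subst_closed h.closed.2.2 σ⟩

def SubstTy (Γ : List Term) (t A : Term) : Prop :=
  CtxOK Γ ∧ ∀ Δ σ, WfCtx Δ → SubOK Δ σ Γ → HasType Δ (t.subst σ) (A.subst σ)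

def SubstEq (Γ : List Term) (t u A : Term) : Prop :=
  CtxOK Γ ∧ ∀ Δ σ, WfCtx Δ → SubOK Δ σ Γ → DefEq Δ (t.subst σ) (u.subst σ) (A.subst σ)

theorem SubstTy.cons {Γ : List Term} {A : Term} {i : ℕ} (h : SubstTy Γ A (.univ i)) :
    CtxOK (A :: Γ) := ⟨h.1, i, h.2⟩

mutual

theorem WfCtx.ctxOK {Γ : List Term} : WfCtx Γ → CtxOK Γ
  | .nil => trivial
  | .cons h => h.substTy.cons

/-- Induction on derivations, for all simultaneous substitutions at once. The explicit rules
`weaken` and `subst` then amount to dropping a term from the substitution or adding one, and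
`weaken` is what moves a substitution under a binder. -/
theorem HasType.substTy {Γ : List Term} {t A : Term} : HasType Γ t A → SubstTy Γ t A
  | .var h hl => ⟨h.ctxOK, fun _ _ _ hσ => hσ _ _ hl⟩
  | .univ i h => ⟨h.ctxOK, fun _ _ hΔ _ => .univ i hΔ⟩
  | .cumul h => ⟨h.substTy.1, fun _ _ hΔ hσ => .cumul (h.substTy.2 _ _ hΔ hσ)⟩
  | .pi hA hB => ⟨hA.substTy.1, fun _ _ hΔ hσ =>
      have h := hA.substTy.2 _ _ hΔ hσ
      .pi h (hB.substTy.2 _ _ (.cons h) (hσ.up h))⟩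
  | .lam hb => ⟨hb.substTy.1.1, fun _ _ hΔ hσ =>
      have ⟨_, h⟩ := hb.substTy.1.2
      .lam (hb.substTy.2 _ _ (.cons (h _ _ hΔ hσ)) (hσ.up (h _ _ hΔ hσ)))⟩
  | .app hf ha => ⟨hf.substTy.1, fun _ _ hΔ hσ => by
      rw [Term.inst_subst']
      exact .app (hf.substTy.2 _ _ hΔ hσ) (ha.substTy.2 _ _ hΔ hσ)⟩
  | .const c h => ⟨h.ctxOK, fun _ _ hΔ _ => by rw [constType_subst]; exact .const c hΔ⟩
  | .conv h e => ⟨h.substTy.1, fun _ _ hΔ hσ =>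
      .conv (h.substTy.2 _ _ hΔ hσ) (e.substEq.2 _ _ hΔ hσ)⟩
  | .weaken h hB => ⟨hB.substTy.cons, fun _ _ hΔ hσ => by
      rw [Term.shift_subst, Term.shift_subst]
      exact h.substTy.2 _ _ hΔ hσ.tail⟩
  | .subst hb ha => ⟨ha.substTy.1, fun _ _ hΔ hσ => by
      rw [Term.inst_subst, Term.inst_subst]
      exact hb.substTy.2 _ _ hΔ (hσ.cons (ha.substTy.2 _ _ hΔ hσ))⟩

theorem DefEq.substEq {Γ : List Term} {t u A : Term} : DefEq Γ t u A → SubstEq Γ t u A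
  | .refl h => ⟨h.substTy.1, fun _ _ hΔ hσ => .refl (h.substTy.2 _ _ hΔ hσ)⟩
  | .symm h => ⟨h.substEq.1, fun _ _ hΔ hσ => .symm (h.substEq.2 _ _ hΔ hσ)⟩
  | .trans h k => ⟨h.substEq.1, fun _ _ hΔ hσ =>
      .trans (h.substEq.2 _ _ hΔ hσ) (k.substEq.2 _ _ hΔ hσ)⟩
  | .conv h k => ⟨h.substEq.1, fun _ _ hΔ hσ =>
      .conv (h.substEq.2 _ _ hΔ hσ) (k.substEq.2 _ _ hΔ hσ)⟩
  | .cumul h => ⟨h.substEq.1, fun _ _ hΔ hσ => .cumul (h.substEq.2 _ _ hΔ hσ)⟩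
  | .pi hA hB => ⟨hA.substEq.1, fun _ _ hΔ hσ =>
      have ⟨_, h⟩ := hB.substEq.1.2
      .pi (hA.substEq.2 _ _ hΔ hσ)
        (hB.substEq.2 _ _ (.cons (h _ _ hΔ hσ)) (hσ.up (h _ _ hΔ hσ)))⟩
  | .lam hA hb => ⟨hA.substEq.1, fun _ _ hΔ hσ =>
      have ⟨_, h⟩ := hb.substEq.1.2
      .lam (hA.substEq.2 _ _ hΔ hσ)
        (hb.substEq.2 _ _ (.cons (h _ _ hΔ hσ)) (hσ.up (h _ _ hΔ hσ)))⟩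
  | .app hf ha => ⟨hf.substEq.1, fun _ _ hΔ hσ => by
      rw [Term.inst_subst']
      exact .app (hf.substEq.2 _ _ hΔ hσ) (ha.substEq.2 _ _ hΔ hσ)⟩
  | .beta hb ha => ⟨ha.substTy.1, fun _ _ hΔ hσ => by
      have ⟨_, h⟩ := hb.substTy.1.2
      rw [Term.inst_subst', Term.inst_subst']
      exact .beta (hb.substTy.2 _ _ (.cons (h _ _ hΔ hσ)) (hσ.up (h _ _ hΔ hσ)))
        (ha.substTy.2 _ _ hΔ hσ)⟩
  | .eta (f := f) hf => ⟨hf.substTy.1, fun _ σ hΔ hσ => by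
      have h := DefEq.eta (hf.substTy.2 _ _ hΔ hσ)
      rw [← Term.shift_subst_up] at h
      exact h⟩
  | .comp hΓ hc => ⟨hΓ.ctxOK, fun _ σ hΔ _ => by
      obtain ⟨h₁, h₂, h₃⟩ := hc.subst σ
      rw [h₁, h₂, h₃]
      exact .comp hΔ hc⟩
  | .weaken h hB => ⟨hB.substTy.cons, fun _ _ hΔ hσ => by
      rw [Term.shift_subst, Term.shift_subst, Term.shift_subst]
      exact h.substEq.2 _ _ hΔ hσ.tail⟩
  | .subst hb ha => ⟨ha.substTy.1, fun _ _ hΔ hσ => by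
      rw [Term.inst_subst, Term.inst_subst, Term.inst_subst]
      exact hb.substEq.2 _ _ hΔ (hσ.cons (ha.substTy.2 _ _ hΔ hσ))⟩

end
/-! ### Interpretation of level codes -/

/-- Interpret the level codes in a constant. -/
def Const.lv (p : ℕ) : Const → Const
  | .id i => .id (lvl p i) | .refl i => .refl (lvl p i) | .idElim i j => .idElim (lvl p i) (lvl p j)
  | .sigma i => .sigma (lvl p i) | .pair i => .pair (lvl p i)
  | .sigmaElim i j => .sigmaElim (lvl p i) (lvl p j)
  | .sum i => .sum (lvl p i) | .inl i => .inl (lvl p i) | .inr i => .inr (lvl p i)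
  | .sumElim i j => .sumElim (lvl p i) (lvl p j)
  | .emptyElim j => .emptyElim (lvl p j) | .unitElim j => .unitElim (lvl p j)
  | .natElim j => .natElim (lvl p j)
  | .funext i => .funext (lvl p i) | .univalence i => .univalence (lvl p i)
  | .trunc i => .trunc (lvl p i) | .tr i => .tr (lvl p i) | .squash i => .squash (lvl p i)
  | .truncRec i j => .truncRec (lvl p i) (lvl p j)
  | .brwElim j => .brwElim (lvl p j) | .leElim j => .leElim (lvl p j)
  | c => c

/-- Interpret the level codes in a term. -/
def Term.lv (p : ℕ) : Term → Term
  | .var n => .var n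
  | .univ i => .univ (lvl p i)
  | .pi A B => .pi (A.lv p) (B.lv p)
  | .lam A b => .lam (A.lv p) (b.lv p)
  | .app f a => .app (f.lv p) (a.lv p)
  | .const c => .const (c.lv p)

theorem Term.lv_rename (p : ℕ) (t : Term) :
    ∀ ρ : ℕ → ℕ, (t.rename ρ).lv p = (t.lv p).rename ρ := by
  induction t with
  | pi A B hA hB => intro ρ; simp [Term.rename, Term.lv, hA, hB]
  | lam A B hA hB => intro ρ; simp [Term.rename, Term.lv, hA, hB]
  | app A B hA hB => intro ρ; simp [Term.rename, Term.lv, hA, hB]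
  | _ => intro ρ; rfl

theorem Term.lv_shift (p : ℕ) (t : Term) : t.shift.lv p = (t.lv p).shift := t.lv_rename p _

theorem Term.lv_subst (p : ℕ) (t : Term) :
    ∀ σ : ℕ → Term, (t.subst σ).lv p = (t.lv p).subst fun n => (σ n).lv p := by
  have up (σ : ℕ → Term) : (fun n => (upSub σ n).lv p) = upSub fun n => (σ n).lv p := by
    funext n
    cases n with
    | zero => rfl
    | succ n => exact Term.lv_shift p _
  induction t with
  | pi A B hA hB => intro σ; simp [Term.subst, Term.lv, hA, hB, up]
  | lam A B hA hB => intro σ; simp [Term.subst, Term.lv, hA, hB, up]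
  | app A B hA hB => intro σ; simp [Term.subst, Term.lv, hA, hB]
  | _ => intro σ; rfl

theorem Term.lv_psub (p : ℕ) (t : Term) (σ : List Term) :
    (t.psub σ 0).lv p = (t.lv p).subst (listSub (σ.map (Term.lv p))) := by
  rw [Term.psub_zero, Term.lv_subst]
  congr 1
  induction σ with
  | nil => rfl
  | cons a σ ih => rw [List.map_cons, listSub_cons, listSub_cons, ← ih]; funext n; cases n <;> rfl

theorem Term.lv_inst (p : ℕ) (t a : Term) : (t.psub [a] 0).lv p = (t.lv p).inst (a.lv p) := by
  rw [Term.lv_psub, ← Term.psub_zero, ← Term.psub_singleton]; rfl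

theorem lvl_succ {a b : ℕ} (p : ℕ) (h : lvlSucc a = .ok b) : lvl p b = lvl p a + 1 := by
  unfold lvlSucc at h
  cases h7 : Nat.beq a 7 with
  | true => simp [h7] at h
  | false =>
    have : a ≠ 7 := by rintro rfl; simp at h7
    simp only [h7, cond_false, Res.ok.injEq] at h
    subst h
    unfold lvl
    split_ifs <;> omega

theorem lvl_le {a b : ℕ} (p : ℕ) (h : lvlLe a b = true) : lvl p a ≤ lvl p b := by
  unfold lvlLe at h
  unfold lvl
  cases h₁ : Nat.ble 8 a with
  | true =>
    have := Nat.le_of_ble_eq_true h₁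
    rw [h₁, cond_true] at h
    have := Nat.le_of_ble_eq_true h
    split_ifs <;> omega
  | false =>
    have h₃ : ¬ 8 ≤ a := by rw [← Nat.ble_eq, h₁]; simp
    rw [h₁, cond_false] at h
    cases h₂ : Nat.ble 8 b with
    | true =>
      have := Nat.le_of_ble_eq_true h₂
      rw [h₂, cond_true] at h
      have := Nat.le_of_ble_eq_true h
      split_ifs <;> omega
    | false =>
      have h₄ : ¬ 8 ≤ b := by rw [← Nat.ble_eq, h₂]; simp
      rw [h₂, cond_false] at h
      have := Nat.le_of_ble_eq_true h
      split_ifs <;> omega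

/-! ### Judgments about terms with level codes -/

/-- Typing, for the level parameter `p`. -/
def Typed (p : ℕ) (Γ : Ctx) (t A : Term) : Prop := HasType (Γ.map (Term.lv p)) (t.lv p) (A.lv p)

/-- Judgmental equality, for the level parameter `p`. -/
def Equal (p : ℕ) (Γ : Ctx) (t u A : Term) : Prop :=
  DefEq (Γ.map (Term.lv p)) (t.lv p) (u.lv p) (A.lv p)

def Wf (p : ℕ) (Γ : Ctx) : Prop := WfCtx (Γ.map (Term.lv p))

theorem HasType.cumul_le {Γ : List Term} {A : Term} {i j : ℕ} (h : HasType Γ A (.univ i))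
    (hij : i ≤ j) : HasType Γ A (.univ j) := by
  induction hij with
  | refl => exact h
  | step _ ih => exact ih.cumul

theorem DefEq.cumul_le {Γ : List Term} {A B : Term} {i j : ℕ} (h : DefEq Γ A B (.univ i))
    (hij : i ≤ j) : DefEq Γ A B (.univ j) := by
  induction hij with
  | refl => exact h
  | step _ ih => exact ih.cumul

section rules

variable {p : ℕ} {Γ : Ctx} {t u v A B T f g a b : Term} {i j : ℕ}

theorem Typed.cumul (h : Typed p Γ A (.univ i)) (hij : lvlLe i j = true) :
    Typed p Γ A (.univ j) := HasType.cumul_le h (lvl_le p hij)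

theorem Equal.cumul (h : Equal p Γ A B (.univ i)) (hij : lvlLe i j = true) :
    Equal p Γ A B (.univ j) := DefEq.cumul_le h (lvl_le p hij)

theorem Typed.wf (h : Typed p Γ A (.univ i)) : Wf p (A :: Γ) := WfCtx.cons h

theorem Typed.conv (h : Typed p Γ t A) (e : Equal p Γ A B (.univ i)) : Typed p Γ t B :=
  HasType.conv h e

theorem Equal.conv (h : Equal p Γ t u A) (e : Equal p Γ A B (.univ i)) : Equal p Γ t u B :=
  DefEq.conv h e

theorem Typed.refl (h : Typed p Γ t A) : Equal p Γ t t A := DefEq.refl h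

theorem Equal.symm (h : Equal p Γ t u A) : Equal p Γ u t A := DefEq.symm h

theorem Equal.trans (h : Equal p Γ t u A) (k : Equal p Γ u v A) : Equal p Γ t v A :=
  DefEq.trans h k

theorem Typed.pi (hA : Typed p Γ A (.univ i)) (hB : Typed p (A :: Γ) B (.univ i)) :
    Typed p Γ (.pi A B) (.univ i) := HasType.pi hA hB

theorem Typed.lam (hb : Typed p (A :: Γ) b B) : Typed p Γ (.lam A b) (.pi A B) := HasType.lam hb

theorem Typed.app (hf : Typed p Γ f (.pi A B)) (ha : Typed p Γ a A) :
    Typed p Γ (.app f a) (B.psub [a] 0) := by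
  unfold Typed; rw [Term.lv_inst]; exact HasType.app hf ha

theorem Equal.app (hf : Equal p Γ f g (.pi A B)) (ha : Equal p Γ a b A) :
    Equal p Γ (.app f a) (.app g b) (B.psub [a] 0) := by
  unfold Equal; rw [Term.lv_inst]; exact DefEq.app hf ha

theorem Equal.beta (hb : Typed p (A :: Γ) b B) (ha : Typed p Γ a A) :
    Equal p Γ (.app (.lam A b) a) (b.psub [a] 0) (B.psub [a] 0) := by
  unfold Equal; rw [Term.lv_inst, Term.lv_inst]; exact DefEq.beta hb ha

end rules

theorem Term.lift_succ_lookup {Γ : Ctx} : ∀ {k n : ℕ} {A : Term}, lookupAt k Γ n = .ok A →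
    ∃ B, Lookup Γ n B ∧ A = B.lift k 0 := by
  induction Γ with
  | nil => intro k n A h; cases n <;> simp [lookupAt] at h
  | cons C Γ ih =>
    intro k n A h
    cases n with
    | zero =>
      simp only [lookupAt, Res.ok.injEq] at h
      exact ⟨_, .here _ _, by rw [← h, ← Term.lift_one, Term.lift_lift, Nat.add_comm]⟩
    | succ n =>
      obtain ⟨B, hB, rfl⟩ := ih (k := k + 1) (n := n) h
      exact ⟨_, .there _ _ _ _ hB, by rw [← Term.lift_one, Term.lift_lift, Nat.add_comm]⟩

theorem Lookup.lv (p : ℕ) {Γ : List Term} {n : ℕ} {A : Term} (h : Lookup Γ n A) :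
    Lookup (Γ.map (Term.lv p)) n (A.lv p) := by
  induction h with
  | here Γ A => rw [Term.lv_shift]; exact .here _ _
  | there Γ A B n _ ih => rw [Term.lv_shift]; exact .there _ _ _ _ ih

theorem Typed.var {p : ℕ} {Γ : Ctx} {n : ℕ} {A : Term} (hΓ : Wf p Γ)
    (h : lookupAt 0 Γ n = .ok A) : Typed p Γ (.var n) A := by
  obtain ⟨B, hB, rfl⟩ := Term.lift_succ_lookup h
  rw [Term.lift_zero]
  exact HasType.var hΓ (hB.lv p)

theorem Res.bind_eq_ok {α β : Type} {x : Res α} {f : α → Res β} {b : β} :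
    x.bind f = .ok b ↔ ∃ a, x = .ok a ∧ f a = .ok b := by
  cases x <;> simp [Res.bind]

theorem Typed.const {p : ℕ} {Γ : Ctx} {c : Const} {A : Term} (hΓ : Wf p Γ)
    (h : inferConst c = .ok A) : Typed p Γ (.const c) A := by
  have key : A = constType c ∧ (constType c).lv p = constType (c.lv p) := by
    cases c
    case univalence i =>
      obtain ⟨b, hb, h⟩ := Res.bind_eq_ok.1 h
      simp only [Res.ok.injEq] at h
      refine ⟨h.symm, ?_⟩
      have hs := lvl_succ p hb
      have hb' : b = i + 1 := by
        unfold lvlSucc at hb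
        cases h7 : Nat.beq i 7 <;> simp_all
      subst hb'
      change _ = constType (.univalence (lvl p i))
      have e : constType (.univalence (lvl p i)) =
          (HoTT.pi (U (lvl p i)) fun A => HoTT.pi (U (lvl p i)) fun B =>
            isEquiv (lvl p i + 1) (eq (lvl p i + 1) (U (lvl p i)) A B) (equiv (lvl p i) A B)
              (idToEquiv (lvl p i) A B)).close := rfl
      rw [e]
      unfold idToEquiv
      rw [← hs]
      rfl
    all_goals
      simp only [inferConst, Res.ok.injEq] at h
      exact ⟨h.symm, rfl⟩
  rw [key.1]
  unfold Typed
  rw [key.2]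
  exact HasType.const _ hΓ

-- Soundness of the equality test and of the type checker

theorem codeBeq_eq {c d : Const} (h : codeBeq c.code d.code = true) : c = d := by
  have hc : c.code = d.code := by
    simp only [codeBeq, Bool.and_eq_true, Nat.beq_eq] at h
    exact Prod.ext h.1 (Prod.ext h.2.1 h.2.2)
  let decode : ℕ × ℕ × ℕ → Const := fun x => match x with
    | (0, i, _) => .id i | (1, i, _) => .refl i | (2, i, j) => .idElim i j
    | (3, i, _) => .sigma i | (4, i, _) => .pair i | (5, i, j) => .sigmaElim i j
    | (6, i, _) => .sum i | (7, i, _) => .inl i | (8, i, _) => .inr i | (9, i, j) => .sumElim i j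
    | (10, _, _) => .empty | (11, j, _) => .emptyElim j
    | (12, _, _) => .unit | (13, _, _) => .star | (14, j, _) => .unitElim j
    | (15, _, _) => .nat | (16, _, _) => .zero | (17, _, _) => .succ | (18, j, _) => .natElim j
    | (19, i, _) => .funext i | (20, i, _) => .univalence i
    | (21, i, _) => .trunc i | (22, i, _) => .tr i | (23, i, _) => .squash i
    | (24, i, j) => .truncRec i j
    | (25, _, _) => .brw | (26, _, _) => .le
    | (27, _, _) => .bzero | (28, _, _) => .bsuc | (29, _, _) => .blim | (30, _, _) => .bisim
    | (31, _, _) => .brwSet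
    | (32, _, _) => .leZero | (33, _, _) => .leTrans | (34, _, _) => .leSuc
    | (35, _, _) => .leCocone | (36, _, _) => .leLimiting | (37, _, _) => .leProp
    | (38, j, _) => .brwElim j | (_, j, _) => .leElim j
  have key (c : Const) : decode c.code = c := by cases c <;> rfl
  rw [← key c, hc, key d]

theorem Term.eqb_eq {t : Term} : ∀ {u : Term}, t.eqb u = true → t = u := by
  induction t with
  | var n =>
    intro u h
    match u, h with
    | .var m, h => rw [Nat.eq_of_beq_eq_true (n := n) (m := m) h]
  | univ n =>
    intro u h
    match u, h with
    | .univ m, h => rw [Nat.eq_of_beq_eq_true (n := n) (m := m) h]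
  | pi A B hA hB =>
    intro u h
    match u, h with
    | .pi A' B', h =>
      cases h₁ : A.eqb A' with
      | true =>
        have h₂ : Bool.rec (motive := fun _ => Bool) false (B.eqb B') (A.eqb A') = true := h
        rw [h₁] at h₂
        rw [hA h₁, hB h₂]
      | false =>
        have h₂ : Bool.rec (motive := fun _ => Bool) false (B.eqb B') (A.eqb A') = true := h
        rw [h₁] at h₂
        cases h₂
  | lam A B hA hB =>
    intro u h
    match u, h with
    | .lam A' B', h =>
      cases h₁ : A.eqb A' with
      | true =>
        have h₂ : Bool.rec (motive := fun _ => Bool) false (B.eqb B') (A.eqb A') = true := h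
        rw [h₁] at h₂
        rw [hA h₁, hB h₂]
      | false =>
        have h₂ : Bool.rec (motive := fun _ => Bool) false (B.eqb B') (A.eqb A') = true := h
        rw [h₁] at h₂
        cases h₂
  | app A B hA hB =>
    intro u h
    match u, h with
    | .app A' B', h =>
      cases h₁ : A.eqb A' with
      | true =>
        have h₂ : Bool.rec (motive := fun _ => Bool) false (B.eqb B') (A.eqb A') = true := h
        rw [h₁] at h₂
        rw [hA h₁, hB h₂]
      | false =>
        have h₂ : Bool.rec (motive := fun _ => Bool) false (B.eqb B') (A.eqb A') = true := h
        rw [h₁] at h₂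
        cases h₂
  | const c =>
    intro u h
    match u, h with
    | .const d, h => rw [codeBeq_eq (c := c) (d := d) h]

/-- A rule is correct for the level parameter `p`. -/
def Rule.OK (p : ℕ) (ρ : Rule) : Prop := Equal p ρ.ctx ρ.lhs ρ.rhs ρ.type

def Rules.OK (p : ℕ) (R : Rules) : Prop := ∀ c l d m ρ σ, R c l d m = some (ρ, σ) → ρ.OK p

/-- Only successful answers are constrained, so running out of fuel is harmless and completeness
plays no role. A reduction without a recorded type is one that left the term unchanged. -/
structure Fns.OK (p : ℕ) (F : Fns) : Prop where
  infer {Γ t A} : Wf p Γ → F.infer Γ t = .ok A → Typed p Γ t A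
  check {Γ t A x} : Wf p Γ → F.check Γ t A = .ok x → Typed p Γ t A
  red {Γ t u A} : Wf p Γ → F.red Γ t = .ok (some (u, A)) → Equal p Γ t u A
  whnf {Γ t u A} : Wf p Γ → F.whnf Γ t = .ok (u, some A) → Equal p Γ t u A
  whnf_none {Γ t u} : F.whnf Γ t = .ok (u, none) → u = t
  conv {Γ t u A x} : Wf p Γ → F.conv Γ t u A = .ok x → Equal p Γ t u A
  convI {Γ t u A} : Wf p Γ → F.convI Γ t u = .ok A → Equal p Γ t u A

theorem Fns.fail_ok (p : ℕ) : Fns.fail.OK p := by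
  constructor <;> simp [Fns.fail]

theorem lvlMax_ok {a b c : ℕ} (h : lvlMax a b = .ok c) :
    lvlLe a c = true ∧ lvlLe b c = true := by
  have hr (a : ℕ) : lvlLe a a = true := by
    unfold lvlLe; cases h : Nat.ble 8 a <;> simp
  unfold lvlMax at h
  cases h₁ : lvlLe a b with
  | true =>
    simp only [h₁, cond_true, Res.ok.injEq] at h
    subst h; exact ⟨h₁, hr _⟩
  | false =>
    cases h₂ : lvlLe b a with
    | true =>
      simp only [h₁, h₂, cond_false, cond_true, Res.ok.injEq] at h
      subst h; exact ⟨hr _, h₂⟩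
    | false =>
      simp only [h₁, h₂, cond_false] at h
      cases h₃ : lvlLe a ((bif Nat.ble 8 a then b else a) + 8) &&
        lvlLe b ((bif Nat.ble 8 a then b else a) + 8) with
      | true =>
        simp only [h₃, cond_true, Res.ok.injEq] at h
        subst h; exact (Bool.and_eq_true _ _).mp h₃
      | false => simp [h₃] at h

section soundness

variable {p : ℕ} {F : Fns} {Γ : Ctx}

theorem Fns.OK.univOf_ok (hF : F.OK p) (hΓ : Wf p Γ) {T : Term} {i : ℕ}
    (h : (F.whnf Γ T).bind (univOf T) = .ok i) : ∃ k, Equal p Γ T (.univ i) (.univ k) := by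
  obtain ⟨r, hr, h⟩ := Res.bind_eq_ok.1 h
  unfold univOf at h
  split at h
  · simp only [Res.ok.injEq] at h
    subst h
    exact ⟨_, hF.whnf hΓ hr⟩
  · simp at h

theorem Fns.OK.asUniv_ok (hF : F.OK p) (hΓ : Wf p Γ) {T : Term} {i : ℕ}
    (h : F.asUniv Γ T = .ok i) : T = .univ i ∨ ∃ k, Equal p Γ T (.univ i) (.univ k) := by
  cases T with
  | univ j => cases h; exact .inl rfl
  | _ => exact .inr (hF.univOf_ok hΓ h)

theorem Fns.OK.sort_ok (hF : F.OK p) (hΓ : Wf p Γ) {A : Term} {i : ℕ}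
    (h : F.sort Γ A = .ok i) : Typed p Γ A (.univ i) := by
  obtain ⟨T, hT, h⟩ := Res.bind_eq_ok.1 h
  have hA := hF.infer hΓ hT
  obtain rfl | ⟨k, hk⟩ := hF.asUniv_ok hΓ h
  · exact hA
  · exact hA.conv hk

theorem Fns.OK.piOf_ok (hF : F.OK p) (hΓ : Wf p Γ) {T : Term} {q : Term × Term}
    (h : (F.whnf Γ T).bind (piOf T) = .ok q) : ∃ k, Equal p Γ T (.pi q.1 q.2) (.univ k) := by
  obtain ⟨r, hr, h⟩ := Res.bind_eq_ok.1 h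
  unfold piOf at h
  split at h
  · simp only [Res.ok.injEq] at h
    subst h
    exact ⟨_, hF.whnf hΓ hr⟩
  · simp at h

theorem Fns.OK.asPi_ok (hF : F.OK p) (hΓ : Wf p Γ) {T : Term} {q : Term × Term}
    (h : F.asPi Γ T = .ok q) : T = .pi q.1 q.2 ∨ ∃ k, Equal p Γ T (.pi q.1 q.2) (.univ k) := by
  cases T with
  | pi A B => cases h; exact .inl rfl
  | _ => exact .inr (hF.piOf_ok hΓ h)

theorem Fns.OK.asPi_typed (hF : F.OK p) (hΓ : Wf p Γ) {t T : Term} {q : Term × Term}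
    (h : F.asPi Γ T = .ok q) (ht : Typed p Γ t T) : Typed p Γ t (.pi q.1 q.2) := by
  obtain rfl | ⟨k, hk⟩ := hF.asPi_ok hΓ h
  · exact ht
  · exact ht.conv hk

theorem Fns.OK.asPi_equal (hF : F.OK p) (hΓ : Wf p Γ) {t u T : Term} {q : Term × Term}
    (h : F.asPi Γ T = .ok q) (ht : Equal p Γ t u T) : Equal p Γ t u (.pi q.1 q.2) := by
  obtain rfl | ⟨k, hk⟩ := hF.asPi_ok hΓ h
  · exact ht
  · exact ht.conv hk

theorem Fns.OK.of_asPi_typed (hF : F.OK p) (hΓ : Wf p Γ) {t T : Term} {q : Term × Term}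
    (h : F.asPi Γ T = .ok q) (ht : Typed p Γ t (.pi q.1 q.2)) : Typed p Γ t T := by
  obtain rfl | ⟨k, hk⟩ := hF.asPi_ok hΓ h
  · exact ht
  · exact ht.conv hk.symm

theorem Fns.OK.of_asPi_equal (hF : F.OK p) (hΓ : Wf p Γ) {t u T : Term} {q : Term × Term}
    (h : F.asPi Γ T = .ok q) (ht : Equal p Γ t u (.pi q.1 q.2)) : Equal p Γ t u T := by
  obtain rfl | ⟨k, hk⟩ := hF.asPi_ok hΓ h
  · exact ht
  · exact ht.conv hk.symm

theorem Fns.OK.convT_ok (hF : F.OK p) (hΓ : Wf p Γ) {A B : Term} {x : Unit}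
    (h : F.convT Γ A B = .ok x) : ∃ k, Equal p Γ A B (.univ k) := by
  obtain ⟨_, _, h⟩ := Res.bind_eq_ok.1 h
  obtain ⟨_, _, h⟩ := Res.bind_eq_ok.1 h
  obtain ⟨_, _, h⟩ := Res.bind_eq_ok.1 h
  exact ⟨_, hF.conv hΓ h⟩

theorem Fns.OK.cast_ok (hF : F.OK p) (hΓ : Wf p Γ) {T A : Term} {x : Unit}
    (h : F.cast Γ T A = .ok x) : T = A ∨
      (∃ i j, (T = .univ i ∨ ∃ k, Equal p Γ T (.univ i) (.univ k)) ∧ A = .univ j ∧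
        lvlLe i j = true) ∨ ∃ k, Equal p Γ T A (.univ k) := by
  unfold Fns.cast at h
  cases h₁ : T.eqb A with
  | true => exact .inl (Term.eqb_eq h₁)
  | false =>
    rw [h₁] at h
    change F.castNe Γ T A = _ at h
    unfold Fns.castNe at h
    split at h
    · rename_i j
      obtain ⟨i, hi, h⟩ := Res.bind_eq_ok.1 h
      cases hij : lvlLe i j with
      | true => exact .inr (.inl ⟨i, j, hF.asUniv_ok hΓ hi, rfl, hij⟩)
      | false => simp [hij] at h
    · exact .inr (.inr (hF.convT_ok hΓ h))

theorem Fns.OK.cast_typed (hF : F.OK p) (hΓ : Wf p Γ) {t T A : Term} {x : Unit}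
    (h : F.cast Γ T A = .ok x) (ht : Typed p Γ t T) : Typed p Γ t A := by
  obtain rfl | ⟨i, j, rfl | ⟨k, hk⟩, rfl, hij⟩ | ⟨k, hk⟩ := hF.cast_ok hΓ h
  · exact ht
  · exact ht.cumul hij
  · exact (ht.conv hk).cumul hij
  · exact ht.conv hk

theorem Fns.OK.cast_equal (hF : F.OK p) (hΓ : Wf p Γ) {t u T A : Term} {x : Unit}
    (h : F.cast Γ T A = .ok x) (ht : Equal p Γ t u T) : Equal p Γ t u A := by
  obtain rfl | ⟨i, j, rfl | ⟨k, hk⟩, rfl, hij⟩ | ⟨k, hk⟩ := hF.cast_ok hΓ h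
  · exact ht
  · exact ht.cumul hij
  · exact (ht.conv hk).cumul hij
  · exact ht.conv hk

theorem Term.sub_eq (σ : List Term) (t : Term) : t.sub σ = t.psub σ 0 := by
  cases σ with
  | nil =>
    rw [Term.psub_zero]
    exact (t.subst_var).symm
  | cons a σ => rfl

theorem Term.psub_one_inst (B a : Term) (σ : List Term) :
    (B.psub σ 1).psub [a] 0 = B.psub (a :: σ) 0 := by
  have : (Term.pi B B).subst (listSub σ) = .pi (B.psub σ 0) (B.psub σ 1) := by
    rw [← Term.psub_zero]; rfl
  simp only [Term.subst, Term.pi.injEq] at this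
  rw [← this.2, Term.psub_singleton, Term.psub_zero, listSub_cons, Term.subst_up_inst]

structure Judge.OK (p : ℕ) (t : Term) (x : Judge) : Prop where
  infer {Γ A} : Wf p Γ → x.infer Γ = .ok A → Typed p Γ t A
  spine {Γ q} : Wf p Γ → x.spine Γ = .ok q → Typed p Γ t (q.1.psub q.2 0)
  check {Γ A u} : Wf p Γ → x.check Γ A = .ok u → Typed p Γ t A

theorem Fns.OK.judgeOf_ok (hF : F.OK p) {t : Term} {x : Ctx → Res Term}
    (h : ∀ Γ A, Wf p Γ → x Γ = .ok A → Typed p Γ t A) : (F.judgeOf x).OK p t where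
  infer hΓ h' := h _ _ hΓ h'
  spine hΓ h' := by
    obtain ⟨T, hT, h'⟩ := Res.bind_eq_ok.1 h'
    simp only [Res.ok.injEq] at h'
    subst h'
    rw [← Term.sub_eq]
    exact h _ _ hΓ hT
  check hΓ h' := by
    obtain ⟨T, hT, h'⟩ := Res.bind_eq_ok.1 h'
    exact hF.cast_typed hΓ h' (h _ _ hΓ hT)

theorem Fns.OK.sortOf_ok (hF : F.OK p) (hΓ : Wf p Γ) {t : Term} {x : Judge} (hx : x.OK p t)
    {i : ℕ} (h : F.sortOf Γ (x.infer Γ) = .ok i) : Typed p Γ t (.univ i) := by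
  obtain ⟨T, hT, h⟩ := Res.bind_eq_ok.1 h
  have hA := hx.infer hΓ hT
  obtain rfl | ⟨k, hk⟩ := hF.asUniv_ok hΓ h
  · exact hA
  · exact hA.conv hk

theorem Fns.OK.inferLam_ok (hF : F.OK p) {A b : Term} {x y : Judge} (hx : x.OK p A)
    (hy : y.OK p b) {T : Term} (hΓ : Wf p Γ) (h : F.inferLam A x y Γ = .ok T) :
    Typed p Γ (.lam A b) T := by
  obtain ⟨i, hi, h⟩ := Res.bind_eq_ok.1 h
  obtain ⟨B, hB, h⟩ := Res.bind_eq_ok.1 h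
  simp only [Res.ok.injEq] at h
  subst h
  exact .lam (hy.infer (hF.sortOf_ok hΓ hx hi).wf hB)

/-- Congruence of function types needs domain and codomain in a common universe; the maximum is
taken after the codes have been interpreted, hence the use of `DefEq` in the conclusion. -/
theorem Fns.OK.domain_ok (hF : F.OK p) (hΓ : Wf p Γ) {A : Term} {q : Term × Term} {x : Unit}
    (hA : Wf p (A :: Γ)) (h : F.domain Γ A q = .ok x) : A = q.1 ∨ ∃ k,
      DefEq (Γ.map (Term.lv p)) ((Term.pi A q.2).lv p) ((Term.pi q.1 q.2).lv p) (.univ k) := by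
  unfold Fns.domain at h
  cases hd : A.eqb q.1 with
  | true => exact .inl (Term.eqb_eq hd)
  | false =>
    rw [hd, cond_false] at h
    obtain ⟨_, hx, h⟩ := Res.bind_eq_ok.1 h
    obtain ⟨j, hj, h⟩ := Res.bind_eq_ok.1 h
    obtain ⟨i, hi⟩ := hF.convT_ok hΓ hx
    exact .inr ⟨max (lvl p i) (lvl p j), DefEq.pi (DefEq.cumul_le hi (le_max_left _ _))
      (.refl (HasType.cumul_le (hF.sort_ok hA hj) (le_max_right _ _)))⟩

theorem Fns.OK.domain_typed (hF : F.OK p) (hΓ : Wf p Γ) {A t : Term} {q : Term × Term} {x : Unit}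
    (hA : Wf p (A :: Γ)) (h : F.domain Γ A q = .ok x) (ht : Typed p Γ t (.pi A q.2)) :
    Typed p Γ t (.pi q.1 q.2) := by
  obtain rfl | ⟨k, hk⟩ := hF.domain_ok hΓ hA h
  · exact ht
  · exact HasType.conv ht hk

theorem Fns.OK.domain_equal (hF : F.OK p) (hΓ : Wf p Γ) {A t u : Term} {q : Term × Term} {x : Unit}
    (hA : Wf p (A :: Γ)) (h : F.domain Γ A q = .ok x) (ht : Equal p Γ t u (.pi A q.2)) :
    Equal p Γ t u (.pi q.1 q.2) := by
  obtain rfl | ⟨k, hk⟩ := hF.domain_ok hΓ hA h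
  · exact ht
  · exact DefEq.conv ht hk

theorem Fns.OK.judgeLam_ok (hF : F.OK p) {A b : Term} {x y : Judge} (hx : x.OK p A)
    (hy : y.OK p b) : (F.judgeLam A x y).OK p (.lam A b) where
  infer hΓ h := hF.inferLam_ok hx hy hΓ h
  spine hΓ h := (hF.judgeOf_ok fun _ _ hΓ h => hF.inferLam_ok hx hy hΓ h).spine hΓ h
  check hΓ h := by
    obtain ⟨q, hq, h⟩ := Res.bind_eq_ok.1 h
    obtain ⟨i, hi, h⟩ := Res.bind_eq_ok.1 h
    obtain ⟨_, hd, h⟩ := Res.bind_eq_ok.1 h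
    have hA := (hF.sortOf_ok hΓ hx hi).wf
    exact hF.of_asPi_typed hΓ hq (hF.domain_typed hΓ hA hd (hy.check hA h).lam)

theorem Fns.OK.judgeApp_ok (hF : F.OK p) {f a : Term} {x y : Judge} (hx : x.OK p f)
    (hy : y.OK p a) : (F.judgeApp a x y).OK p (.app f a) := by
  have key {Γ : Ctx} {q : Term × List Term} (hΓ : Wf p Γ)
      (h : (x.spine Γ).bind (F.applyTo y Γ a) = .ok q) :
      Typed p Γ (.app f a) (q.1.psub q.2 0) := by
    obtain ⟨r, hr, h⟩ := Res.bind_eq_ok.1 h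
    have key := hx.spine hΓ hr
    rw [← Term.sub_eq] at key
    unfold Fns.applyTo at h
    split at h
    · rename_i A B hAB
      obtain ⟨x, hx, h⟩ := Res.bind_eq_ok.1 h
      simp only [Res.ok.injEq] at h
      subst h
      rw [hAB, Term.sub_eq] at key
      have := Typed.app (A := A.psub r.2 0) (B := B.psub r.2 1) key
        ((Term.sub_eq _ _) ▸ hy.check hΓ hx)
      rwa [Term.psub_one_inst] at this
    · obtain ⟨s, hs, h⟩ := Res.bind_eq_ok.1 h
      obtain ⟨x, hx, h⟩ := Res.bind_eq_ok.1 h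
      simp only [Res.ok.injEq] at h
      subst h
      exact (hF.asPi_typed hΓ hs key).app (hy.check hΓ hx)
  refine ⟨fun hΓ h => ?_, fun hΓ h => key hΓ h, fun hΓ h => ?_⟩
  · obtain ⟨q, hq, h⟩ := Res.bind_eq_ok.1 h
    simp only [Res.ok.injEq] at h
    subst h
    rw [Term.sub_eq]
    exact key hΓ hq
  · obtain ⟨q, hq, h⟩ := Res.bind_eq_ok.1 h
    rw [Term.sub_eq] at h
    exact hF.cast_typed hΓ h (key hΓ hq)

theorem Fns.OK.judge_ok (hF : F.OK p) (t : Term) : (F.judge t).OK p t := by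
  induction t with
  | var n => exact hF.judgeOf_ok fun _ _ hΓ h => Typed.var hΓ h
  | univ i =>
    refine hF.judgeOf_ok fun Γ A hΓ h => ?_
    obtain ⟨j, hj, h⟩ := Res.bind_eq_ok.1 h
    simp only [Res.ok.injEq] at h
    subst h
    have := HasType.univ (lvl p i) hΓ
    rw [← lvl_succ p hj] at this
    exact this
  | pi A B hA hB =>
    refine hF.judgeOf_ok fun Γ T hΓ h => ?_
    obtain ⟨i, hi, h⟩ := Res.bind_eq_ok.1 h
    obtain ⟨j, hj, h⟩ := Res.bind_eq_ok.1 h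
    obtain ⟨k, hk, h⟩ := Res.bind_eq_ok.1 h
    simp only [Res.ok.injEq] at h
    subst h
    have hA := hF.sortOf_ok hΓ hA hi
    exact .pi (hA.cumul (lvlMax_ok hk).1) ((hF.sortOf_ok hA.wf hB hj).cumul (lvlMax_ok hk).2)
  | lam A b hA hb => exact hF.judgeLam_ok hA hb
  | app f a hf ha => exact hF.judgeApp_ok hf ha
  | const c => exact hF.judgeOf_ok fun _ _ hΓ h => Typed.const hΓ h

theorem Fns.OK.checkSub_ok (hF : F.OK p) (hΓ : Wf p Γ) : ∀ {Δ : Ctx} {σ : List Term} {x : Unit},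
    F.checkSub Γ Δ σ = .ok x →
      SubOK (Γ.map (Term.lv p)) (listSub (σ.map (Term.lv p))) (Δ.map (Term.lv p))
  | [], [], _, _ => by intro n A h; cases h
  | A :: Δ, a :: σ, x, h => by
    obtain ⟨y, hy, h⟩ := Res.bind_eq_ok.1 h
    rw [List.map_cons, List.map_cons, listSub_cons]
    refine (hF.checkSub_ok hΓ hy).cons ?_
    have := hF.check hΓ h
    unfold Typed at this
    rwa [Term.lv_psub] at this
  | [], _ :: _, _, h => by simp [Fns.checkSub] at h
  | _ :: _, [], _, h => by simp [Fns.checkSub] at h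

theorem Fns.OK.redApp_ok (hF : F.OK p) (hΓ : Wf p Γ) {f a u A : Term}
    (h : ((F.red Γ f).bind fun r =>
      match r with
      | none => .ok none
      | some (f', S) => (F.asPi Γ S).bind fun q => (F.check Γ a q.1).bind fun _ =>
        .ok (some (.app f' a, q.2.psub [a] 0))) = .ok (some (u, A))) :
    Equal p Γ (.app f a) u A := by
  obtain ⟨r, hr, h⟩ := Res.bind_eq_ok.1 h
  split at h
  · simp at h
  · obtain ⟨q, hq, h⟩ := Res.bind_eq_ok.1 h
    obtain ⟨x, hx, h⟩ := Res.bind_eq_ok.1 h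
    simp only [Res.ok.injEq, Option.some.injEq, Prod.mk.injEq] at h
    obtain ⟨rfl, rfl⟩ := h
    exact (hF.asPi_equal hΓ hq (hF.red hΓ hr)).app (hF.check hΓ hx).refl

theorem Fns.OK.redS_ok (hF : F.OK p) {R : Rules} (hR : R.OK p) (hΓ : Wf p Γ) {t u A : Term}
    (h : F.redS R Γ t = .ok (some (u, A))) : Equal p Γ t u A := by
  unfold Fns.redS at h
  split at h
  · rename_i f a
    split at h
    · obtain ⟨i, hi, h⟩ := Res.bind_eq_ok.1 h
      obtain ⟨x, hx, h⟩ := Res.bind_eq_ok.1 h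
      obtain ⟨B, hB, h⟩ := Res.bind_eq_ok.1 h
      simp only [Res.ok.injEq, Option.some.injEq, Prod.mk.injEq] at h
      obtain ⟨rfl, rfl⟩ := h
      exact .beta (hF.infer (hF.sort_ok hΓ hi).wf hB) (hF.check hΓ hx)
    · split at h
      · exact hF.redApp_ok hΓ h
      · rename_i c l hc
        split at h
        · simp at h
        · rename_i n hn
          cases hb : Nat.beq n l.length with
          | true =>
            rw [hb, cond_true] at h
            obtain ⟨r, hr, h⟩ := Res.bind_eq_ok.1 h
            split at h
            · obtain ⟨T, hT, h⟩ := Res.bind_eq_ok.1 h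
              obtain ⟨q, hq, h⟩ := Res.bind_eq_ok.1 h
              obtain ⟨x, hx, h⟩ := Res.bind_eq_ok.1 h
              simp only [Res.ok.injEq, Option.some.injEq, Prod.mk.injEq] at h
              obtain ⟨rfl, rfl⟩ := h
              exact (hF.asPi_typed hΓ hq (hF.infer hΓ hT)).refl.app
                (hF.cast_equal hΓ hx (hF.whnf hΓ hr))
            · split at h
              · simp at h
              · split at h
                · simp at h
                · rename_i ρ σ hρ
                  obtain ⟨x, hx, h⟩ := Res.bind_eq_ok.1 h
                  cases he : Term.eqb (.app f a) (ρ.lhs.psub σ 0) with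
                  | false => simp [he] at h
                  | true =>
                    simp only [he, cond_true, Res.ok.injEq, Option.some.injEq,
                      Prod.mk.injEq] at h
                    obtain ⟨rfl, rfl⟩ := h
                    rw [Term.eqb_eq he]
                    unfold Equal
                    rw [Term.lv_psub, Term.lv_psub, Term.lv_psub]
                    -- The reduction is a substitution instance of the open rule, so stability of
                    -- judgmental equality under simultaneous substitution suffices.
                    exact (DefEq.substEq (hR _ _ _ _ _ _ hρ)).2 _ _ hΓ (hF.checkSub_ok hΓ hx)
          | false =>
            rw [hb, cond_false] at h
            cases hb' : Nat.ble n l.length with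
            | true =>
              rw [hb', cond_true] at h
              exact hF.redApp_ok hΓ h
            | false => simp [hb'] at h
  · simp at h

theorem Fns.OK.whnfS_ok (hF : F.OK p) (hΓ : Wf p Γ) {t u A : Term}
    (h : F.whnfS Γ t = .ok (u, some A)) : Equal p Γ t u A := by
  obtain ⟨r, hr, h⟩ := Res.bind_eq_ok.1 h
  split at h
  · simp at h
  · obtain ⟨r₂, hr₂, h⟩ := Res.bind_eq_ok.1 h
    split at h
    · simp only [Res.ok.injEq, Prod.mk.injEq, Option.some.injEq] at h
      obtain ⟨rfl, rfl⟩ := h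
      exact hF.red hΓ hr
    · obtain ⟨x, hx, h⟩ := Res.bind_eq_ok.1 h
      simp only [Res.ok.injEq, Prod.mk.injEq, Option.some.injEq] at h
      obtain ⟨rfl, rfl⟩ := h
      exact (hF.red hΓ hr).trans (hF.cast_equal hΓ hx (hF.whnf hΓ hr₂))

theorem Fns.OK.whnfS_none (F : Fns) {t u : Term} (h : F.whnfS Γ t = .ok (u, none)) : u = t := by
  obtain ⟨r, hr, h⟩ := Res.bind_eq_ok.1 h
  split at h
  · simp only [Res.ok.injEq, Prod.mk.injEq] at h; exact h.1.symm
  · obtain ⟨r₂, hr₂, h⟩ := Res.bind_eq_ok.1 h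
    split at h
    · simp at h
    · obtain ⟨x, hx, h⟩ := Res.bind_eq_ok.1 h
      simp at h

theorem Fns.OK.whnf_castO (hF : F.OK p) (hΓ : Wf p Γ) {t A : Term} {r : Term × Option Term}
    {x : Unit} (hr : F.whnf Γ t = .ok r) (h : F.castO Γ r.2 A = .ok x) :
    r.1 = t ∨ Equal p Γ t r.1 A := by
  obtain ⟨u, o⟩ := r
  cases o with
  | none => exact .inl (hF.whnf_none hr)
  | some T => exact .inr (hF.cast_equal hΓ h (hF.whnf hΓ hr))

theorem Fns.OK.convS_ok (hF : F.OK p) (hΓ : Wf p Γ) {t u A : Term} {x : Unit}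
    (h : F.convS Γ t u A = .ok x) : Equal p Γ t u A := by
  unfold Fns.convS at h
  cases he : t.eqb u with
  | true =>
    rw [he, cond_true] at h
    rw [← Term.eqb_eq he]
    exact (hF.check hΓ h).refl
  | false =>
    rw [he, cond_false] at h
    obtain ⟨r, hr, h⟩ := Res.bind_eq_ok.1 h
    obtain ⟨y, hy, h⟩ := Res.bind_eq_ok.1 h
    obtain ⟨s, hs, h⟩ := Res.bind_eq_ok.1 h
    obtain ⟨z, hz, h⟩ := Res.bind_eq_ok.1 h
    have key : Equal p Γ r.1 s.1 A := by
      split at h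
      · rename_i A₁ B₁ A₂ B₂ h₁ h₂
        rw [h₁, h₂]
        split at h
        · obtain ⟨i, hi, h⟩ := Res.bind_eq_ok.1 h
          obtain ⟨_, hA, h⟩ := Res.bind_eq_ok.1 h
          exact DefEq.pi (hF.conv hΓ hA) (hF.conv (hF.sort_ok hΓ hi).wf h)
        · simp at h
      · rename_i A₁ b₁ A₂ b₂ h₁ h₂
        rw [h₁, h₂]
        obtain ⟨q, hq, h⟩ := Res.bind_eq_ok.1 h
        obtain ⟨i, hi, h⟩ := Res.bind_eq_ok.1 h
        obtain ⟨_, hd, h⟩ := Res.bind_eq_ok.1 h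
        obtain ⟨_, hA, h⟩ := Res.bind_eq_ok.1 h
        obtain ⟨k, hk⟩ := hF.convT_ok hΓ hA
        refine hF.of_asPi_equal hΓ hq (hF.domain_equal hΓ (hF.sort_ok hΓ hi).wf hd ?_)
        exact DefEq.lam hk (hF.conv (hF.sort_ok hΓ hi).wf h)
      · obtain ⟨S, hS, h⟩ := Res.bind_eq_ok.1 h
        exact hF.cast_equal hΓ h (hF.convI hΓ hS)
    obtain e₁ | e₁ := hF.whnf_castO hΓ hr hy <;> obtain e₂ | e₂ := hF.whnf_castO hΓ hs hz
    · rwa [e₁, e₂] at key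
    · rw [e₁] at key; exact key.trans e₂.symm
    · rw [e₂] at key; exact e₁.trans key
    · exact e₁.trans (key.trans e₂.symm)

theorem Fns.OK.convIS_ok (hF : F.OK p) (hΓ : Wf p Γ) {t u A : Term}
    (h : F.convIS Γ t u = .ok A) : Equal p Γ t u A := by
  unfold Fns.convIS at h
  cases he : t.eqb u with
  | true =>
    rw [he, cond_true] at h
    rw [← Term.eqb_eq he]
    exact (hF.infer hΓ h).refl
  | false =>
    rw [he, cond_false] at h
    split at h
    · obtain ⟨S, hS, h⟩ := Res.bind_eq_ok.1 h
      obtain ⟨q, hq, h⟩ := Res.bind_eq_ok.1 h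
      obtain ⟨_, ha, h⟩ := Res.bind_eq_ok.1 h
      simp only [Res.ok.injEq] at h
      subst h
      exact (hF.asPi_equal hΓ hq (hF.convI hΓ hS)).app (hF.conv hΓ ha)
    · simp at h

theorem Fns.OK.withJudge (hF : F.OK p) : F.withJudge.OK p where
  infer hΓ h := (hF.judge_ok _).infer hΓ h
  check hΓ h := (hF.judge_ok _).check hΓ h
  red := hF.red
  whnf := hF.whnf
  whnf_none := hF.whnf_none
  conv := hF.conv
  convI := hF.convI

theorem Fns.OK.withWhnf (hF : F.OK p) {G : Fns} (hG : G.OK p) {R : Rules} (hR : R.OK p) :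
    (F.withWhnf G R).OK p where
  infer := hF.infer
  check := hF.check
  red hΓ h := hG.redS_ok hR hΓ h
  whnf hΓ h := hG.whnfS_ok hΓ h
  whnf_none := Fns.OK.whnfS_none G
  conv := hF.conv
  convI := hF.convI

theorem Fns.OK.withConv (hF : F.OK p) {G : Fns} (hG : G.OK p) : (F.withConv G).OK p where
  infer := hF.infer
  check := hF.check
  red := hF.red
  whnf := hF.whnf
  whnf_none := hF.whnf_none
  conv hΓ h := hG.convS_ok hΓ h
  convI hΓ h := hG.convIS_ok hΓ h

theorem Fns.OK.iterate {F : Fns} {s : Fns → Fns} (hF : F.OK p) (hs : ∀ G : Fns, G.OK p → (s G).OK p)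
    (n : ℕ) : Fns.OK p (Nat.rec F (fun _ G => s G) n) := by
  induction n with
  | zero => exact hF
  | succ n ih => exact hs _ ih

theorem Fns.OK.step (hF : F.OK p) {R : Rules} (hR : R.OK p) : (F.step R).OK p := by
  have h₂ := Fns.OK.iterate hF.withJudge (fun G hG => hF.withJudge.withWhnf hG hR) 100
  exact Fns.OK.iterate h₂ (fun G hG => h₂.withConv hG) 100

theorem fns_ok {R : Rules} (hR : R.OK p) (n : ℕ) : (fns R n).OK p :=
  Fns.OK.iterate (Fns.fail_ok p) (fun _ hG => hG.step hR) n

end soundness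
/-! ### Correctness of the computation rules -/

def noRules : Rules := fun _ _ _ _ => none

theorem noRules_ok (p : ℕ) : noRules.OK p := fun _ _ _ _ _ _ h => by simp [noRules] at h

def Fns.checkCtx (F : Fns) : Ctx → Res Unit
  | [] => .ok ()
  | A :: Γ => (F.checkCtx Γ).bind fun _ => (F.sort Γ A).bind fun _ => .ok ()

/-- Abstract all variables of the context `Γ` in `t`. -/
def lams : Ctx → Term → Term
  | [], t => t
  | A :: Γ, t => lams Γ (.lam A t)

/-- Quantify over all variables of the context `Γ` in `T`. -/
def pis : Ctx → Term → Term
  | [], T => T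
  | A :: Γ, T => pis Γ (.pi A T)

/-- Besides typing both sides of the open rule, this verifies that abstracting its context again
returns the closed rule, so `peel` and `peelPi` need not be analysed. -/
def Fns.checkComp (F : Fns) (x : Closed) : Res Unit :=
  let ρ := Rule.ofComp x
  (F.checkCtx ρ.ctx).bind fun _ =>
  (F.check ρ.ctx ρ.lhs ρ.type).bind fun _ =>
  (F.check ρ.ctx ρ.rhs ρ.type).bind fun _ =>
    bif Term.eqb (lams ρ.ctx ρ.lhs) x.lhs &&
      (Term.eqb (lams ρ.ctx ρ.rhs) x.rhs && Term.eqb (pis ρ.ctx ρ.type) x.type) then .ok ()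
    else .err 11 []

def Res.isOk {α : Type} : Res α → Bool
  | .ok _ => true
  | .err _ _ => false

theorem Res.isOk_iff {α : Type} {x : Res α} : x.isOk = true ↔ ∃ a, x = .ok a := by
  cases x <;> simp [Res.isOk]

-- From closed computation rules to equalities in context

section

variable {p : ℕ} {F : Fns}

theorem Term.rename_up_inst (t : Term) : (t.rename (upRen Nat.succ)).inst (.var 0) = t := by
  rw [Term.inst, Term.rename_subst]
  conv_rhs => rw [← t.subst_var]
  congr 1
  funext n; cases n <;> rfl

theorem DefEq.app_shift {Γ : List Term} {t u A B : Term} {i : ℕ} (hA : HasType Γ A (.univ i))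
    (h : DefEq Γ t u (.pi A B)) :
    DefEq (A :: Γ) (.app t.shift (.var 0)) (.app u.shift (.var 0)) B := by
  have := DefEq.app (h.weaken hA) (.refl (.var (.cons hA) (.here _ _)))
  rwa [Term.rename_up_inst] at this

theorem upRen_eq_upSub (t : Term) (ρ : ℕ → ℕ) : t.rename ρ = t.subst fun n => .var (ρ n) := by
  conv_lhs => rw [← t.subst_var]
  rw [Term.subst_rename]; rfl

/-- Typing is preserved when a variable is added below the last one. -/
theorem HasType.weaken_up {Γ : List Term} {b A B C : Term} {i j : ℕ} (hA : HasType Γ A (.univ i))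
    (hC : HasType Γ C (.univ j)) (h : HasType (A :: Γ) b B) :
    HasType (A.shift :: C :: Γ) (b.rename (upRen Nat.succ)) (B.rename (upRen Nat.succ)) := by
  rw [upRen_eq_upSub, upRen_eq_upSub]
  have hA' := hA.weaken hC
  refine h.substTy.2 _ _ (.cons hA') ?_
  intro n D hD
  rw [← upRen_eq_upSub]
  refine .var (.cons hA') ?_
  cases hD with
  | here =>
    have : A.shift.rename (upRen Nat.succ) = A.shift.shift := by
      simp only [Term.shift, Term.rename_rename]; rfl
    rw [this]; exact .here _ _
  | there _ D _ n hn =>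
    have : D.shift.rename (upRen Nat.succ) = D.shift.shift := by
      simp only [Term.shift, Term.rename_rename]; rfl
    rw [this]; exact .there _ _ _ _ (.there _ _ _ _ hn)

theorem DefEq.beta_shift {Γ : List Term} {b A B : Term} {i : ℕ} (hA : HasType Γ A (.univ i))
    (h : HasType (A :: Γ) b B) : DefEq (A :: Γ) (.app (Term.lam A b).shift (.var 0)) b B := by
  have := DefEq.beta (HasType.weaken_up hA hA h) (.var (.cons hA) (.here _ _))
  rwa [Term.rename_up_inst, Term.rename_up_inst] at this

/-- Bodies of equal abstractions are equal, provided that they are well-typed. -/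
theorem DefEq.lam_inj {Γ : List Term} {b c A B : Term} {i : ℕ} (hA : HasType Γ A (.univ i))
    (hb : HasType (A :: Γ) b B) (hc : HasType (A :: Γ) c B)
    (h : DefEq Γ (.lam A b) (.lam A c) (.pi A B)) : DefEq (A :: Γ) b c B :=
  ((DefEq.beta_shift hA hb).symm.trans (h.app_shift hA)).trans (.beta_shift hA hc)

/-- All types of a context are well-formed. -/
def CtxTyped (p : ℕ) : Ctx → Prop
  | [] => True
  | A :: Γ => CtxTyped p Γ ∧ ∃ i, Typed p Γ A (.univ i)

theorem CtxTyped.wf {p : ℕ} : ∀ {Γ : Ctx}, CtxTyped p Γ → Wf p Γ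
  | [], _ => WfCtx.nil
  | _ :: _, h => h.2.choose_spec.wf

theorem Fns.OK.checkCtx_ok (hF : F.OK p) :
    ∀ {Γ : Ctx} {x : Unit}, F.checkCtx Γ = .ok x → CtxTyped p Γ
  | [], _, _ => trivial
  | _ :: _, _, h => by
    obtain ⟨_, h₁, h⟩ := Res.bind_eq_ok.1 h
    obtain ⟨_, h₂, _⟩ := Res.bind_eq_ok.1 h
    exact ⟨hF.checkCtx_ok h₁, _, hF.sort_ok (hF.checkCtx_ok h₁).wf h₂⟩

/-- Abstractions are removed one at a time: both sides are weakened, applied to the new variable and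
contracted by `β`. The typing hypotheses are what the `β` rule asks for. -/
theorem Equal.of_lams {p : ℕ} : ∀ {Γ : Ctx} {t u T : Term}, CtxTyped p Γ → Typed p Γ t T →
    Typed p Γ u T → Equal p [] (lams Γ t) (lams Γ u) (pis Γ T) → Equal p Γ t u T
  | [], _, _, _, _, _, _, h => h
  | A :: Γ, t, u, T, hΓ, ht, hu, h => by
    obtain ⟨hΓ, i, hA⟩ := hΓ
    exact DefEq.lam_inj hA ht hu (Equal.of_lams hΓ (Typed.lam ht) (Typed.lam hu) h)

theorem Fns.OK.checkComp_ok (hF : F.OK p) {x : Closed}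
    (hc : Comp (x.lhs.lv p) (x.rhs.lv p) (x.type.lv p)) (h : (F.checkComp x).isOk = true) :
    (Rule.ofComp x).OK p := by
  obtain ⟨_, h⟩ := Res.isOk_iff.1 h
  obtain ⟨_, h₁, h⟩ := Res.bind_eq_ok.1 h
  obtain ⟨_, h₂, h⟩ := Res.bind_eq_ok.1 h
  obtain ⟨_, h₃, h⟩ := Res.bind_eq_ok.1 h
  have hΓ := hF.checkCtx_ok h₁
  refine Equal.of_lams hΓ (hF.check hΓ.wf h₂) (hF.check hΓ.wf h₃) ?_
  generalize hb : (Term.eqb _ _ && _) = b at h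
  cases b with
  | false => simp at h
  | true =>
    simp only [Bool.and_eq_true] at hb
    rw [Term.eqb_eq hb.1, Term.eqb_eq hb.2.1, Term.eqb_eq hb.2.2]
    exact DefEq.comp .nil hc

end

/-- A rule without level codes is correct. -/
def Rule.Holds (ρ : Rule) : Prop := DefEq ρ.ctx ρ.lhs ρ.rhs ρ.type

/-- A checker without computation rules, by which the rules can be validated without circularity. -/
abbrev bare (n : ℕ) : Fns := fns noRules n

theorem bare_ok (p n : ℕ) : (bare n).OK p := fns_ok (noRules_ok p) n

/-- The check runs once, with the code `8`; the parameter `j` interprets this code as the level `j`.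
-/
theorem idRule_holds (j : ℕ) : (idRule j j).Holds :=
  (bare_ok j 30).checkComp_ok (x := idComp 8 8) (.id j j) (by decide +kernel)

theorem idRule_zero_one_holds : (idRule 0 1).Holds :=
  (bare_ok 0 30).checkComp_ok (x := idComp 0 1) (.id 0 1) (by decide +kernel)

theorem natZeroRule_holds (j : ℕ) : (natZeroRule j).Holds :=
  (bare_ok j 30).checkComp_ok (x := natZeroComp 8) (.natZero j) (by decide +kernel)

theorem natSuccRule_holds (j : ℕ) : (natSuccRule j).Holds :=
  (bare_ok j 30).checkComp_ok (x := natSuccComp 8) (.natSucc j) (by decide +kernel)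

theorem sigmaRule_holds (j : ℕ) : (sigmaRule j j).Holds :=
  (bare_ok j 30).checkComp_ok (x := sigmaComp 8 8) (.sigma j j) (by decide +kernel)

theorem inlRule_holds (j : ℕ) : (inlRule 0 j).Holds :=
  (bare_ok j 30).checkComp_ok (x := inlComp 0 8) (.inl 0 j) (by decide +kernel)

theorem inrRule_holds (j : ℕ) : (inrRule 0 j).Holds :=
  (bare_ok j 30).checkComp_ok (x := inrComp 0 8) (.inr 0 j) (by decide +kernel)

theorem brwZeroRule_holds (j : ℕ) : (brwZeroRule j).Holds :=
  (bare_ok j 30).checkComp_ok (x := brwZeroComp 8) (.brwZero j) (by decide +kernel)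

theorem brwSucRule_holds (j : ℕ) : (brwSucRule j).Holds :=
  (bare_ok j 30).checkComp_ok (x := brwSucComp 8) (.brwSuc j) (by decide +kernel)

/-- The computation rule for successors, on which the typing of that for limits depends. -/
def sucRules : Rules := fun c l d m =>
  match c with
  | .brwElim j =>
    match d with
    | .bsuc => match m with | [n] => some (brwSucRule j, n :: l.reverse) | _ => none
    | _ => none
  | _ => none

theorem sucRules_ok (p : ℕ) : sucRules.OK p := by
  intro c l d m ρ σ h
  unfold sucRules at h
  split at h
  · rename_i j
    split at h
    · split at h <;> simp only [Option.some.injEq, Prod.mk.injEq, reduceCtorEq] at h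
      rw [← h.1]
      exact brwSucRule_holds (lvl p j)
    · simp at h
  · simp at h

theorem brwLimRule_holds (j : ℕ) : (brwLimRule j).Holds :=
  (fns_ok (sucRules_ok j) 30).checkComp_ok (x := brwLimComp 8) (.brwLim j) (by decide +kernel)

theorem rules_ok (p : ℕ) : rules.OK p := by
  intro c l d m ρ σ h
  unfold rules at h
  split at h
  · rename_i i j
    cases hij : Nat.beq i j || (Nat.beq i 0 && Nat.beq j 1) with
    | false => simp [hij] at h
    | true =>
      rw [hij, cond_true] at h
      split at h
      · split at h <;> simp only [Option.some.injEq, Prod.mk.injEq, reduceCtorEq] at h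
        rw [← h.1]
        simp only [Bool.or_eq_true, Bool.and_eq_true] at hij
        obtain hij | hij := hij
        · have := Nat.eq_of_beq_eq_true hij
          subst this
          exact idRule_holds (lvl p i)
        · have h₁ := Nat.eq_of_beq_eq_true hij.1
          have h₂ := Nat.eq_of_beq_eq_true hij.2
          subst h₁ h₂
          exact idRule_zero_one_holds
      · simp at h
  · rename_i j
    split at h
    · split at h <;> simp only [Option.some.injEq, Prod.mk.injEq, reduceCtorEq] at h
      rw [← h.1]
      exact natZeroRule_holds (lvl p j)
    · split at h <;> simp only [Option.some.injEq, Prod.mk.injEq, reduceCtorEq] at h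
      rw [← h.1]
      exact natSuccRule_holds (lvl p j)
    · simp at h
  · rename_i i j
    cases hij : Nat.beq i j with
    | false => simp [hij] at h
    | true =>
      rw [hij, cond_true] at h
      have := Nat.eq_of_beq_eq_true hij
      subst this
      split at h
      · split at h <;> simp only [Option.some.injEq, Prod.mk.injEq, reduceCtorEq] at h
        rw [← h.1]
        exact sigmaRule_holds (lvl p i)
      · simp at h
  · rename_i i j
    cases hij : Nat.beq i 0 with
    | false => simp [hij] at h
    | true =>
      rw [hij, cond_true] at h
      have := Nat.eq_of_beq_eq_true hij
      subst this
      split at h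
      · split at h <;> simp only [Option.some.injEq, Prod.mk.injEq, reduceCtorEq] at h
        rw [← h.1]
        exact inlRule_holds (lvl p j)
      · split at h <;> simp only [Option.some.injEq, Prod.mk.injEq, reduceCtorEq] at h
        rw [← h.1]
        exact inrRule_holds (lvl p j)
      · simp at h
  · rename_i j
    split at h
    · split at h <;> simp only [Option.some.injEq, Prod.mk.injEq, reduceCtorEq] at h
      rw [← h.1]
      exact brwZeroRule_holds (lvl p j)
    · split at h <;> simp only [Option.some.injEq, Prod.mk.injEq, reduceCtorEq] at h
      rw [← h.1]
      exact brwSucRule_holds (lvl p j)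
    · split at h <;> simp only [Option.some.injEq, Prod.mk.injEq, reduceCtorEq] at h
      rw [← h.1]
      exact brwLimRule_holds (lvl p j)
    · simp at h
  · simp at h
/-! ### A surface language -/

/-- Surface terms, to be refined to raw terms. -/
inductive Surf : Type
  | core (t : Term)
  | app (f a : Surf)
  | lam (b : Surf)
  | have_ (A : Term) (s b : Surf)
  | pair (a b : Surf)
  | fst (p : Surf)
  | snd (p : Surf)
  | exI (a : Surf)
  | exE (e f : Surf)
  | sigE (f : Surf)
  | unpack (e f : Surf)
  | natE (z s : Surf)
  | caseE (f g : Surf)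
  | botE (e : Surf)
  | refl

/-! #### Untrusted normalization of types -/

/-- Contract all `β`-redexes and projections of pairs, as far as the fuel allows. -/
def Term.nice : ℕ → Term → Term
  | 0, t => t
  | n + 1, t =>
    match t with
    | .app f a =>
      match f.nice n with
      | .lam _ b => (b.psub [a] 0).nice n
      | .app (.app (.app (.app (.const (.sigmaElim i j)) A) B) C) g =>
        match a.nice n with
        | .app (.app (.app (.app (.const (.pair _)) _) _) x) y => (Term.app (.app g x) y).nice n
        | a' => .app (.app (.app (.app (.app (.const (.sigmaElim i j)) A) B) C) g) a'
      | f' => .app f' (a.nice n)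
    | .pi A B => .pi (A.nice n) (B.nice n)
    | .lam A B => .lam (A.nice n) (B.nice n)
    | t => t

def Term.isLam : Term → Bool
  | .lam _ _ => true
  | _ => false

/-- Whether a term has a `β`-redex or the projection of a pair. -/
def Term.hasRedex (t : Term) : Bool :=
  Term.rec (fun _ => false) (fun _ => false) (fun _ _ a b => a || b) (fun _ _ a b => a || b)
    (fun f a x y => f.isLam || (x || (y ||
      match f with
      | .app (.app (.app (.app (.const (.sigmaElim _ _)) _) _) _) _ =>
        match a with
        | .app (.app (.app (.app (.const (.pair _)) _) _) _) _ => true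
        | _ => false
      | _ => false))) (fun _ => false) t

/-- The application of a term, contracted if it is an abstraction. -/
def Term.beta (f a : Term) : Term :=
  match f with
  | .lam _ b => b.psub [a] 0
  | f => .app f a

def Term.norm (t : Term) : Term := bif t.hasRedex then t.nice 200 else t

/-! #### Refinement of surface terms -/

/-- The mutually recursive functions that refine surface terms. -/
structure Refiner where
  infer : Ctx → Surf → Res (Term × Term)
  check : Ctx → Surf → Term → Res Term

def Surf.spine : Surf → List Surf → Surf × List Surf
  | .app f a, l => f.spine (a :: l)
  | s, l => (s, l)

/-- Bring a type into a form that is recognized by `pat`. -/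
def Fns.expose {α : Type} (F : Fns) (pat : Term → Option α) (Γ : Ctx) (A : Term) :
    Res (Term × α) :=
  match pat A with
  | some x => .ok (A, x)
  | none => (F.whnf Γ A).bind fun r =>
    match r with
    | (A', some (.univ _)) =>
      match pat A' with
      | some x => .ok (A', x)
      | none => .err 13 (A' :: Γ)
    | _ => .err 13 (A :: Γ)

def patSigma : Term → Option (ℕ × Term × Term)
  | .app (.app (.const (.sigma i)) A) B => some (i, A, B)
  | _ => none

def patSum : Term → Option (ℕ × Term × Term)
  | .app (.app (.const (.sum i)) A) B => some (i, A, B)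
  | _ => none

def patTrunc : Term → Option (ℕ × Term)
  | .app (.const (.trunc i)) A => some (i, A)
  | _ => none

def patEq : Term → Option (ℕ × Term × Term)
  | .app (.app (.app (.const (.id i)) A) a) _ => some (i, A, a)
  | _ => none

/-- A proof that a truncation, an order or the empty type is a proposition. -/
def proveProp : Term → Option Term
  | .app (.const (.trunc i)) A => some (.app (.const (.squash i)) A)
  | .app (.app (.const .le) x) y => some (.app (.app (.const .leProp) x) y)
  | .const .empty => some (lam empty fun x => lam empty fun y =>
      con (.emptyElim 0) ⬝ (lam empty fun _ => eq 0 empty x y) ⬝ x).close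
  | _ => none

section

variable (F : Fns) (E : Refiner) (Γ : Ctx)

/-- Apply a typed function to a typed argument. -/
def Fns.appV (f a : Term × Term) : Res (Term × Term) :=
  (F.asPi Γ f.2).bind fun p => (F.cast Γ a.2 p.1).bind fun _ =>
    .ok (.app f.1 a.1, p.2.psub [a.1] 0)

/-- Apply a typed function to a raw term. -/
def Fns.appR (f : Term × Term) (a : Term) : Res (Term × Term) :=
  (F.asPi Γ f.2).bind fun p => (F.check Γ a p.1).bind fun _ =>
    .ok (.app f.1 a, p.2.psub [a] 0)

def constV (c : Const) : Res (Term × Term) :=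
  (inferConst c).bind fun T => .ok (.const c, T)

/-- Replace the type of a typed term. -/
def Fns.castV (v : Term × Term) (A : Term) : Res (Term × Term) :=
  (F.cast Γ v.2 A).bind fun _ => .ok (v.1, A)

def Fns.normV (v : Term × Term) : Res (Term × Term) :=
  bif v.2.hasRedex then F.castV Γ v (v.2.nice 200) else .ok v

/-- Check against a type in which redexes are contracted before. -/
def Refiner.checkN (s : Surf) (A : Term) : Res (Term × Term) :=
  bif A.hasRedex then
    let A' := A.nice 200
    (E.check Γ s A').bind fun t => F.castV Γ (t, A') A
  else (E.check Γ s A).bind fun t => .ok (t, A)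

/-- Apply a typed function to a surface term. -/
def Refiner.appS (f : Term × Term) (s : Surf) : Res (Term × Term) :=
  (F.asPi Γ f.2).bind fun p => (E.checkN F Γ s p.1).bind fun a =>
    .ok (.app f.1 a.1, p.2.psub [a.1] 0)

def Fns.appRs : Term × Term → List Term → Res (Term × Term)
  | v, [] => .ok v
  | v, a :: l => (F.appR Γ v a).bind fun w => Fns.appRs w l

def Refiner.appSs : Term × Term → List Surf → Res (Term × Term)
  | v, [] => .ok v
  | v, a :: l => (E.appS F Γ v a).bind fun w => Refiner.appSs w l

/-- Refine an application. -/
def Refiner.spine (s : Surf) : Res (Term × Term) :=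
  let q := s.spine []
  ((E.infer Γ q.1).bind fun v => E.appSs F Γ v q.2).bind fun v => F.normV Γ v

def Refiner.inferS (s : Surf) : Res (Term × Term) :=
  match s with
  | .core t => (F.infer Γ t).bind fun T => .ok (t, T)
  | .app _ _ => E.spine F Γ s
  | .fst p => (E.infer Γ p).bind fun v => (F.expose patSigma Γ v.2).bind fun r =>
      let A := r.2.2.1; let B := r.2.2.2; let S := Term.app (.app (.const (.sigma r.2.1)) A) B
      (constV (.sigmaElim r.2.1 r.2.1)).bind fun c =>
      (F.appRs Γ c [A, B, .lam S (A.lift 1 0),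
        .lam A (.lam (.app (B.lift 1 0) (.var 0)) (.var 1))]).bind fun w =>
      (F.castV Γ v S).bind fun v => (F.appV Γ w v).bind fun w => F.castV Γ w A
  | .snd p => (E.infer Γ p).bind fun v => (F.expose patSigma Γ v.2).bind fun r =>
      let i := r.2.1
      let A := r.2.2.1; let B := r.2.2.2; let S := Term.app (.app (.const (.sigma i)) A) B
      let proj (A B S p : Term) : Term :=
        .app (.app (.app (.app (.app (.const (.sigmaElim i i)) A) B) (.lam S (A.lift 1 0)))
          (.lam A (.lam (.app (B.lift 1 0) (.var 0)) (.var 1)))) p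
      (constV (.sigmaElim i i)).bind fun c =>
      (F.appRs Γ c [A, B,
        .lam S (.app (B.lift 1 0) (proj (A.lift 1 0) (B.lift 1 0) (S.lift 1 0) (.var 0))),
        .lam A (.lam (.app (B.lift 1 0) (.var 0)) (.var 0))]).bind fun w =>
      (F.castV Γ v S).bind fun v => (F.appV Γ w v).bind fun w =>
        F.castV Γ w (Term.app B (proj A B S v.1)).norm
  | _ => .err 15 Γ

/-- Motives and normal forms are guessed here, but each raw term is assembled by operations that
check types. Soundness therefore follows step by step and does not depend on the guesses. -/
def Refiner.checkS (s : Surf) (G : Term) : Res Term :=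
  match s with
  | .lam b => (F.asPi Γ G).bind fun p => (F.sort Γ p.1).bind fun _ =>
      (E.check (p.1 :: Γ) b p.2).bind fun t => .ok (.lam p.1 t)
  | .have_ A s b => (F.sort Γ A).bind fun _ => (E.checkN F Γ s A).bind fun t =>
      (E.check (A :: Γ) b (G.lift 1 0)).bind fun u => .ok (.app (.lam A u) t.1)
  | .pair a b => (F.expose patSigma Γ G).bind fun r =>
      (constV (.pair r.2.1)).bind fun c => (F.appRs Γ c [r.2.2.1, r.2.2.2]).bind fun w =>
      (E.appSs F Γ w [a, b]).bind fun w => (F.castV Γ w G).bind fun w => .ok w.1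
  | .exI a => (F.expose patTrunc Γ G).bind fun r =>
      (constV (.tr r.2.1)).bind fun c => (F.appR Γ c r.2.2).bind fun w =>
      (E.appS F Γ w a).bind fun w => (F.castV Γ w G).bind fun w => .ok w.1
  | .exE e f => (E.infer Γ e).bind fun v => (F.expose patTrunc Γ v.2).bind fun r =>
      match proveProp G with
      | none => .err 16 [G]
      | some h => (F.sort Γ G).bind fun j => (constV (.truncRec r.2.1 j)).bind fun c =>
        (F.appRs Γ c [r.2.2, G, h]).bind fun w => (E.appS F Γ w f).bind fun w =>
        (F.appV Γ w v).bind fun w => (F.castV Γ w G).bind fun w => .ok w.1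
  | .sigE f => (F.asPi Γ G).bind fun p => (F.expose patSigma Γ p.1).bind fun r =>
      let A := r.2.2.1; let B := r.2.2.2
      -- The type of the method: in the codomain `p.2`, whose variable `0` is the pair, two
      -- variables are inserted from index `1` on and the pair of these is substituted for the
      -- variable `0`.
      let M := Term.pi A (.pi ((B.lift 1 0).beta (.var 0)) ((p.2.lift 2 1).psub [.app (.app
        (.app (.app (.const (.pair r.2.1)) (A.lift 2 0)) (B.lift 2 0)) (.var 1)) (.var 0)] 0).norm)
      (F.sort Γ p.1).bind fun _ => (F.sort (p.1 :: Γ) p.2).bind fun j =>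
      (constV (.sigmaElim r.2.1 j)).bind fun c => (F.appRs Γ c [A, B]).bind fun w =>
      (F.appV Γ w (.lam p.1 p.2, .pi p.1 (.univ j))).bind fun w =>
      (E.check Γ f M).bind fun t => (F.appV Γ w (t, M)).bind fun w =>
      (F.castV Γ w G).bind fun w => .ok w.1
  | .unpack e f => (E.infer Γ e).bind fun v =>
      (E.check Γ (.sigE f) (.pi v.2 (G.lift 1 0))).bind fun t =>
      (F.appV Γ (t, .pi v.2 (G.lift 1 0)) v).bind fun w => (F.castV Γ w G).bind fun w => .ok w.1
  | .natE z s => (F.asPi Γ G).bind fun p =>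
      (F.sort Γ p.1).bind fun _ => (F.sort (p.1 :: Γ) p.2).bind fun j =>
      (constV (.natElim j)).bind fun c =>
      (F.appV Γ c (.lam p.1 p.2, .pi p.1 (.univ j))).bind fun w =>
      (E.appSs F Γ w [z, s]).bind fun w => (F.castV Γ w G).bind fun w => .ok w.1
  | .caseE f g => (F.asPi Γ G).bind fun p => (F.expose patSum Γ p.1).bind fun r =>
      (F.sort Γ p.1).bind fun _ => (F.sort (p.1 :: Γ) p.2).bind fun j =>
      (constV (.sumElim r.2.1 j)).bind fun c => (F.appRs Γ c [r.2.2.1, r.2.2.2]).bind fun w =>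
      (F.appV Γ w (.lam p.1 p.2, .pi p.1 (.univ j))).bind fun w =>
      (E.appSs F Γ w [f, g]).bind fun w => (F.castV Γ w G).bind fun w => .ok w.1
  | .botE e => (F.sort Γ G).bind fun j => (constV (.emptyElim j)).bind fun c =>
      (F.appR Γ c (.lam (.const .empty) (G.lift 1 0))).bind fun w =>
      (E.appS F Γ w e).bind fun w => (F.castV Γ w G).bind fun w => .ok w.1
  | .refl => (F.expose patEq Γ G).bind fun r =>
      (constV (.refl r.2.1)).bind fun c => (F.appRs Γ c [r.2.2.1, r.2.2.2]).bind fun w =>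
      (F.castV Γ w G).bind fun w => .ok w.1
  | .app _ _ => (E.spine F Γ s).bind fun w => (F.castV Γ w G).bind fun w => .ok w.1
  | s => (E.infer Γ s).bind fun w => (F.castV Γ w G).bind fun w => .ok w.1

end

def refiners (F : Fns) (n : ℕ) : Refiner :=
  Nat.rec ⟨fun _ _ => .err 0 [], fun _ _ _ => .err 0 []⟩
    (fun _ E => ⟨E.inferS F, E.checkS F⟩) n

/-! #### Soundness of the refinement -/

structure Refiner.OK (p : ℕ) (E : Refiner) : Prop where
  infer {Γ s v} : Wf p Γ → E.infer Γ s = .ok v → Typed p Γ v.1 v.2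
  check {Γ s A t} : Wf p Γ → E.check Γ s A = .ok t → Typed p Γ t A

theorem Term.lift_inst (t a : Term) : (t.lift 1 0).psub [a] 0 = t := by
  rw [Term.psub_singleton, Term.lift_one, Term.inst, Term.shift_subst]
  exact t.subst_var

section

variable {p : ℕ} {F : Fns} {E : Refiner} {Γ : Ctx}

theorem Fns.OK.appV_ok (hF : F.OK p) (hΓ : Wf p Γ) {f a w : Term × Term}
    (hf : Typed p Γ f.1 f.2) (ha : Typed p Γ a.1 a.2) (h : F.appV Γ f a = .ok w) :
    Typed p Γ w.1 w.2 := by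
  obtain ⟨q, hq, h⟩ := Res.bind_eq_ok.1 h
  obtain ⟨x, hx, h⟩ := Res.bind_eq_ok.1 h
  simp only [Res.ok.injEq] at h
  subst h
  exact (hF.asPi_typed hΓ hq hf).app (hF.cast_typed hΓ hx ha)

theorem Fns.OK.appR_ok (hF : F.OK p) (hΓ : Wf p Γ) {f w : Term × Term} {a : Term}
    (hf : Typed p Γ f.1 f.2) (h : F.appR Γ f a = .ok w) : Typed p Γ w.1 w.2 := by
  obtain ⟨q, hq, h⟩ := Res.bind_eq_ok.1 h
  obtain ⟨x, hx, h⟩ := Res.bind_eq_ok.1 h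
  simp only [Res.ok.injEq] at h
  subst h
  exact (hF.asPi_typed hΓ hq hf).app (hF.check hΓ hx)

theorem Fns.OK.appRs_ok (hF : F.OK p) (hΓ : Wf p Γ) : ∀ {l : List Term} {f w : Term × Term},
    Typed p Γ f.1 f.2 → F.appRs Γ f l = .ok w → Typed p Γ w.1 w.2
  | [], f, w, hf, h => by
    simp only [Fns.appRs, Res.ok.injEq] at h
    exact h ▸ hf
  | a :: l, f, w, hf, h => by
    obtain ⟨v, hv, h⟩ := Res.bind_eq_ok.1 h
    exact hF.appRs_ok hΓ (hF.appR_ok hΓ hf hv) h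

theorem constV_ok (hΓ : Wf p Γ) {c : Const} {w : Term × Term} (h : constV c = .ok w) :
    Typed p Γ w.1 w.2 := by
  obtain ⟨T, hT, h⟩ := Res.bind_eq_ok.1 h
  simp only [Res.ok.injEq] at h
  subst h
  exact Typed.const hΓ hT

theorem Fns.OK.castV_ok (hF : F.OK p) (hΓ : Wf p Γ) {v w : Term × Term} {A : Term}
    (hv : Typed p Γ v.1 v.2) (h : F.castV Γ v A = .ok w) : Typed p Γ w.1 w.2 ∧ w.2 = A := by
  obtain ⟨x, hx, h⟩ := Res.bind_eq_ok.1 h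
  simp only [Res.ok.injEq] at h
  subst h
  exact ⟨hF.cast_typed hΓ hx hv, rfl⟩

theorem Fns.OK.castV_fst (hF : F.OK p) (hΓ : Wf p Γ) {v : Term × Term} {A t : Term}
    (hv : Typed p Γ v.1 v.2) (h : ((F.castV Γ v A).bind fun w => .ok w.1) = .ok t) :
    Typed p Γ t A := by
  obtain ⟨w, hw, h⟩ := Res.bind_eq_ok.1 h
  simp only [Res.ok.injEq] at h
  subst h
  obtain ⟨h₁, h₂⟩ := hF.castV_ok hΓ hv hw
  exact h₂ ▸ h₁

theorem Fns.OK.normV_ok (hF : F.OK p) (hΓ : Wf p Γ) {v w : Term × Term}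
    (hv : Typed p Γ v.1 v.2) (h : F.normV Γ v = .ok w) : Typed p Γ w.1 w.2 := by
  unfold Fns.normV at h
  cases hr : v.2.hasRedex with
  | true => rw [hr, cond_true] at h; exact (hF.castV_ok hΓ hv h).1
  | false =>
    simp only [hr, cond_false, Res.ok.injEq] at h
    exact h ▸ hv

theorem Refiner.OK.checkN_ok (hE : E.OK p) (hF : F.OK p) (hΓ : Wf p Γ) {s : Surf} {A : Term}
    {w : Term × Term} (h : E.checkN F Γ s A = .ok w) : Typed p Γ w.1 A := by
  unfold Refiner.checkN at h
  cases hr : A.hasRedex with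
  | true =>
    rw [hr, cond_true] at h
    obtain ⟨t, ht, h⟩ := Res.bind_eq_ok.1 h
    obtain ⟨h₁, h₂⟩ := hF.castV_ok hΓ (v := (t, _)) (hE.check hΓ ht) h
    exact h₂ ▸ h₁
  | false =>
    rw [hr, cond_false] at h
    obtain ⟨t, ht, h⟩ := Res.bind_eq_ok.1 h
    simp only [Res.ok.injEq] at h
    subst h
    exact hE.check hΓ ht

theorem Refiner.OK.appS_ok (hE : E.OK p) (hF : F.OK p) (hΓ : Wf p Γ) {f w : Term × Term} {s : Surf}
    (hf : Typed p Γ f.1 f.2) (h : E.appS F Γ f s = .ok w) : Typed p Γ w.1 w.2 := by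
  obtain ⟨q, hq, h⟩ := Res.bind_eq_ok.1 h
  obtain ⟨a, ha, h⟩ := Res.bind_eq_ok.1 h
  simp only [Res.ok.injEq] at h
  subst h
  exact (hF.asPi_typed hΓ hq hf).app (hE.checkN_ok hF hΓ ha)

theorem Refiner.OK.appSs_ok (hE : E.OK p) (hF : F.OK p) (hΓ : Wf p Γ) :
    ∀ {l : List Surf} {f w : Term × Term},
      Typed p Γ f.1 f.2 → E.appSs F Γ f l = .ok w → Typed p Γ w.1 w.2
  | [], f, w, hf, h => by
    simp only [Refiner.appSs, Res.ok.injEq] at h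
    exact h ▸ hf
  | a :: l, f, w, hf, h => by
    obtain ⟨v, hv, h⟩ := Res.bind_eq_ok.1 h
    exact hE.appSs_ok hF hΓ (hE.appS_ok hF hΓ hf hv) h

theorem Refiner.OK.spine_ok (hE : E.OK p) (hF : F.OK p) (hΓ : Wf p Γ) {s : Surf}
    {w : Term × Term} (h : E.spine F Γ s = .ok w) : Typed p Γ w.1 w.2 := by
  obtain ⟨v, hv, h⟩ := Res.bind_eq_ok.1 h
  obtain ⟨u, hu, hv⟩ := Res.bind_eq_ok.1 hv
  exact hF.normV_ok hΓ (hE.appSs_ok hF hΓ (hE.infer hΓ hu) hv) h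

theorem Refiner.OK.inferS_ok (hE : E.OK p) (hF : F.OK p) (hΓ : Wf p Γ) {s : Surf}
    {w : Term × Term} (h : E.inferS F Γ s = .ok w) : Typed p Γ w.1 w.2 := by
  cases s with
  | core t =>
    obtain ⟨T, hT, h⟩ := Res.bind_eq_ok.1 h
    simp only [Res.ok.injEq] at h
    subst h
    exact hF.infer hΓ hT
  | app _ _ => exact hE.spine_ok hF hΓ h
  | fst _ =>
    obtain ⟨v, hv, h⟩ := Res.bind_eq_ok.1 h
    obtain ⟨r, hr, h⟩ := Res.bind_eq_ok.1 h
    obtain ⟨c, hc, h⟩ := Res.bind_eq_ok.1 h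
    obtain ⟨w₁, h₁, h⟩ := Res.bind_eq_ok.1 h
    obtain ⟨v₁, hv₁, h⟩ := Res.bind_eq_ok.1 h
    obtain ⟨w₂, h₂, h⟩ := Res.bind_eq_ok.1 h
    exact (hF.castV_ok hΓ (hF.appV_ok hΓ (hF.appRs_ok hΓ (constV_ok hΓ hc) h₁)
      (hF.castV_ok hΓ (hE.infer hΓ hv) hv₁).1 h₂) h).1
  | snd _ =>
    obtain ⟨v, hv, h⟩ := Res.bind_eq_ok.1 h
    obtain ⟨r, hr, h⟩ := Res.bind_eq_ok.1 h
    obtain ⟨c, hc, h⟩ := Res.bind_eq_ok.1 h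
    obtain ⟨w₁, h₁, h⟩ := Res.bind_eq_ok.1 h
    obtain ⟨v₁, hv₁, h⟩ := Res.bind_eq_ok.1 h
    obtain ⟨w₂, h₂, h⟩ := Res.bind_eq_ok.1 h
    exact (hF.castV_ok hΓ (hF.appV_ok hΓ (hF.appRs_ok hΓ (constV_ok hΓ hc) h₁)
      (hF.castV_ok hΓ (hE.infer hΓ hv) hv₁).1 h₂) h).1
  | _ => simp [Refiner.inferS] at h

/-- The typing of a motive. -/
theorem Fns.OK.motive_ok (hF : F.OK p) (hΓ : Wf p Γ) {A B : Term} {i j : ℕ}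
    (hA : F.sort Γ A = .ok i) (hB : F.sort (A :: Γ) B = .ok j) :
    Typed p Γ (.lam A B) (.pi A (.univ j)) :=
  .lam (hF.sort_ok (hF.sort_ok hΓ hA).wf hB)

theorem Refiner.OK.spineCast_ok (hE : E.OK p) (hF : F.OK p) (hΓ : Wf p Γ) {s : Surf} {G t : Term}
    (h : ((E.spine F Γ s).bind fun w => (F.castV Γ w G).bind fun w => .ok w.1) = .ok t) :
    Typed p Γ t G := by
  obtain ⟨w, hw, h⟩ := Res.bind_eq_ok.1 h
  exact hF.castV_fst hΓ (hE.spine_ok hF hΓ hw) h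

theorem Refiner.OK.inferCast_ok (hE : E.OK p) (hF : F.OK p) (hΓ : Wf p Γ) {s : Surf} {G t : Term}
    (h : ((E.infer Γ s).bind fun w => (F.castV Γ w G).bind fun w => .ok w.1) = .ok t) :
    Typed p Γ t G := by
  obtain ⟨w, hw, h⟩ := Res.bind_eq_ok.1 h
  exact hF.castV_fst hΓ (hE.infer hΓ hw) h

theorem Refiner.OK.checkS_ok (hE : E.OK p) (hF : F.OK p) (hΓ : Wf p Γ) {s : Surf}
    {G t : Term} (h : E.checkS F Γ s G = .ok t) : Typed p Γ t G := by
  cases s with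
  | lam b =>
    obtain ⟨q, hq, h⟩ := Res.bind_eq_ok.1 h
    obtain ⟨i, hi, h⟩ := Res.bind_eq_ok.1 h
    obtain ⟨u, hu, h⟩ := Res.bind_eq_ok.1 h
    simp only [Res.ok.injEq] at h
    subst h
    exact hF.of_asPi_typed hΓ hq (.lam (hE.check (hF.sort_ok hΓ hi).wf hu))
  | have_ A s b =>
    obtain ⟨i, hi, h⟩ := Res.bind_eq_ok.1 h
    obtain ⟨u, hu, h⟩ := Res.bind_eq_ok.1 h
    obtain ⟨v, hv, h⟩ := Res.bind_eq_ok.1 h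
    simp only [Res.ok.injEq] at h
    subst h
    have := (Typed.lam (hE.check (hF.sort_ok hΓ hi).wf hv)).app (hE.checkN_ok hF hΓ hu)
    rwa [Term.lift_inst] at this
  | pair a b =>
    obtain ⟨r, hr, h⟩ := Res.bind_eq_ok.1 h
    obtain ⟨c, hc, h⟩ := Res.bind_eq_ok.1 h
    obtain ⟨w, hw, h⟩ := Res.bind_eq_ok.1 h
    obtain ⟨v, hv, h⟩ := Res.bind_eq_ok.1 h
    exact hF.castV_fst hΓ (hE.appSs_ok hF hΓ (hF.appRs_ok hΓ (constV_ok hΓ hc) hw) hv) h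
  | exI a =>
    obtain ⟨r, hr, h⟩ := Res.bind_eq_ok.1 h
    obtain ⟨c, hc, h⟩ := Res.bind_eq_ok.1 h
    obtain ⟨w, hw, h⟩ := Res.bind_eq_ok.1 h
    obtain ⟨v, hv, h⟩ := Res.bind_eq_ok.1 h
    exact hF.castV_fst hΓ (hE.appS_ok hF hΓ (hF.appR_ok hΓ (constV_ok hΓ hc) hw) hv) h
  | exE e f =>
    obtain ⟨v, hv, h⟩ := Res.bind_eq_ok.1 h
    obtain ⟨r, hr, h⟩ := Res.bind_eq_ok.1 h
    split at h
    · simp at h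
    · obtain ⟨j, hj, h⟩ := Res.bind_eq_ok.1 h
      obtain ⟨c, hc, h⟩ := Res.bind_eq_ok.1 h
      obtain ⟨w, hw, h⟩ := Res.bind_eq_ok.1 h
      obtain ⟨x, hx, h⟩ := Res.bind_eq_ok.1 h
      obtain ⟨y, hy, h⟩ := Res.bind_eq_ok.1 h
      exact hF.castV_fst hΓ (hF.appV_ok hΓ (hE.appS_ok hF hΓ
        (hF.appRs_ok hΓ (constV_ok hΓ hc) hw) hx) (hE.infer hΓ hv) hy) h
  | sigE f =>
    obtain ⟨q, hq, h⟩ := Res.bind_eq_ok.1 h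
    obtain ⟨r, hr, h⟩ := Res.bind_eq_ok.1 h
    obtain ⟨i, hi, h⟩ := Res.bind_eq_ok.1 h
    obtain ⟨j, hj, h⟩ := Res.bind_eq_ok.1 h
    obtain ⟨c, hc, h⟩ := Res.bind_eq_ok.1 h
    obtain ⟨w, hw, h⟩ := Res.bind_eq_ok.1 h
    obtain ⟨x, hx, h⟩ := Res.bind_eq_ok.1 h
    obtain ⟨y, hy, h⟩ := Res.bind_eq_ok.1 h
    obtain ⟨z, hz, h⟩ := Res.bind_eq_ok.1 h
    exact hF.castV_fst hΓ (hF.appV_ok hΓ (hF.appV_ok hΓ (hF.appRs_ok hΓ (constV_ok hΓ hc) hw)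
      (hF.motive_ok hΓ hi hj) hx) (hE.check hΓ hy) hz) h
  | unpack e f =>
    obtain ⟨v, hv, h⟩ := Res.bind_eq_ok.1 h
    obtain ⟨u, hu, h⟩ := Res.bind_eq_ok.1 h
    obtain ⟨w, hw, h⟩ := Res.bind_eq_ok.1 h
    exact hF.castV_fst hΓ (hF.appV_ok hΓ (f := (u, _)) (hE.check hΓ hu) (hE.infer hΓ hv) hw) h
  | natE z s =>
    obtain ⟨q, hq, h⟩ := Res.bind_eq_ok.1 h
    obtain ⟨i, hi, h⟩ := Res.bind_eq_ok.1 h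
    obtain ⟨j, hj, h⟩ := Res.bind_eq_ok.1 h
    obtain ⟨c, hc, h⟩ := Res.bind_eq_ok.1 h
    obtain ⟨x, hx, h⟩ := Res.bind_eq_ok.1 h
    obtain ⟨y, hy, h⟩ := Res.bind_eq_ok.1 h
    exact hF.castV_fst hΓ (hE.appSs_ok hF hΓ (hF.appV_ok hΓ (constV_ok hΓ hc)
      (hF.motive_ok hΓ hi hj) hx) hy) h
  | caseE f g =>
    obtain ⟨q, hq, h⟩ := Res.bind_eq_ok.1 h
    obtain ⟨r, hr, h⟩ := Res.bind_eq_ok.1 h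
    obtain ⟨i, hi, h⟩ := Res.bind_eq_ok.1 h
    obtain ⟨j, hj, h⟩ := Res.bind_eq_ok.1 h
    obtain ⟨c, hc, h⟩ := Res.bind_eq_ok.1 h
    obtain ⟨w, hw, h⟩ := Res.bind_eq_ok.1 h
    obtain ⟨x, hx, h⟩ := Res.bind_eq_ok.1 h
    obtain ⟨y, hy, h⟩ := Res.bind_eq_ok.1 h
    exact hF.castV_fst hΓ (hE.appSs_ok hF hΓ (hF.appV_ok hΓ (hF.appRs_ok hΓ (constV_ok hΓ hc) hw)
      (hF.motive_ok hΓ hi hj) hx) hy) h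
  | botE e =>
    obtain ⟨j, hj, h⟩ := Res.bind_eq_ok.1 h
    obtain ⟨c, hc, h⟩ := Res.bind_eq_ok.1 h
    obtain ⟨x, hx, h⟩ := Res.bind_eq_ok.1 h
    obtain ⟨y, hy, h⟩ := Res.bind_eq_ok.1 h
    exact hF.castV_fst hΓ (hE.appS_ok hF hΓ (hF.appR_ok hΓ (constV_ok hΓ hc) hx) hy) h
  | refl =>
    obtain ⟨r, hr, h⟩ := Res.bind_eq_ok.1 h
    obtain ⟨c, hc, h⟩ := Res.bind_eq_ok.1 h
    obtain ⟨x, hx, h⟩ := Res.bind_eq_ok.1 h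
    exact hF.castV_fst hΓ (hF.appRs_ok hΓ (constV_ok hΓ hc) hx) h
  | app _ _ => exact hE.spineCast_ok hF hΓ h
  | _ => exact hE.inferCast_ok hF hΓ h

theorem refiners_ok (hF : F.OK p) : ∀ n, (refiners F n).OK p
  | 0 => ⟨by simp [refiners], by simp [refiners]⟩
  | n + 1 => ⟨fun hΓ h => (refiners_ok hF n).inferS_ok hF hΓ h,
      fun hΓ h => (refiners_ok hF n).checkS_ok hF hΓ h⟩

end

/-! #### Surface terms with named variables -/

/-- Surface terms as a function of the number of enclosing binders. -/
def S : Type := ℕ → Surf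

instance : Coe Tm S := ⟨fun t d => .core (t d)⟩

namespace S

def app (f a : S) : S := fun d => .app (f d) (a d)
def lam (b : Tm → S) : S := fun d => .lam (b (fun e => .var (e - (d + 1))) (d + 1))
def have_ (A : Tm) (s : S) (b : Tm → S) : S :=
  fun d => .have_ (A d) (s d) (b (fun e => .var (e - (d + 1))) (d + 1))
def pair (a b : S) : S := fun d => .pair (a d) (b d)
def fst (a : S) : S := fun d => .fst (a d)
def snd (a : S) : S := fun d => .snd (a d)
def exI (a : S) : S := fun d => .exI (a d)
def exE (e : S) (f : Tm → S) : S := fun d => .exE (e d) (lam f d)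
def natE (z : S) (s : Tm → Tm → S) : S := fun d => .natE (z d) (lam (fun n => lam (s n)) d)
def sigE (f : Tm → Tm → S) : S := fun d => .sigE (lam (fun x => lam (f x)) d)
def unpack (e : S) (f : Tm → Tm → S) : S := fun d => .unpack (e d) (lam (fun x => lam (f x)) d)
def caseE (f g : Tm → S) : S := fun d => .caseE (lam f d) (lam g d)
def botE (e : S) : S := fun d => .botE (e d)
def refl : S := fun _ => .refl

end S

infixl:80 " ⋅ " => HoTT.S.app

/-- The refiner that is used for all proofs. -/
def refiner : Refiner := refiners (fns rules 40) 150

/-- The surface term `s` is refined to an element of `A`. -/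
def verify (s : S) (A : Tm) : Bool := (refiner.check [] (s 0) A.close).isOk

/-- Soundness of the checker is uniform in the parameter, so a single successful run yields a
derivation for every level. -/
theorem verify_sound {s : S} {A : Tm} (h : verify s A = true) (p : ℕ) :
    ∃ t, HasType [] t (A.close.lv p) := by
  obtain ⟨t, ht⟩ := Res.isOk_iff.1 h
  exact ⟨_, (refiners_ok (fns_ok (rules_ok p) _) _).check (Γ := []) WfCtx.nil ht⟩

/-! ### Combining proofs -/

/-- The type `A`, in which level codes may occur, is inhabited at all levels. -/
def Valid (A : Tm) : Prop := ∀ p, ∃ t, HasType [] t (A.close.lv p)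

theorem valid_of_verify {A : Tm} (s : S) (h : verify s A = true) : Valid A := verify_sound h

/-- Whether `A` is closed and does not depend on the number of enclosing binders. -/
def isClosed (A : Tm) : Bool := Term.eqb (A 1) (A 0) && Term.eqb ((A 0).lift 1 0) (A 0)

theorem isClosed_lv {A : Tm} (h : isClosed A = true) (p : ℕ) (a : Term) :
    ((A 1).lv p).inst a = A.close.lv p := by
  simp only [isClosed, Bool.and_eq_true] at h
  rw [Term.eqb_eq h.1]
  have := Term.eqb_eq h.2
  conv_lhs => rw [← this, Term.lift_one, Term.lv_shift, Term.inst, Term.shift_subst]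
  exact Term.subst_var _

theorem Valid.mp {A B : Tm} (h : Valid (A ⇒ B)) (hA : Valid A) (hB : isClosed B = true) :
    Valid B := by
  intro p
  obtain ⟨t, ht⟩ := h p
  obtain ⟨a, ha⟩ := hA p
  have := HasType.app (A := A.close.lv p) (B := (B 1).lv p) ht ha
  rw [isClosed_lv hB] at this
  exact ⟨_, this⟩

/-- This specializes a statement about the parameter to fixed levels: reading the code `8` as `0` or
`1` gives the instance at that numeral. -/
theorem Valid.change {A B : Tm} (q : ℕ → ℕ) (hA : Valid A)
    (h : ∀ p, B.close.lv p = A.close.lv (q p)) : Valid B := by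
  intro p
  obtain ⟨t, ht⟩ := hA (q p)
  exact ⟨t, (h p) ▸ ht⟩

/-! ### Propositions and sets -/

def J (i j : ℕ) (A a : Tm) (C : Tm → Tm → Tm) (b : S) (x p : Tm) : S :=
  (con (.idElim i j) ⬝ A ⬝ a ⬝ lam A fun z => lam (eq i A a z) fun p => C z p : Tm) ⋅ b ⋅ x ⋅ p

def Jt (i j : ℕ) (A a : Tm) (C : Tm → Tm → Tm) (b : Tm) (x p : Tm) : Tm :=
  con (.idElim i j) ⬝ A ⬝ a ⬝ (lam A fun z => lam (eq i A a z) fun p => C z p) ⬝ b ⬝ x ⬝ p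

/-- A reflexive relation that is valued in propositions and implies equality makes the type a set.
The map `x = y → R x y → x = y`, corrected by its value at reflexivity, is the identity by path
induction; it factors through a proposition, so any two paths agree. -/
def setOfRel (i j : ℕ) : Tm :=
  pi (U i) fun A => pi (A ⇒ A ⇒ U j) fun R => (pi A fun x => R ⬝ x ⬝ x) ⇒
    (pi A fun x => pi A fun y => isProp j (R ⬝ x ⬝ y)) ⇒
    (pi A fun x => pi A fun y => R ⬝ x ⬝ y ⇒ eq i A x y) ⇒ isSet i A

/-- `z = y` from `x = z` and `x = y`. -/
def cancel (i : ℕ) (A x z q y r : Tm) : Tm :=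
  Jt i i A x (fun z _ => pi A fun y => eq i A x y ⇒ eq i A z y)
    (lam A fun y => lam (eq i A x y) fun s => s) z q ⬝ y ⬝ r

def setOfRelS (i j : ℕ) : S :=
  .lam fun A => .lam fun R => .lam fun r0 => .lam fun hR => .lam fun e =>
  .lam fun x => .lam fun y =>
  let tr := fun y p => Jt i i A x (fun y _ => R ⬝ x ⬝ y) (r0 ⬝ x) y p
  .have_ (pi A fun z => pi (eq i A x z) fun q =>
    eq i (eq i A z z) (cancel i A x z q z q) (refl i A z))
    (.lam fun z => .lam fun q => J i i A x
      (fun z q => eq i (eq i A z z) (cancel i A x z q z q) (refl i A z)) .refl z q) fun cq =>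
  .have_ (pi A fun y => pi (eq i A x y) fun p =>
      eq i (eq i A x y) (cancel i A x x (e ⬝ x ⬝ x ⬝ (r0 ⬝ x)) y (e ⬝ x ⬝ y ⬝ tr y p)) p)
    (.lam fun y => .lam fun p => J i i A x
      (fun y p => eq i (eq i A x y) (cancel i A x x (e ⬝ x ⬝ x ⬝ (r0 ⬝ x)) y (e ⬝ x ⬝ y ⬝
        tr y p)) p)
      (cq ⬝ x ⬝ (e ⬝ x ⬝ x ⬝ (r0 ⬝ x))) y p) fun k =>
  .lam fun p => .lam fun p' =>
  let E := eq i A x y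
  let d := fun r => cancel i A x x (e ⬝ x ⬝ x ⬝ (r0 ⬝ x)) y (e ⬝ x ⬝ y ⬝ r)
  -- The paths `p` and `p'` have the same image in the proposition `R x y`, so what `d` recovers
  -- from either image is `p` as well as `p'`.
  .have_ (eq i E (d (tr y p')) p)
    (J j i (R ⬝ x ⬝ y) (tr y p) (fun r _ => eq i E (d r) p) (k ⬝ y ⬝ p) (tr y p')
      (hR ⬝ x ⬝ y ⬝ tr y p ⬝ tr y p')) fun h =>
  cancel i E (d (tr y p')) p h p' (k ⬝ y ⬝ p')

theorem setOfRel_valid : Valid (setOfRel 8 8) :=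
  valid_of_verify (setOfRelS 8 8) (by decide +kernel)

theorem setOfRel_one_zero : Valid (setOfRel 1 0) :=
  valid_of_verify (setOfRelS 1 0) (by decide +kernel)

-- Function extensionality and closure properties of propositions

def funExt (i : ℕ) : Tm := pi (U i) fun A => pi (A ⇒ U i) fun B => pi (pi A fun x => B ⬝
    x) fun f => pi (pi A fun x => B ⬝ x) fun g => (pi A fun x => eq i (B ⬝ x) (f ⬝ x) (g ⬝ x)) ⇒
    eq i (pi A fun x => B ⬝ x) f g

def funExtS : S := .lam fun A => .lam fun B => .lam fun f => .lam fun g =>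
  .lam fun h => .unpack (con (.funext 8) ⬝ A ⬝ B ⬝ f ⬝ g) fun q _ => .unpack q fun r _ => (r : S) ⋅
    h

theorem funExt_valid : Valid (funExt 8) := valid_of_verify funExtS (by decide +kernel)

def propPi (i : ℕ) : Tm := pi (U i) fun A => pi (A ⇒ U i) fun B =>
  (pi A fun x => isProp i (B ⬝ x)) ⇒ isProp i (pi A fun x => B ⬝ x)

def propPiS : S := .lam fun fe => .lam fun A => .lam fun B => .lam fun h' => .lam fun f =>
    .lam fun g => fe ⬝ A ⬝ B ⬝ f ⬝ g ⋅ .lam fun x => h' ⬝ x ⬝ (f ⬝ x) ⬝ (g ⬝ x)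

theorem propPi_valid : Valid (propPi 8) :=
  (valid_of_verify (A := funExt 8 ⇒ propPi 8) propPiS (by decide +kernel)).mp
    funExt_valid (by decide +kernel)

theorem propPi_valid_zero : Valid (propPi 0) := propPi_valid.change (fun _ => 0) fun _ => rfl

/-- This is `setOfRel` for the relation with constant value `A`. -/
def propIsSet (i : ℕ) : Tm := pi (U i) fun A => isProp i A ⇒ isSet i A

def propIsSetS : S := .lam fun sr => .lam fun A => .lam fun h =>
  sr ⬝ A ⬝ (lam A fun _ => lam A fun _ => A) ⋅ (.lam fun x => x) ⋅ (.lam fun _ => .lam fun _ =>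
    h) ⋅ (.lam fun x => .lam fun y => .lam fun _ => h ⬝ x ⬝ y)

theorem propIsSet_valid : Valid (propIsSet 8) :=
  (valid_of_verify (A := setOfRel 8 8 ⇒ propIsSet 8) propIsSetS (by decide +kernel)).mp
    setOfRel_valid (by decide +kernel)

def propIsProp (i : ℕ) : Tm := pi (U i) fun A => isProp i (isProp i A)

def propIsPropS (i : ℕ) : S := .lam fun pp => .lam fun is => .lam fun A => .lam fun f =>
    .lam fun g =>
  pp ⬝ A ⬝ (lam A fun x => pi A fun y => eq i A x y) ⋅ (.lam fun x =>
    pp ⬝ A ⬝ (lam A fun y => eq i A x y) ⋅ (.lam fun y => is ⬝ A ⬝ f ⬝ x ⬝ y)) ⋅ f ⋅ g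

theorem propIsProp_valid : Valid (propIsProp 8) :=
  ((valid_of_verify (A := propPi 8 ⇒ propIsSet 8 ⇒ propIsProp 8) (propIsPropS 8)
    (by decide +kernel)).mp propPi_valid (by decide +kernel)).mp
    propIsSet_valid (by decide +kernel)

/-- Identity types at different levels are different constants, so under cumulativity the proof of
being a proposition has to be carried over by path induction. -/
def liftProp (i j : ℕ) : Tm := pi (U i) fun A => isProp i A ⇒ isProp j A

def liftPropS (i j : ℕ) : S := .lam fun A => .lam fun h => .lam fun x => .lam fun y =>
  J i j A x (fun z _ => eq j A x z) .refl y (h ⬝ x ⬝ y)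

theorem liftProp_valid : Valid (liftProp 0 8) :=
  valid_of_verify (liftPropS 0 8) (by decide +kernel)

theorem liftProp_valid_one : Valid (liftProp 0 1) := liftProp_valid.change (fun _ => 1) fun _ => rfl

def propProd (i : ℕ) : Tm := pi (U i) fun A => pi (U i) fun B => isProp i A ⇒ isProp i B ⇒
    isProp i (prod i A B)

def propProdS (i : ℕ) : S := .lam fun A => .lam fun B => .lam fun hA => .lam fun hB =>
  .sigE fun a b => .sigE fun a' b' =>
  let pr := pair i A (fun _ => B)
  J i i A a (fun z _ => eq i (prod i A B) (pr a b) (pr z b'))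
    (J i i B b (fun w _ => eq i (prod i A B) (pr a b) (pr a w)) .refl b' (hB ⬝ b ⬝ b')) a' (hA ⬝
      a ⬝ a')

theorem propProd_valid : Valid (propProd 8) :=
  valid_of_verify (propProdS 8) (by decide +kernel)

-- Extensionality for propositions

def propExt (i : ℕ) : Tm := pi (U i) fun A => pi (U i) fun B => isProp i A ⇒ isProp i B ⇒ (A ⇒ B) ⇒
    (B ⇒ A) ⇒ eq (i + 1) (U i) A B

def propExtS (i : ℕ) : S := .lam fun A => .lam fun B => .lam fun hA => .lam fun hB => .lam fun f =>
    .lam fun g =>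
  .unpack (con (.univalence i) ⬝ A ⬝ B) fun q _ => .unpack q fun r _ => (r : S) ⋅ .pair f (.pair
    (.pair g (.lam fun y => hB ⬝ (f ⬝ (g ⬝ y)) ⬝ y)) (.pair g (.lam fun x => hA ⬝ (g ⬝ (f ⬝ x)) ⬝
      x)))

theorem propExt_valid : Valid (propExt 0) :=
  valid_of_verify (propExtS 0) (by decide +kernel)

/-- Univalence identifies the underlying types; after path induction along this equality the
remaining components are equal, because being a proposition is a proposition. -/
def hPropEq : Tm := pi (hProp 0) fun P => pi (hProp 0) fun Q => (holds 0 P ⇒ holds 0 Q) ⇒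
    (holds 0 Q ⇒ holds 0 P) ⇒ eq 1 (hProp 0) P Q

def hPropEqS : S := .lam fun pe => .lam fun pp => .sigE fun A p => .sigE fun B q => .lam fun f =>
    .lam fun g =>
  let pr := pair 1 (U 0) (fun A => isProp 0 A)
  J 1 1 (U 0) A (fun X _ => pi (isProp 0 X) fun q => eq 1 (hProp 0) (pr A p) (pr X q))
    (.lam fun q => J 0 1 (isProp 0 A) p (fun r _ => eq 1 (hProp 0) (pr A p) (pr A r)) .refl q (pp ⬝
      A ⬝ p ⬝ q))
    B (pe ⬝ A ⬝ B ⬝ p ⬝ q ⬝ f ⬝ g) ⋅ q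

theorem hPropEq_valid : Valid hPropEq :=
  ((valid_of_verify (A := propExt 0 ⇒ propIsProp 0 ⇒ hPropEq) hPropEqS
    (by decide +kernel)).mp propExt_valid (by decide +kernel)).mp
    (propIsProp_valid.change (fun _ => 0) fun _ => rfl) (by decide +kernel)

/-- Quantification over a type of propositions: a type `H` of codes of propositions `el h`, closed
under equality of equivalent propositions and containing a code of each proposition. -/
def propUniv (body : (H el ep he mk mi mo : Tm) → Tm) : Tm :=
  pi (U 1) fun H => pi (H ⇒ U 0) fun el => pi (pi H fun P => isProp 0 (el ⬝ P)) fun ep =>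
  pi (pi H fun P => pi H fun Q => (el ⬝ P ⇒ el ⬝ Q) ⇒ (el ⬝ Q ⇒ el ⬝ P) ⇒ eq 1 H P Q) fun he =>
  pi (pi (U 0) fun A => isProp 0 A ⇒ H) fun mk =>
  pi (pi (U 0) fun A => pi (isProp 0 A) fun p => A ⇒ el ⬝ (mk ⬝ A ⬝ p)) fun mi =>
  pi (pi (U 0) fun A => pi (isProp 0 A) fun p => el ⬝ (mk ⬝ A ⬝ p) ⇒ A) fun mo =>
  body H el ep he mk mi mo

def S.propUniv (body : (H el ep he mk mi mo : Tm) → S) : S :=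
  .lam fun H => .lam fun el => .lam fun ep => .lam fun he => .lam fun mk => .lam fun mi =>
  .lam fun mo => body H el ep he mk mi mo

/-- This is `setOfRel` for logical equivalence, which is a proposition between propositions and
implies equality of codes. It supplies the method for the set constructor of trees. -/
def setOfProps : Tm := propUniv fun H _ _ _ _ _ _ => isSet 1 H

def setOfPropsS : S := .lam fun sr => .lam fun pd => .lam fun pp =>
  .propUniv fun H el ep he _ _ _ =>
  sr ⬝ H ⬝ (lam H fun P => lam H fun Q => iff 0 (el ⬝ P) (el ⬝ Q)) ⋅
   (.lam fun _ => .pair (.lam fun x => x) (.lam fun x => x)) ⋅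
   (.lam fun P => .lam fun Q => pd ⬝ (el ⬝ P ⇒ el ⬝ Q) ⬝ (el ⬝ Q ⇒ el ⬝ P) ⋅
     (pp ⬝ (el ⬝ P) ⬝ (lam (el ⬝ P) fun _ => el ⬝ Q) ⋅ (.lam fun _ => ep ⬝ Q)) ⋅
     (pp ⬝ (el ⬝ Q) ⬝ (lam (el ⬝ Q) fun _ => el ⬝ P) ⋅ (.lam fun _ => ep ⬝ P))) ⋅
   (.lam fun P => .lam fun Q => .lam fun h => he ⬝ P ⬝ Q ⋅ .fst h ⋅ .snd h)

theorem setOfProps_valid : Valid setOfProps :=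
  (((valid_of_verify (A := setOfRel 1 0 ⇒ propProd 0 ⇒ propPi 0 ⇒ setOfProps) setOfPropsS
    (by decide +kernel)).mp setOfRel_one_zero
    (by decide +kernel)).mp (propProd_valid.change (fun _ => 0) fun _ => rfl)
    (by decide +kernel)).mp propPi_valid_zero (by decide +kernel)

/-- The domain of the argument that follows the arguments `l` of a function of type `T`. -/
def nextDomain (T : Term) (l : List Tm) : Tm := fun d => go d T [] l
where
  go (d : ℕ) : Term → List Term → List Tm → Term
    | .pi A _, σ, [] => A.sub σ
    | .pi _ B, σ, a :: l => go d B (a d :: σ) l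
    | T, _, _ => T

def apps (f : Tm) (l : List Tm) : Tm := l.foldl app f

/-- Bind the next argument of the function `f` of type `T`, proved by `s`. -/
def S.arg (T : Term) (l : List Tm) (s : S) (b : List Tm → S) : S :=
  .have_ (nextDomain T l) s fun x => b (l ++ [x])

/-- A family `L` of propositions, increasing along the order, that is refuted at zero, is `X ≤ y` at
the successor of `y`, and at a limit implies that it holds at some term of the sequence. -/
def strictBelow : Tm := propUniv fun _ _ _ _ _ _ _ => pi brw fun X =>
  sig 1 (brw ⇒ U 0) fun L => prod 1 (L ⬝ bzero ⇒ empty) <|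
    prod 1 (pi brw fun y => L ⬝ bsuc y ⇒ le X y) <|
    prod 1 (pi brw fun y => le X y ⇒ L ⬝ bsuc y) <|
    prod 1 (pi (nat ⇒ brw) fun f => pi (increasing f) fun u =>
      L ⬝ blim f u ⇒ ex 0 nat fun k => L ⬝ (f ⬝ k))
    (pi brw fun x => pi brw fun y => le x y ⇒ L ⬝ x ⇒ L ⬝ y)

def botProp : Tm := lam empty fun x => lam empty fun y =>
      con (.emptyElim 0) ⬝ (lam empty fun _ => eq 0 empty x y) ⬝ x

/-- Simultaneous elimination into codes of propositions, with implication as the relation over `≤`.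
The methods for `≤` then say exactly that the family is monotone. Codes are decoded by the explicit
maps `mi` and `mo`, so the particular construction of the type of propositions never enters the
computation. -/
def strictBelowS : S := .lam fun pp => .lam fun lp => .lam fun st =>
    .propUniv fun H el ep he mk mi mo => .lam fun X =>
  let C := lam brw fun _ => H
  let D := lam brw fun x => lam brw fun y => lam H fun P => lam H fun P' => lam (le x y) fun _ =>
    el ⬝ P ⇒ el ⬝ P'
  let z := mk ⬝ empty ⬝ botProp
  let s := lam brw fun y => lam H fun _ => mk ⬝ (le X y) ⬝ (con .leProp ⬝ X ⬝ y)
  let A := fun c => sig 0 nat fun k => el ⬝ (c ⬝ k)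
  let l := lam (nat ⇒ brw) fun f => lam (increasing f) fun _ => lam (nat ⇒ H) fun c =>
    lam (pi nat fun n => el ⬝ (mk ⬝ le X (f ⬝ n) ⬝ (con .leProp ⬝ X ⬝ (f ⬝ n))) ⇒
      el ⬝ (c ⬝ succ n)) fun _ => mk ⬝ (trunc 0 (A c)) ⬝ (con (.squash 0) ⬝ A c)
  let T := constType (.brwElim 1)
  let tp := fun x y p h => transport 0 1 brw C x y p h
  -- The motive is constant, so transport in it is the identity; this removes the transport from the
  -- method for bisimilar limits.
  .have_ (pi brw fun x => pi brw fun y => pi (eq 0 brw x y) fun p => pi H fun h =>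
    eq 1 H (tp x y p h) h)
    (.lam fun x => .lam fun y => .lam fun p => J 0 1 brw x (fun y p => pi H fun h =>
      eq 1 H (tp x y p h) h) (.lam fun _ => .refl) y p) fun tc =>
  .have_ (pi H fun P => pi H fun Q => eq 1 H P Q ⇒ prod 0 (el ⬝ P ⇒ el ⬝ Q) (el ⬝ Q ⇒ el ⬝ P))
    (.lam fun P => .lam fun Q => .lam fun p => J 1 1 H P
      (fun Q _ => prod 0 (el ⬝ P ⇒ el ⬝ Q) (el ⬝ Q ⇒ el ⬝ P))
      (.pair (.lam fun x => x) (.lam fun x => x)) Q p) fun sb =>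
  .have_ (pi (nat ⇒ H) fun c => pi (nat ⇒ H) fun d => (pi nat fun k => ex 1 nat fun n =>
    (el ⬝ (c ⬝ k) ⇒ el ⬝ (d ⬝ n))) ⇒ trunc 0 (A c) ⇒ trunc 0 (A d))
    (.lam fun _ => .lam fun _ => .lam fun h => .lam fun w => .exE w fun q => .unpack q fun k e =>
      .exE (h ⬝ k) fun r => .unpack r fun n g =>
      .exI (.pair n (g ⬝ e))) fun md =>
  -- For bisimilar limits, the simulations over the sequences turn a witness of one existential into
  -- a witness of the other, in both directions, and equivalent propositions have equal codes.
  .arg T [C, D, z, s, l] (.lam fun f => .lam fun u => .lam fun g => .lam fun v => .lam fun p =>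
    .lam fun q => .lam fun c => .lam fun _ => .lam fun d => .lam fun _ => .lam fun h =>
    .lam fun h' =>
    let lc := mk ⬝ (trunc 0 (A c)) ⬝ (con (.squash 0) ⬝ A c)
    let ld := mk ⬝ (trunc 0 (A d)) ⬝ (con (.squash 0) ⬝ A d)
    let t := tp (blim f u) (blim g v) (con .bisim ⬝ f ⬝ u ⬝ g ⬝ v ⬝ p ⬝ q) lc
    .have_ (prod 0 (el ⬝ t ⇒ el ⬝ lc) (el ⬝ lc ⇒ el ⬝ t)) (sb ⬝ t ⬝ lc ⬝ (tc ⬝ blim f u ⬝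
      blim g v ⬝ (con .bisim ⬝ f ⬝ u ⬝ g ⬝ v ⬝ p ⬝ q) ⬝ lc)) fun w =>
    he ⬝ t ⬝ ld ⋅ (.lam fun x => mi ⬝ trunc 0 (A d) ⬝ (con (.squash 0) ⬝ A d) ⋅ (md ⬝ c ⬝ d ⋅
      (.lam fun k => .exE (h ⬝ k) fun r => .unpack r fun n i => .exI (.pair n (.snd i))) ⋅
        (mo ⬝ trunc 0 (A c) ⬝ (con (.squash 0) ⬝ A c) ⋅ (.fst w ⋅ x)))) ⋅
      (.lam fun x => .snd w ⋅ (mi ⬝ trunc 0 (A c) ⬝ (con (.squash 0) ⬝ A c) ⋅ (md ⬝ d ⬝ c ⋅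
        (.lam fun k => .exE (h' ⬝ k) fun r => .unpack r fun n i => .exI (.pair n (.snd i))) ⋅
        (mo ⬝ trunc 0 (A d) ⬝ (con (.squash 0) ⬝ A d) ⬝ x))))) fun a =>
  .arg T a (.lam fun _ => st ⬝ H ⬝ el ⬝ ep ⬝ he ⬝ mk ⬝ mi ⬝ mo) fun a =>
  .arg T a (.lam fun _ => .lam fun _ => .lam fun w => .botE (mo ⬝ empty ⬝ botProp ⬝ w)) fun a =>
  .arg T a (.lam fun _ => .lam fun _ => .lam fun _ => .lam fun _ => .lam fun _ => .lam fun _ =>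
    .lam fun _ => .lam fun _ => .lam fun g => .lam fun h => .lam fun e => h ⬝ (g ⬝ e)) fun a =>
  .arg T a (.lam fun x => .lam fun y => .lam fun p => .lam fun _ => .lam fun _ => .lam fun _ =>
    .lam fun e =>
    mi ⬝ le X y ⬝ (con .leProp ⬝ X ⬝ y) ⬝ (con .leTrans ⬝ X ⬝ x ⬝ y ⬝
      (mo ⬝ le X x ⬝ (con .leProp ⬝ X ⬝ x) ⬝ e) ⬝ p)) fun a =>
  .arg T a (.lam fun _ => .lam fun _ => .lam fun _ => .lam fun k => .lam fun _ => .lam fun _ =>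
    .lam fun c => .lam fun _ => .lam fun g => .lam fun e =>
    mi ⬝ trunc 0 (A c) ⬝ (con (.squash 0) ⬝ A c) ⋅ .exI (.pair k (g ⬝ e))) fun a =>
  -- For an upper bound of a sequence, the truncated witness may be used because the goal `el cx` is
  -- a proposition.
  .arg T a (.lam fun _ => .lam fun _ => .lam fun _ => .lam fun _ => .lam fun c => .lam fun _ =>
    .lam fun cx => .lam fun g => .lam fun e =>
    con (.truncRec 0 0) ⬝ A c ⬝ (el ⬝ cx) ⬝ (ep ⬝ cx) ⋅ (.lam fun q => .unpack q fun k w =>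
      g ⬝ k ⬝ w) ⋅ (mo ⬝ trunc 0 (A c) ⬝ (con (.squash 0) ⬝ A c) ⬝ e)) fun a =>
  .arg T a (.lam fun _ => .lam fun _ => .lam fun cx => .lam fun cy => .lam fun _ =>
    lp ⬝ (el ⬝ cx ⇒ el ⬝ cy) ⋅ (pp ⬝ (el ⬝ cx) ⬝ (lam (el ⬝ cx) fun _ => el ⬝ cy) ⋅
      .lam fun _ => ep ⬝ cy)) fun a =>
  let E := apps (con (.brwElim 1)) a
  .pair (lam brw fun y => el ⬝ (E ⬝ y)) <|
  .pair (.lam fun h => mo ⬝ empty ⬝ botProp ⬝ h) <|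
  .pair (.lam fun y => .lam fun h => mo ⬝ le X y ⬝ (con .leProp ⬝ X ⬝ y) ⬝ h) <|
  .pair (.lam fun y => .lam fun h => mi ⬝ le X y ⬝ (con .leProp ⬝ X ⬝ y) ⬝ h) <|
  .pair (.lam fun f => .lam fun _ => .lam fun h =>
    let c := lam nat fun n => E ⬝ (f ⬝ n)
    mo ⬝ trunc 0 (A c) ⬝ (con (.squash 0) ⬝ A c) ⬝ h) <|
  (.lam fun x => .lam fun y => .lam fun p => apps (con (.leElim 1)) a ⬝ x ⬝ y ⬝ p)

theorem strictBelow_valid : Valid strictBelow :=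
  ((valid_of_verify (A := propPi 0 ⇒ liftProp 0 1 ⇒ setOfProps ⇒ strictBelow) strictBelowS
    (by decide +kernel)).mp propPi_valid_zero (by decide +kernel)).mp liftProp_valid_one
    (by decide +kernel) |>.mp setOfProps_valid (by decide +kernel)

/-! ### The order of Brouwer trees -/

/-- The abstract codes are now instantiated by the pairs of a type in the lowest universe and a
proof that it is a proposition; encoding and decoding are identities. -/
def belowRel : Tm := pi brw fun X =>
  sig 1 (brw ⇒ U 0) fun L => prod 1 (L ⬝ bzero ⇒ empty)
    (prod 1 (pi brw fun y => L ⬝ bsuc y ⇒ le X y)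
    (prod 1 (pi brw fun y => le X y ⇒ L ⬝ bsuc y)
    (prod 1 (pi (nat ⇒ brw) fun f => pi (increasing f) fun u =>
      L ⬝ blim f u ⇒ ex 0 nat fun k => L ⬝ (f ⬝ k))
     (pi brw fun x => pi brw fun y => le x y ⇒ L ⬝ x ⇒ L ⬝ y))))

def belowRelS : S := .lam fun he => .lam fun sb =>
  let B := fun A => isProp 0 A
  sb ⬝ hProp 0 ⬝ (lam (hProp 0) fun P => holds 0 P) ⬝ (lam (hProp 0) fun P => snd 1 (U 0) B P) ⬝
    he ⬝
    (lam (U 0) fun A => lam (isProp 0 A) fun p => pair 1 (U 0) B A p) ⬝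
    (lam (U 0) fun A => lam (isProp 0 A) fun _ => lam A fun a => a) ⬝
    (lam (U 0) fun A => lam (isProp 0 A) fun _ => lam A fun a => a)

theorem belowRel_valid : Valid belowRel :=
  ((valid_of_verify (A := hPropEq ⇒ strictBelow ⇒ belowRel) belowRelS (by decide +kernel)).mp
    hPropEq_valid (by decide +kernel)).mp strictBelow_valid (by decide +kernel)

/-- Induction on Brouwer trees for a family of propositions. -/
def brwInd (j : ℕ) : Tm := pi (brw ⇒ U j) fun P => (pi brw fun x => isProp j (P ⬝ x)) ⇒
  P ⬝ bzero ⇒ (pi brw fun x => P ⬝ x ⇒ P ⬝ bsuc x) ⇒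
  (pi (nat ⇒ brw) fun f => pi (increasing f) fun u => (pi nat fun n => P ⬝ (f ⬝ n)) ⇒ P ⬝
    blim f u) ⇒
  pi brw fun x => P ⬝ x

/-- The relation over `≤` is taken to be the unit type, and the path constructors are respected
because the family consists of propositions. -/
def brwIndS (j : ℕ) : S := .lam fun is => .lam fun P => .lam fun h => .lam fun z => .lam fun s =>
    .lam fun l =>
  let T := constType (.brwElim j)
  let D := lam brw fun x => lam brw fun y => lam (P ⬝ x) fun _ => lam (P ⬝ y) fun _ =>
    lam (le x y) fun _ => unit
  .have_ (isProp j unit) (con (.unitElim j) ⬝ (lam unit fun x => pi unit fun y => eq j unit x y) ⬝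
    (con (.unitElim j) ⬝ (lam unit fun y => eq j unit star y) ⬝ refl j unit star)) fun pu =>
  let l' := lam (nat ⇒ brw) fun f => lam (increasing f) fun u => lam (pi nat fun n => P ⬝
    (f ⬝ n)) fun c =>
    lam (nat ⇒ unit) fun _ => l ⬝ f ⬝ u ⬝ c
  .arg T [P, D, z, s, l'] (.lam fun f => .lam fun u => .lam fun g => .lam fun v => .lam fun p =>
    .lam fun q =>
    .lam fun c => .lam fun _ => .lam fun d => .lam fun _ => .lam fun _ => .lam fun _ =>
    h ⬝ blim g v ⬝ (transport 0 j brw P (blim f u) (blim g v) (con .bisim ⬝ f ⬝ u ⬝ g ⬝ v ⬝ p ⬝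
      q) (l ⬝ f ⬝ u ⬝ c))
      ⬝ (l ⬝ g ⬝ v ⬝ d)) fun a =>
  .arg T a (.lam fun x => is ⬝ (P ⬝ x) ⬝ (h ⬝ x)) fun a =>
  .arg T a (.lam fun _ => .lam fun _ => star) fun a =>
  .arg T a (.lam fun _ => .lam fun _ => .lam fun _ => .lam fun _ => .lam fun _ => .lam fun _ =>
    .lam fun _ =>
    .lam fun _ => .lam fun _ => .lam fun _ => star) fun a =>
  .arg T a (.lam fun _ => .lam fun _ => .lam fun _ => .lam fun _ => .lam fun _ => .lam fun _ =>
    star) fun a =>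
  .arg T a (.lam fun _ => .lam fun _ => .lam fun _ => .lam fun _ => .lam fun _ => .lam fun _ =>
    .lam fun _ =>
    .lam fun _ => .lam fun _ => star) fun a =>
  .arg T a (.lam fun _ => .lam fun _ => .lam fun _ => .lam fun _ => .lam fun _ => .lam fun _ =>
    .lam fun _ =>
    .lam fun _ => star) fun a =>
  .arg T a (.lam fun _ => .lam fun _ => .lam fun _ => .lam fun _ => .lam fun _ => pu) fun a =>
  apps (con (.brwElim j)) a

theorem brwInd_valid : Valid (brwInd 8) :=
  (valid_of_verify (A := propIsSet 8 ⇒ brwInd 8) (brwIndS 8) (by decide +kernel)).mp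
    propIsSet_valid (by decide +kernel)

theorem brwInd_valid_zero : Valid (brwInd 0) := brwInd_valid.change (fun _ => 0) fun _ => rfl

/-! ### Basic properties of the order -/

/-- `A` with the premises `l`. -/
def premises (l : List Tm) (A : Tm) : Tm := l.foldr arr A

def isClosedTails : List Tm → Tm → Bool
  | [], _ => true
  | _ :: l, A => isClosed (premises l A) && isClosedTails l A

theorem valid_of_premises {A : Tm} : ∀ (l : List Tm), Valid (premises l A) →
    isClosedTails l A = true → l.Forall Valid → Valid A
  | [], h, _, _ => h
  | _ :: l, h, hc, hl => by
    rw [List.forall_cons] at hl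
    rw [isClosedTails, Bool.and_eq_true] at hc
    exact valid_of_premises l (Valid.mp h hl.1 hc.1) hc.2 hl.2

/-- A surface term that proves `A` from the premises `l`. -/
theorem valid_from {A : Tm} (l : List Tm) (s : S)
    (h : (isClosedTails l A && verify s (premises l A)) = true) (hl : l.Forall Valid) :
    Valid A := by
  rw [Bool.and_eq_true] at h
  exact valid_of_premises l (valid_of_verify s h.2) h.1 hl

def leRefl : Tm := pi brw fun x => le x x

def leReflS : S := .lam fun ind =>
  ind ⬝ (lam brw fun x => le x x) ⋅ (.lam fun x => con .leProp ⬝ x ⬝ x) ⋅ (con .leZero ⬝ bzero) ⋅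
    (.lam fun x => .lam fun h => con .leSuc ⬝ x ⬝ x ⬝ h) ⋅
    (.lam fun f => .lam fun u => .lam fun h => con .leLimiting ⬝ f ⬝ u ⬝ blim f u ⋅ .lam fun n =>
      con .leCocone ⬝ (f ⬝ n) ⬝ f ⬝ u ⬝ n ⬝ (h ⬝ n))

theorem leRefl_valid : Valid leRefl :=
  valid_from [brwInd 0] leReflS (by decide +kernel) brwInd_valid_zero

def leSelfSuc : Tm := pi brw fun x => le x (bsuc x)

def leSelfSucS : S := .lam fun rf => .lam fun ind =>
  ind ⬝ (lam brw fun x => le x (bsuc x)) ⋅ (.lam fun x => con .leProp ⬝ x ⬝ bsuc x) ⋅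
    (con .leZero ⬝ bsuc bzero) ⋅ (.lam fun x => .lam fun h => con .leSuc ⬝ x ⬝ bsuc x ⬝ h) ⋅
    (.lam fun f => .lam fun u => .lam fun h => con .leLimiting ⬝ f ⬝ u ⬝ bsuc (blim f u) ⋅
      .lam fun n =>
      con .leTrans ⬝ (f ⬝ n) ⬝ bsuc (f ⬝ n) ⬝ bsuc (blim f u) ⬝ (h ⬝ n) ⬝
        (con .leSuc ⬝ (f ⬝ n) ⬝ blim f u ⬝ (con .leCocone ⬝ (f ⬝ n) ⬝ f ⬝ u ⬝ n ⬝ (rf ⬝ (f ⬝ n)))))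

theorem leSelfSuc_valid : Valid leSelfSuc :=
  valid_from [leRefl, brwInd 0] leSelfSucS (by decide +kernel) ⟨leRefl_valid, brwInd_valid_zero⟩

/-- For `X = x`, the family `L` holds at `suc x` because `x ≤ x`. Monotonicity moves it along the
given inequality to zero, where it is refuted. -/
def sucLeZero : Tm := pi brw fun x => le (bsuc x) bzero ⇒ empty

def sucLeZeroS : S := .lam fun rf => .lam fun br => .lam fun x => .lam fun h =>
  .unpack (br ⬝ x) fun _ w => .unpack w fun l0 w => .unpack w fun _ w => .unpack w fun ls w =>
    .unpack w fun _ lm => l0 ⬝ (lm ⬝ bsuc x ⬝ bzero ⬝ h ⬝ (ls ⬝ x ⬝ (rf ⬝ x)))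

theorem sucLeZero_valid : Valid sucLeZero :=
  valid_from [leRefl, belowRel] sucLeZeroS (by decide +kernel) ⟨leRefl_valid, belowRel_valid⟩

/-- The same transport of `L` as for `sucLeZero`, read off at a successor instead of zero. -/
def sucLeSuc : Tm := pi brw fun x => pi brw fun y => le (bsuc x) (bsuc y) ⇒ le x y

def sucLeSucS : S := .lam fun rf => .lam fun br => .lam fun x => .lam fun y => .lam fun h =>
  .unpack (br ⬝ x) fun _ w => .unpack w fun _ w => .unpack w fun le w => .unpack w fun ls w =>
    .unpack w fun _ lm => le ⬝ y ⬝ (lm ⬝ bsuc x ⬝ bsuc y ⬝ h ⬝ (ls ⬝ x ⬝ (rf ⬝ x)))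

theorem sucLeSuc_valid : Valid sucLeSuc :=
  valid_from [leRefl, belowRel] sucLeSucS (by decide +kernel) ⟨leRefl_valid, belowRel_valid⟩

def sucLeLim : Tm := pi brw fun x => pi (nat ⇒ brw) fun f => pi (increasing f) fun u =>
  le (bsuc x) (blim f u) ⇒ ex 0 nat fun k => le (bsuc x) (f ⬝ k)

def sucLeLimS : S := .lam fun pp => .lam fun ind => .lam fun rf => .lam fun br =>
  .lam fun x => .lam fun f => .lam fun u => .lam fun h =>
  .unpack (br ⬝ x) fun L w => .unpack w fun l0 w => .unpack w fun le' w => .unpack w fun ls w =>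
    .unpack w fun ll lm =>
    -- Decoding, by induction on `y`: the limit clause of `L` names a term of the sequence at which
    -- the induction hypothesis applies. Thus `L` at `f k` gives `suc x ≤ f k`.
    .have_ (pi brw fun y => L ⬝ y ⇒ le (bsuc x) y)
      (ind ⬝ (lam brw fun y => L ⬝ y ⇒ le (bsuc x) y) ⋅
        (.lam fun y => pp ⬝ (L ⬝ y) ⬝ (lam (L ⬝ y) fun _ => le (bsuc x) y) ⋅ .lam fun _ =>
          con .leProp ⬝ bsuc x ⬝ y) ⋅
        (.lam fun a => .botE (l0 ⬝ a)) ⋅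
        (.lam fun y => .lam fun _ => .lam fun a => con .leSuc ⬝ x ⬝ y ⬝ (le' ⬝ y ⬝ a)) ⋅
        (.lam fun g => .lam fun v => .lam fun ih => .lam fun a => .exE (ll ⬝ g ⬝ v ⬝ a) fun q =>
          .unpack q fun k b => con .leCocone ⬝ bsuc x ⬝ g ⬝ v ⬝ k ⬝ (ih ⬝ k ⬝ b))) fun sl =>
    .exE (ll ⬝ f ⬝ u ⬝ (lm ⬝ bsuc x ⬝ blim f u ⬝ h ⬝ (ls ⬝ x ⬝ (rf ⬝ x)))) fun q =>
      .unpack q fun k b =>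
      .exI (.pair k (sl ⬝ (f ⬝ k) ⬝ b))

theorem sucLeLim_valid : Valid sucLeLim :=
  valid_from [propPi 0, brwInd 0, leRefl, belowRel] sucLeLimS (by decide +kernel)
    ⟨propPi_valid_zero, brwInd_valid_zero, leRefl_valid, belowRel_valid⟩

/-- In the limit case, `suc (lim f) ≤ lim f` gives some `k` with `suc (lim f) ≤ f k`; then `suc (f
k) ≤ suc (lim f) ≤ f k` contradicts the induction hypothesis. -/
def sucLeSelf : Tm := pi brw fun x => le (bsuc x) x ⇒ empty

def sucLeSelfS : S := .lam fun pp => .lam fun ind => .lam fun rf => .lam fun sz => .lam fun ss =>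
    .lam fun sl =>
  ind ⬝ (lam brw fun x => le (bsuc x) x ⇒ empty) ⋅
    (.lam fun x => pp ⬝ le (bsuc x) x ⬝ (lam (le (bsuc x) x) fun _ => empty) ⋅ .lam fun _ =>
      botProp) ⋅
    (sz ⬝ bzero) ⋅ (.lam fun x => .lam fun h => .lam fun p => h ⬝ (ss ⬝ bsuc x ⬝ x ⬝ p)) ⋅
    (.lam fun f => .lam fun u => .lam fun h => .lam fun p => .exE (sl ⬝ blim f u ⬝ f ⬝ u ⬝
      p) fun q =>
      .unpack q fun k b => h ⬝ k ⬝ (con .leTrans ⬝ bsuc (f ⬝ k) ⬝ bsuc (blim f u) ⬝ (f ⬝ k) ⬝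
        (con .leSuc ⬝ (f ⬝ k) ⬝ blim f u ⬝ (con .leCocone ⬝ (f ⬝ k) ⬝ f ⬝ u ⬝ k ⬝
          (rf ⬝ (f ⬝ k)))) ⬝ b))

theorem sucLeSelf_valid : Valid sucLeSelf :=
  valid_from [propPi 0, brwInd 0, leRefl, sucLeZero, sucLeSuc, sucLeLim] sucLeSelfS
    (by decide +kernel) ⟨propPi_valid_zero, brwInd_valid_zero, leRefl_valid, sucLeZero_valid,
      sucLeSuc_valid, sucLeLim_valid⟩

/-! ### Natural numbers and binary digits -/

/-- Congruence: `t a = t x` in `B`, from `p : a = x` in `A`. -/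
def cong (A B a : Tm) (t : Tm → Tm) (x p : Tm) : Tm :=
  Jt 0 0 A a (fun z _ => eq 0 B (t a) (t z)) (refl 0 B (t a)) x p

def sym (A a x p : Tm) : Tm := Jt 0 0 A a (fun z _ => eq 0 A z a) (refl 0 A a) x p

/-- Iteration of a function. -/
def iteration : Tm := pi (U 0) fun A => pi A fun a => pi (A ⇒ A) fun f => sig 0 (nat ⇒ A) fun e =>
  prod 0 (eq 0 A (e ⬝ zero) a) (pi nat fun n => eq 0 A (e ⬝ succ n) (f ⬝ (e ⬝ n)))

def iterationS : S := .lam fun A => .lam fun a => .lam fun f =>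
  .pair (con (.natElim 0) ⬝ (lam nat fun _ => A) ⬝ a ⬝ (lam nat fun _ => f))
    (.pair .refl (.lam fun _ => .refl))

theorem iteration_valid : Valid iteration := valid_of_verify iterationS (by decide +kernel)

/-- A surjection from the natural numbers onto the pairs of natural numbers. -/
def enumeration : Tm := sig 0 (nat ⇒ nat) fun e => sig 0 (nat ⇒ nat) fun e' =>
  pi nat fun a => pi nat fun b => sig 0 nat fun n => prod 0 (eq 0 nat (e ⬝ n) a) (eq 0 nat (e' ⬝
    n) b)

def enumerationS : S := .lam fun it =>
  let N2 := prod 0 nat nat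
  let pr := pair 0 nat fun _ => nat
  let p1 := fst 0 nat fun _ => nat
  let p2 := snd 0 nat fun _ => nat
  let hit := fun e a b => sig 0 nat fun n => eq 0 N2 (e ⬝ n) (pr a b)
  let add := fun a => natRec 0 (fun _ => nat ⇒ nat) (lam nat fun b => b) (fun _ h =>
    lam nat fun b => h ⬝ succ b) a
  -- One step of a walk along the antidiagonals: `(a, b+1)` goes to `(a+1, b)`, and `(a, 0)` goes to
  -- the start `(0, a+1)` of the next antidiagonal. Iteration from `(0, 0)` meets every pair.
  .have_ (sig 0 (N2 ⇒ N2) fun f => prod 0 (pi nat fun a => eq 0 N2 (f ⬝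
    pr a zero) (pr zero (succ a)))
        (pi nat fun a => pi nat fun b => eq 0 N2 (f ⬝ pr a (succ b)) (pr (succ a) b)))
    (.pair (con (.sigmaElim 0 0) ⬝ nat ⬝ (lam nat fun _ => nat) ⬝ (lam N2 fun _ => N2) ⬝
      lam nat fun a => con (.natElim 0) ⬝ (lam nat fun _ => N2) ⬝ pr zero (succ a) ⬝
        (lam nat fun b => lam N2 fun _ => pr (succ a) b)) <|
      .pair (.lam fun _ => .refl) (.lam fun _ => .lam fun _ => .refl)) fun w =>
  .unpack w fun f w => .unpack w fun f0 f1 =>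
  .unpack (it ⬝ N2 ⬝ pr zero zero ⬝ f) fun e w => .unpack w fun e0 es =>
  .have_ (pi N2 fun q => pi N2 fun r => eq 0 N2 (f ⬝ q) r ⇒ (sig 0 nat fun n => eq 0 N2 (e ⬝ n) q) ⇒
      sig 0 nat fun n => eq 0 N2 (e ⬝ n) r)
    (.lam fun q => .lam fun r => .lam fun p => .lam fun w => .unpack w fun n h => .pair (succ n)
      (J 0 0 N2 (f ⬝ q) (fun z _ => eq 0 N2 (e ⬝ succ n) z)
        (J 0 0 N2 (e ⬝ n) (fun z _ => eq 0 N2 (e ⬝ succ n) (f ⬝ z)) (es ⬝ n) q h) r p)) fun nx =>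
  .have_ (hit e zero zero) (.pair zero e0) fun h0 =>
  .have_ (pi nat fun a => hit e a zero ⇒ hit e zero (succ a))
    (.lam fun a => nx ⬝ pr a zero ⬝ pr zero (succ a) ⬝ (f0 ⬝ a)) fun h1 =>
  .have_ (pi nat fun a => pi nat fun b => hit e a (succ b) ⇒ hit e (succ a) b)
    (.lam fun a => .lam fun b => nx ⬝ pr a (succ b) ⬝ pr (succ a) b ⬝ (f1 ⬝ a ⬝ b)) fun h2 =>
  .have_ (pi nat fun a => pi nat fun b => eq 0 nat (add a ⬝ succ b) (succ (add a ⬝ b)))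
    (.natE (.lam fun _ => .refl) fun _ ih => .lam fun b => ih ⬝ succ b) fun gs =>
  .have_ (pi nat fun a => eq 0 nat (add a ⬝ zero) a)
    (.natE .refl fun a ih => J 0 0 nat (add a ⬝ zero) (fun z _ => eq 0 nat (add a ⬝
      succ zero) (succ z))
      (gs ⬝ a ⬝ zero) a ih) fun gz =>
  .have_ (pi nat fun c => pi nat fun a => hit e a c ⇒ hit e (add c ⬝ a) zero)
    (.natE (.lam fun _ => .lam fun h => h) fun c ih => .lam fun a => .lam fun h => ih ⬝ succ a ⬝
      (h2 ⬝ a ⬝ c ⬝ h)) fun down =>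
  -- From `(0, t)` the walk descends to `(t, 0)` and jumps to `(0, t+1)`.
  .have_ (pi nat fun t => hit e zero t)
    (.natE h0 fun t ih => h1 ⬝ t ⋅ J 0 0 nat (add t ⬝ zero) (fun z _ => hit e z zero) (down ⬝ t ⬝
      zero ⬝ ih) t (gz ⬝ t)) fun diag =>
  .have_ (pi nat fun a => pi nat fun b => hit e zero (add a ⬝ b) ⇒ hit e a b)
    (.natE (.lam fun _ => .lam fun h => h) fun a ih => .lam fun b => .lam fun h => h2 ⬝ a ⬝ b ⬝
      (ih ⬝ succ b ⬝ h)) fun up =>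
  .pair (lam nat fun n => p1 (e ⬝ n)) <| .pair (lam nat fun n => p2 (e ⬝ n)) <| .lam fun a =>
    .lam fun b =>
    .unpack (up ⬝ a ⬝ b ⬝ (diag ⬝ (add a ⬝ b))) fun n q => .pair n <|
      .pair (cong N2 nat (e ⬝ n) p1 (pr a b) q) (cong N2 nat (e ⬝ n) p2 (pr a b) q)

theorem enumeration_valid : Valid enumeration :=
  valid_from [iteration] enumerationS (by decide +kernel) iteration_valid

def digitZero : Tm := con (.inl 0) ⬝ unit ⬝ unit ⬝ star

/-- Transport in the family that is the unit type at the digit `0` and empty at the digit `1`. -/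
def digitsDiffer : Tm := eq 0 two digitZero digitOne ⇒ empty

def digitsDifferS : S :=
  let F := con (.sumElim 0 1) ⬝ unit ⬝ unit ⬝ (lam two fun _ => U 0) ⬝ (lam unit fun _ => unit) ⬝
    (lam unit fun _ => empty)
  .lam fun p => J 0 0 two digitZero (fun x _ => F ⬝ x) star digitOne p

theorem digitsDiffer_valid : Valid digitsDiffer :=
  valid_of_verify digitsDifferS (by decide +kernel)

/-! ### Semidecidable propositions -/

/-- Some digit of `s` is `1`. -/
def someOne (s : Tm) : Tm := ex 0 nat fun k => eq 0 two (s ⬝ k) digitOne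

def semidecTrue : Tm := pi (U 0) fun P => P ⇒ semidec 8 P

def semidecTrueS : S := .lam fun _ => .lam fun h => .exI <| .pair (lam nat fun _ => digitOne) <|
  .pair (.lam fun _ => .exI (.pair zero .refl)) (.lam fun _ => h)

theorem semidecTrue_valid : Valid semidecTrue := valid_of_verify semidecTrueS (by decide +kernel)

def semidecFalse : Tm := pi (U 0) fun P => (P ⇒ empty) ⇒ isProp 0 P ⇒ semidec 8 P

def semidecFalseS : S := .lam fun dd => .lam fun P => .lam fun h => .lam fun hp => .exI <|
  .pair (lam nat fun _ => digitZero) <| .pair (.lam fun p => .botE (h ⬝ p))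
    (.lam fun w => con (.truncRec 0 0) ⬝ (sig 0 nat fun _ => eq 0 two digitZero digitOne) ⬝ P ⬝ hp ⋅
      (.lam fun q => .unpack q fun _ r => .botE (dd ⬝ r)) ⋅ w)

theorem semidecFalse_valid : Valid semidecFalse :=
  valid_from [digitsDiffer] semidecFalseS (by decide +kernel) digitsDiffer_valid

def semidecIff : Tm := pi (U 0) fun P => pi (U 0) fun Q => (P ⇒ Q) ⇒ (Q ⇒ P) ⇒ semidec 8 P ⇒
    semidec 8 Q

def semidecIffS : S := .lam fun _ => .lam fun _ => .lam fun f => .lam fun g => .lam fun h =>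
  .exE h fun w => .unpack w fun s w => .unpack w fun a b => .exI <| .pair s <|
    .pair (.lam fun q => a ⬝ (g ⬝ q)) (.lam fun k => f ⬝ (b ⬝ k))

theorem semidecIff_valid : Valid semidecIff := valid_of_verify semidecIffS (by decide +kernel)

/-- Countable choice selects a sequence for every `P k`; reading these along an enumeration of the
pairs of indices gives a single sequence, which has a digit `1` just when one of them does. -/
def semidecJoin : Tm := countableChoice 8 ⇒ pi (nat ⇒ U 0) fun P =>
  (pi nat fun k => semidec 8 (P ⬝ k)) ⇒ semidec 8 (ex 0 nat fun k => P ⬝ k)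

def semidecJoinS : S := .lam fun en => .lam fun cc => .lam fun P => .lam fun h =>
  .unpack en fun e w => .unpack w fun e' sj =>
  .have_ (pi (nat ⇒ nat ⇒ two) fun s => (pi nat fun k => iff 8 (P ⬝ k) (someOne (s ⬝ k))) ⇒
      semidec 8 (ex 0 nat fun k => P ⬝ k))
    (.lam fun s => .lam fun hs => .exI <| .pair (lam nat fun j => s ⬝ (e ⬝ j) ⬝ (e' ⬝ j)) <| .pair
      (.lam fun w => .exE w fun w => .unpack w fun k p => .unpack (hs ⬝ k) fun f _ =>
        .exE (f ⬝ p) fun w =>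
        .unpack w fun m r => .unpack (sj ⬝ k ⬝ m) fun n t => .unpack t fun a b => .exI <| .pair n <|
          J 0 0 nat k (fun z _ => eq 0 two (s ⬝ z ⬝ (e' ⬝ n)) digitOne)
            (J 0 0 nat m (fun z _ => eq 0 two (s ⬝ k ⬝ z) digitOne) r (e' ⬝ n) (sym nat (e' ⬝
              n) m b))
            (e ⬝ n) (sym nat (e ⬝ n) k a))
      (.lam fun w => .exE w fun w => .unpack w fun j r => .unpack (hs ⬝ (e ⬝ j)) fun _ g =>
        .exI <| .pair (e ⬝ j) <| (g : S) ⋅ .exI (.pair (e' ⬝ j) r))) fun mk =>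
  .exE (cc ⬝ (lam nat fun k => sig 8 (nat ⇒ two) fun s => iff 8 (P ⬝ k) (someOne s)) ⬝ h) fun q =>
    .have_ (pi nat fun k => sig 8 (nat ⇒ two) fun s => iff 8 (P ⬝ k) (someOne s)) q fun q =>
      (mk ⬝ (lam nat fun k => fst 8 (nat ⇒ two) (fun s => iff 8 (P ⬝ k) (someOne s)) (q ⬝
        k)) : Tm) ⋅
        .lam fun k => .snd (q ⬝ k)
theorem semidecJoin_valid : Valid semidecJoin :=
  valid_from [enumeration] semidecJoinS (by decide +kernel) enumeration_valid

/-! ### Multiples of `ω` -/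

/-- `x + k`. -/
def addN (x k : Tm) : Tm := natRec 0 (fun _ => brw) x (fun _ y => bsuc y) k

def addMono : Tm := pi brw fun x => pi brw fun y => le x y ⇒ pi nat fun k =>
    le (addN x k) (addN y k)

def addMonoS : S := .lam fun x => .lam fun y => .lam fun h => .natE h fun k ih =>
  con .leSuc ⬝ addN x k ⬝ addN y k ⬝ ih

theorem addMono_valid : Valid addMono := valid_of_verify addMonoS (by decide +kernel)

def leAdd : Tm := pi brw fun x => pi nat fun k => le x (addN x k)

def leAddS : S := .lam fun rf => .lam fun ls => .lam fun x => .natE (rf ⬝ x) fun k ih =>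
  con .leTrans ⬝ x ⬝ addN x k ⬝ bsuc (addN x k) ⬝ ih ⬝ (ls ⬝ addN x k)

theorem leAdd_valid : Valid leAdd :=
  valid_from [leRefl, leSelfSuc] leAddS (by decide +kernel) ⟨leRefl_valid, leSelfSuc_valid⟩

/-- Quantification over the sequences `om` that start with zero and in which each term is the
supremum of the finite successors of the term before. -/
def omegaSeq (body : Tm → Tm) : Tm := pi (nat ⇒ brw) fun om => (pi brw fun y => le (om ⬝ zero) y) ⇒
  (pi nat fun n => pi brw fun y =>
    iff 0 (le (om ⬝ succ n) y) (pi nat fun k => le (addN (om ⬝ n) k) y)) ⇒ body om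

def S.omegaSeq (body : (om o0 ol : Tm) → S) : S :=
  .lam fun om => .lam fun o0 => .lam fun ol => body om o0 ol

def omegaSuc : Tm := omegaSeq fun om => pi nat fun n => le (bsuc (om ⬝ n)) (om ⬝ succ n)

def omegaSucS : S := .lam fun rf => .omegaSeq fun om _ ol => .lam fun n =>
  .unpack (ol ⬝ n ⬝ (om ⬝ succ n)) fun f _ => f ⬝ (rf ⬝ (om ⬝ succ n)) ⬝ succ zero

theorem omegaSuc_valid : Valid omegaSuc :=
  valid_from [leRefl] omegaSucS (by decide +kernel) leRefl_valid

/-- Each `om a + k` is below `om b + k`, and so below the supremum `om (b+1)`. -/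
def omegaMono : Tm := omegaSeq fun om => pi nat fun a => pi nat fun b => le (om ⬝ a) (om ⬝ b) ⇒
  le (om ⬝ succ a) (om ⬝ succ b)

def omegaMonoS : S := .lam fun rf => .lam fun am => .omegaSeq fun om _ ol => .lam fun a =>
    .lam fun b =>
  .lam fun h => .unpack (ol ⬝ a ⬝ (om ⬝ succ b)) fun _ g => .unpack (ol ⬝ b ⬝
    (om ⬝ succ b)) fun f _ =>
    (g : S) ⋅ .lam fun k => con .leTrans ⬝ addN (om ⬝ a) k ⬝ addN (om ⬝ b) k ⬝ (om ⬝ succ b) ⬝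
      (am ⬝ (om ⬝ a) ⬝ (om ⬝ b) ⬝ h ⬝ k) ⬝ (f ⬝ (rf ⬝ (om ⬝ succ b)) ⬝ k)

theorem omegaMono_valid : Valid omegaMono :=
  valid_from [leRefl, addMono] omegaMonoS (by decide +kernel) ⟨leRefl_valid, addMono_valid⟩

/-- If `om (n+1) ≤ suc y`, then `om n + (k+1) ≤ suc y` for every `k`; cancelling the successor
leaves `om n + k ≤ y`. The index is shifted by one, and the supremum does not notice. -/
def omegaLeSuc : Tm := omegaSeq fun om => pi nat fun n => pi brw fun y =>
  le (om ⬝ n) (bsuc y) ⇒ le (om ⬝ n) y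

def omegaLeSucS : S := .lam fun ss => .omegaSeq fun om o0 ol =>
  .natE (.lam fun y => .lam fun _ => o0 ⬝ y) fun n _ => .lam fun y => .lam fun h =>
    .unpack (ol ⬝ n ⬝ bsuc y) fun f _ => .unpack (ol ⬝ n ⬝ y) fun _ g =>
      (g : S) ⋅ .lam fun k => ss ⬝ addN (om ⬝ n) k ⬝ y ⬝ (f ⬝ h ⬝ succ k)

theorem omegaLeSuc_valid : Valid omegaLeSuc :=
  valid_from [sucLeSuc] omegaLeSucS (by decide +kernel) sucLeSuc_valid

/-- Forwards, `suc (om n) ≤ om (n+1) ≤ lim f` gives `suc (om n) ≤ f k` for some `k`. Backwards, if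
`om n ≤ f k`, then strict increase makes each `om n + j` lie below a term of `f` that is `j` places
later, and the supremum of these trees is `om (n+1)`. -/
def omegaLeLim : Tm := omegaSeq fun om => pi nat fun n => pi (nat ⇒ brw) fun f =>
  pi (increasing f) fun u => prod 0 (le (om ⬝ succ n) (blim f u) ⇒ ex 0 nat fun k =>
    le (om ⬝ n) (f ⬝ k))
    ((ex 0 nat fun k => le (om ⬝ n) (f ⬝ k)) ⇒ le (om ⬝ succ n) (blim f u))

def omegaLeLimS : S := .lam fun os => .lam fun ls => .lam fun sl => .omegaSeq fun om o0 ol =>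
  .lam fun n => .lam fun f => .lam fun u => .pair
    (.lam fun h => .exE (sl ⬝ (om ⬝ n) ⬝ f ⬝ u ⬝ (con .leTrans ⬝ bsuc (om ⬝ n) ⬝ (om ⬝ succ n) ⬝
      blim f u ⬝
        (os ⬝ om ⬝ o0 ⬝ ol ⬝ n) ⬝ h)) fun w => .unpack w fun k p => .exI <| .pair k
      (con .leTrans ⬝ (om ⬝ n) ⬝ bsuc (om ⬝ n) ⬝ (f ⬝ k) ⬝ (ls ⬝ (om ⬝ n)) ⬝ p))
    (.lam fun w => .exE w fun w => .unpack w fun k p => .unpack (ol ⬝ n ⬝ blim f u) fun _ g =>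
      (g : S) ⋅
      .have_ (pi nat fun j => sig 0 nat fun i => le (addN (om ⬝ n) j) (f ⬝ i))
        (.natE (.pair k p) fun j ih => .unpack ih fun i q => .pair (succ i)
          (con .leTrans ⬝ bsuc (addN (om ⬝ n) j) ⬝ bsuc (f ⬝ i) ⬝ (f ⬝ succ i) ⬝
            (con .leSuc ⬝ addN (om ⬝ n) j ⬝ (f ⬝ i) ⬝ q) ⬝ (u ⬝ i))) fun m =>
      .lam fun j => .unpack (m ⬝ j) fun i q => con .leCocone ⬝ addN (om ⬝ n) j ⬝ f ⬝ u ⬝ i ⬝ q)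

theorem omegaLeLim_valid : Valid omegaLeLim :=
  valid_from [omegaSuc, leSelfSuc, sucLeLim] omegaLeLimS (by decide +kernel)
    ⟨omegaSuc_valid, leSelfSuc_valid, sucLeLim_valid⟩

/-- The index `n` is quantified inside the induction on `y`, because in the limit case the question
about `n + 1` is reduced to questions about `n`. Countable choice is used only there, to join the
answers for the terms of the sequence. -/
def omegaSemidec : Tm := omegaSeq fun om => countableChoice 8 ⇒ pi brw fun y => pi nat fun n =>
  semidec 8 (le (om ⬝ n) y)

def omegaSemidecS : S := .lam fun ind => .lam fun pp => .lam fun st => .lam fun sf => .lam fun si =>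
  .lam fun sj => .lam fun sz => .lam fun os => .lam fun ls => .lam fun lsS => .lam fun ll =>
  .omegaSeq fun om o0 ol => .lam fun cc =>
  ind ⬝ (lam brw fun y => pi nat fun n => semidec 8 (le (om ⬝ n) y)) ⋅
    (.lam fun y => pp ⬝ nat ⬝ (lam nat fun n => semidec 8 (le (om ⬝ n) y)) ⋅
      .lam fun n => con (.squash 8) ⬝ (sig 8 (nat ⇒ two) fun s =>
        iff 8 (le (om ⬝ n) y) (someOne s))) ⋅
    (.natE (st ⬝ le (om ⬝ zero) bzero ⬝ (o0 ⬝ bzero)) fun n _ =>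
      sf ⬝ le (om ⬝ succ n) bzero ⋅ (.lam fun h => sz ⬝ (om ⬝ n) ⬝ (con .leTrans ⬝ bsuc (om ⬝ n) ⬝
        (om ⬝ succ n) ⬝ bzero ⬝ (os ⬝ om ⬝ o0 ⬝ ol ⬝ n) ⬝ h)) ⋅ (con .leProp ⬝ (om ⬝ succ n) ⬝
          bzero)) ⋅
    (.lam fun y => .lam fun ih => .lam fun n => si ⬝ le (om ⬝ n) y ⬝ le (om ⬝ n) (bsuc y) ⋅
      (.lam fun p => con .leTrans ⬝ (om ⬝ n) ⬝ y ⬝ bsuc y ⬝ p ⬝ (ls ⬝ y)) ⋅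
      (.lam fun p => lsS ⬝ om ⬝ o0 ⬝ ol ⬝ n ⬝ y ⬝ p) ⋅ (ih ⬝ n)) ⋅
    (.lam fun f => .lam fun u => .lam fun ih =>
      .natE (st ⬝ le (om ⬝ zero) (blim f u) ⬝ (o0 ⬝ blim f u)) fun n _ =>
        .unpack (ll ⬝ om ⬝ o0 ⬝ ol ⬝ n ⬝ f ⬝ u) fun a b =>
        si ⬝ (ex 0 nat fun k => le (om ⬝ n) (f ⬝ k)) ⬝ le (om ⬝ succ n) (blim f u) ⬝ b ⬝ a ⋅
          (sj ⬝ cc ⬝ (lam nat fun k => le (om ⬝ n) (f ⬝ k)) ⋅ .lam fun k => ih ⬝ k ⬝ n))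

theorem omegaSemidec_valid : Valid omegaSemidec :=
  valid_from [brwInd 8, propPi 8, semidecTrue, semidecFalse, semidecIff, semidecJoin, sucLeZero,
    omegaSuc, leSelfSuc, omegaLeSuc, omegaLeLim] omegaSemidecS (by decide +kernel)
    ⟨brwInd_valid, propPi_valid, semidecTrue_valid, semidecFalse_valid, semidecIff_valid,
      semidecJoin_valid, sucLeZero_valid, omegaSuc_valid, leSelfSuc_valid, omegaLeSuc_valid,
      omegaLeLim_valid⟩

/-! ### A search through the rows of a binary matrix -/

/-- Case distinction on `e`, an element of the coproduct of `A` and `B`, to prove `G`. -/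
def S.cases (A B G : Tm) (e : S) (f g : Tm → S) : S :=
  .have_ (sum 0 A B ⇒ G) (.caseE f g) fun k => (k : S) ⋅ e

def S.inl (A B : Tm) (s : S) : S := (con (.inl 0) ⬝ A ⬝ B : Tm) ⋅ s

def S.inr (A B : Tm) (s : S) : S := (con (.inr 0) ⬝ A ⬝ B : Tm) ⋅ s

/-- The entry `(a, b)` of `s` is `1`, and `C`. -/
def found (s a b : Tm) (C : Tm) : Tm := prod 0 (eq 0 two (s ⬝ a ⬝ b) digitOne) C

/-- The entry `(a, b)` of `s` is not `1`, and `C`. -/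
def notFound (s a b : Tm) (C : Tm) : Tm := prod 0 (eq 0 two (s ⬝ a ⬝ b) digitOne ⇒ empty) C

/-- The type of infinite binary matrices. -/
def matrix : Tm := nat ⇒ nat ⇒ two

/-- The search leaves the row `c t` at step `t`. -/
def advance (s c d t : Tm) : Tm := found s (c ⬝ t) (d ⬝ t)
  (prod 0 (eq 0 nat (c ⬝ succ t) (succ (c ⬝ t))) (eq 0 nat (d ⬝ succ t) zero))

/-- The search moves on in the row `c t` at step `t`. -/
def stay (s c d t : Tm) : Tm := notFound s (c ⬝ t) (d ⬝ t)
  (prod 0 (eq 0 nat (c ⬝ succ t) (c ⬝ t)) (eq 0 nat (d ⬝ succ t) (succ (d ⬝ t))))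

/-- The search through the rows of a matrix, in which each row is left at its first entry `1`. -/
def search : Tm := pi matrix fun s => sig 0 (nat ⇒ nat) fun c => sig 0 (nat ⇒ nat) fun d =>
  prod 0 (eq 0 nat (c ⬝ zero) zero) (prod 0 (eq 0 nat (d ⬝ zero) zero)
    (pi nat fun t => sum 0 (advance s c d t) (stay s c d t)))

def searchS : S := .lam fun it => .lam fun dd => .lam fun s =>
  let N2 := prod 0 nat nat
  let pr := pair 0 nat fun _ => nat
  let p1 := fst 0 nat fun _ => nat
  let p2 := snd 0 nat fun _ => nat
  let A := fun f a b => found s a b (eq 0 N2 (f ⬝ a ⬝ b) (pr (succ a) zero))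
  let B := fun f a b => notFound s a b (eq 0 N2 (f ⬝ a ⬝ b) (pr a (succ b)))
  let l := fun u => con (.inl 0) ⬝ unit ⬝ unit ⬝ u
  let r := fun u => con (.inr 0) ⬝ unit ⬝ unit ⬝ u
  let cs := fun a b => con (.sumElim 0 0) ⬝ unit ⬝ unit ⬝ (lam two fun _ => N2) ⬝
    (lam unit fun _ => pr a (succ b)) ⬝ (lam unit fun _ => pr (succ a) zero)
  let A' := fun a b x => prod 0 (eq 0 two x digitOne) (eq 0 N2 (cs a b ⬝ x) (pr (succ a) zero))
  let B' := fun a b x => prod 0 (eq 0 two x digitOne ⇒ empty) (eq 0 N2 (cs a b ⬝ x) (pr a (succ b)))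
  .have_ (pi nat fun a => pi nat fun b => pi two fun x => sum 0 (A' a b x) (B' a b x))
    (.lam fun a => .lam fun b => .caseE
      (fun u => con (.unitElim 0) ⬝ (lam unit fun u => sum 0 (A' a b (l u)) (B' a b (l u))) ⋅
        (.inr (A' a b digitZero) (B' a b digitZero) (.pair dd .refl)) ⋅ u)
      (fun u => con (.unitElim 0) ⬝ (lam unit fun u => sum 0 (A' a b (r u)) (B' a b (r u))) ⋅
        (.inl (A' a b digitOne) (B' a b digitOne) (.pair .refl .refl)) ⋅ u)) fun h =>
  .have_ (sig 0 (nat ⇒ nat ⇒ N2) fun f => pi nat fun a => pi nat fun b => sum 0 (A f a b) (B f a b))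
    (.pair (lam nat fun a => lam nat fun b => cs a b ⬝ (s ⬝ a ⬝ b)) (.lam fun a => .lam fun b =>
      h ⬝ a ⬝ b ⬝ (s ⬝ a ⬝ b))) fun w =>
  .unpack w fun f hf => .unpack (it ⬝ N2 ⬝ pr zero zero ⬝ lam N2 fun q => f ⬝ p1 q ⬝
    p2 q) fun e w =>
  .unpack w fun e0 es =>
  .have_ (pi nat fun t => eq 0 N2 (e ⬝ succ t) (f ⬝ p1 (e ⬝ t) ⬝ p2 (e ⬝ t))) es fun es =>
  let c := lam nat fun t => p1 (e ⬝ t)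
  let d := lam nat fun t => p2 (e ⬝ t)
  .pair c <| .pair d <| .pair (cong N2 nat (e ⬝ zero) p1 (pr zero zero) e0) <|
    .pair (cong N2 nat (e ⬝ zero) p2 (pr zero zero) e0) <| .lam fun t =>
    let a := p1 (e ⬝ t)
    let b := p2 (e ⬝ t)
    let next := fun (r p : Tm) (k : Tm → S) => S.have_ (eq 0 N2 (e ⬝ succ t) r)
      (J 0 0 N2 (f ⬝ a ⬝ b) (fun z _ => eq 0 N2 (e ⬝ succ t) z) (es ⬝ t) r p) k
    .cases (A f a b) (B f a b) (sum 0 (advance s c d t) (stay s c d t)) (hf ⬝ a ⬝ b)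
      (fun w => .inl (advance s c d t) (stay s c d t) <| .unpack w fun h p =>
        next (pr (succ a) zero) p fun p =>
        .pair h <| .pair (cong N2 nat (e ⬝ succ t) p1 (pr (succ a) zero) p) (cong N2 nat (e ⬝
          succ t) p2 (pr (succ a) zero) p))
      (fun w => .inr (advance s c d t) (stay s c d t) <| .unpack w fun h p =>
        next (pr a (succ b)) p fun p =>
        .pair h <| .pair (cong N2 nat (e ⬝ succ t) p1 (pr a (succ b)) p) (cong N2 nat (e ⬝
          succ t) p2 (pr a (succ b)) p))

theorem search_valid : Valid search :=
  valid_from [iteration, digitsDiffer] searchS (by decide +kernel)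
    ⟨iteration_valid, digitsDiffer_valid⟩

/-! ### Comparing `ω²` with the limit of a search -/

/-- The strict comparison of `a` and `b` is expressed by the trees `om (a+1)` and `om b`, which is
the form used later and avoids an order on natural numbers. -/
def eqOrLess (om a b : Tm) : Tm :=
  sum 0 (eq 0 nat a b) (sum 0 (le (om ⬝ succ a) (om ⬝ b)) (le (om ⬝ succ b) (om ⬝ a)))

def omegaTri : Tm := omegaSeq fun om => pi nat fun a => pi nat fun b => eqOrLess om a b

def omegaTriS : S := .lam fun mo => .omegaSeq fun om o0 ol =>
  let E := fun a b => eq 0 nat a b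
  let L := fun a b => le (om ⬝ succ a) (om ⬝ b)
  .natE (.natE (.inl (E zero zero) (sum 0 (L zero zero) (L zero zero)) .refl)
      (fun b _ => .inr (E zero (succ b)) (sum 0 (L zero (succ b)) (L (succ b) zero)) <|
        .inl (L zero (succ b)) (L (succ b) zero) (mo ⬝ om ⬝ o0 ⬝ ol ⬝ zero ⬝ b ⬝ (o0 ⬝ (om ⬝ b)))))
    fun a ih => .natE (.inr (E (succ a) zero) (sum 0 (L (succ a) zero) (L zero (succ a))) <|
        .inr (L (succ a) zero) (L zero (succ a)) (mo ⬝ om ⬝ o0 ⬝ ol ⬝ zero ⬝ a ⬝ (o0 ⬝ (om ⬝ a))))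
      fun b _ =>
        let X := sum 0 (L (succ a) (succ b)) (L (succ b) (succ a))
        let G := eqOrLess om (succ a) (succ b)
        .cases (E a b) (sum 0 (L a b) (L b a)) G (ih ⬝ b)
          (fun p => .inl (E (succ a) (succ b)) X (cong nat nat a succ b p))
          fun w => .cases (L a b) (L b a) G w
            (fun h => .inr (E (succ a) (succ b)) X <|
              .inl (L (succ a) (succ b)) (L (succ b) (succ a))
              (mo ⬝ om ⬝ o0 ⬝ ol ⬝ succ a ⬝ b ⬝ h))
            (fun h => .inr (E (succ a) (succ b)) X <|
              .inr (L (succ a) (succ b)) (L (succ b) (succ a))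
              (mo ⬝ om ⬝ o0 ⬝ ol ⬝ succ b ⬝ a ⬝ h))

theorem omegaTri_valid : Valid omegaTri :=
  valid_from [omegaMono] omegaTriS (by decide +kernel) omegaMono_valid

def omegaLeAdd : Tm := omegaSeq fun om => pi nat fun n => pi brw fun y => pi nat fun k =>
  le (om ⬝ n) (addN y k) ⇒ le (om ⬝ n) y

def omegaLeAddS : S := .lam fun ls => .omegaSeq fun om o0 ol => .lam fun n => .lam fun y =>
  .natE (.lam fun h => h) fun k ih => .lam fun h => ih ⬝ (ls ⬝ om ⬝ o0 ⬝ ol ⬝ n ⬝ addN y k ⬝ h)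

theorem omegaLeAdd_valid : Valid omegaLeAdd :=
  valid_from [omegaLeSuc] omegaLeAddS (by decide +kernel) omegaLeSuc_valid

/-- An increasing sequence that, up to finite successors, passes through the trees `om (c t)`. -/
def omegaPath : Tm := omegaSeq fun om => pi (nat ⇒ nat) fun c =>
  (pi nat fun t => sum 0 (eq 0 nat (c ⬝ succ t) (succ (c ⬝ t))) (eq 0 nat (c ⬝ succ t) (c ⬝ t))) ⇒
  sig 0 (nat ⇒ brw) fun f => prod 0 (increasing f) (prod 0 (pi nat fun t => le (om ⬝ (c ⬝ t)) (f ⬝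
    t))
    (pi nat fun n => pi nat fun t => le (om ⬝ n) (f ⬝ t) ⇒ le (om ⬝ n) (om ⬝ (c ⬝ t))))

def omegaPathS : S := .lam fun rf => .lam fun ls => .lam fun os => .lam fun am => .lam fun la =>
    .lam fun oa =>
  .omegaSeq fun om o0 ol => .lam fun c => .lam fun h =>
  .have_ (pi nat fun t => le (om ⬝ (c ⬝ t)) (om ⬝ (c ⬝ succ t)))
    (.lam fun t => .cases (eq 0 nat (c ⬝ succ t) (succ (c ⬝ t))) (eq 0 nat (c ⬝ succ t) (c ⬝ t))
      (le (om ⬝ (c ⬝ t)) (om ⬝ (c ⬝ succ t))) (h ⬝ t)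
      (fun p => J 0 0 nat (succ (c ⬝ t)) (fun z _ => le (om ⬝ (c ⬝ t)) (om ⬝ z))
        (con .leTrans ⬝ (om ⬝ (c ⬝ t)) ⬝ bsuc (om ⬝ (c ⬝ t)) ⬝ (om ⬝ succ (c ⬝ t)) ⬝
          (ls ⬝ (om ⬝ (c ⬝ t))) ⬝
          (os ⬝ om ⬝ o0 ⬝ ol ⬝ (c ⬝ t))) (c ⬝ succ t) (sym nat (c ⬝ succ t) (succ (c ⬝ t)) p))
      (fun p => J 0 0 nat (c ⬝ t) (fun z _ => le (om ⬝ (c ⬝ t)) (om ⬝ z)) (rf ⬝ (om ⬝ (c ⬝ t)))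
        (c ⬝ succ t) (sym nat (c ⬝ succ t) (c ⬝ t) p))) fun mo =>
  -- The index `c t` may stay the same for arbitrarily many steps; the summand `t` makes the
  -- sequence strictly increasing, and multiples of `ω` below a term are not affected by it.
  .pair (lam nat fun t => addN (om ⬝ (c ⬝ t)) t) <| .pair
    (.lam fun t => con .leSuc ⬝ addN (om ⬝ (c ⬝ t)) t ⬝ addN (om ⬝ (c ⬝ succ t)) t ⬝
      (am ⬝ (om ⬝ (c ⬝ t)) ⬝ (om ⬝ (c ⬝ succ t)) ⬝ (mo ⬝ t) ⬝ t)) <|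
    .pair (.lam fun t => la ⬝ (om ⬝ (c ⬝ t)) ⬝ t)
      (.lam fun n => .lam fun t => oa ⬝ om ⬝ o0 ⬝ ol ⬝ n ⬝ (om ⬝ (c ⬝ t)) ⬝ t)

theorem omegaPath_valid : Valid omegaPath :=
  valid_from [leRefl, leSelfSuc, omegaSuc, addMono, leAdd,
    omegaLeAdd] omegaPathS (by decide +kernel)
    ⟨leRefl_valid, leSelfSuc_valid, omegaSuc_valid, addMono_valid, leAdd_valid, omegaLeAdd_valid⟩

/-- There is a tree above all `om n` if and only if all rows of the matrix have an entry `1`. -/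
def omegaRows : Tm := omegaSeq fun om => pi matrix fun s => sig 0 brw fun y =>
  iff 0 (pi nat fun n => le (om ⬝ n) y) (pi nat fun n => someOne (s ⬝ n))

/-- The tree is the limit of the path that follows the row index `c` of the search. It is above `om
n` if the search reaches row `n`; conversely, trees of the form `om` below it force the search to
have left the earlier rows, each at an entry `1`. -/
def omegaRowsS : S := .lam fun se => .lam fun pa => .lam fun tri => .lam fun oll => .lam fun osu =>
    .lam fun sls =>
  .omegaSeq fun om o0 ol => .lam fun s => .unpack (se ⬝ s) fun c w => .unpack w fun d w =>
    .unpack w fun c0 w =>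
  .unpack w fun d0 st =>
  let A := fun t => advance s c d t
  let B := fun t => stay s c d t
  let S₁ := fun t => eq 0 nat (c ⬝ succ t) (succ (c ⬝ t))
  let S₂ := fun t => eq 0 nat (c ⬝ succ t) (c ⬝ t)
  let less := fun (n : Tm) (h : Tm) => S.botE (sls ⬝ (om ⬝ n) ⬝ (con .leTrans ⬝ bsuc (om ⬝ n) ⬝
    (om ⬝ succ n) ⬝ (om ⬝ n) ⬝
    (osu ⬝ om ⬝ o0 ⬝ ol ⬝ n) ⬝ h))
  .have_ (pi nat fun t => sum 0 (S₁ t) (S₂ t)) (.lam fun t =>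
    .cases (A t) (B t) (sum 0 (S₁ t) (S₂ t)) (st ⬝ t)
    (fun w => .inl (S₁ t) (S₂ t) (.unpack w fun _ w => .unpack w fun p _ => p))
    (fun w => .inr (S₁ t) (S₂ t) (.unpack w fun _ w => .unpack w fun p _ => p))) fun sc =>
  .unpack (pa ⬝ om ⬝ o0 ⬝ ol ⬝ c ⬝ sc) fun f w => .unpack w fun u w => .unpack w fun fc cf =>
  -- A row `n` before the current row has an entry `1`. When the search advances, `n` is the row
  -- just left, or an earlier one, or a later one; the last case is absurd because `om (n+1) ≤ om n`
  -- fails.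
  .have_ (pi nat fun t => pi nat fun n => le (om ⬝ succ n) (om ⬝ (c ⬝ t)) ⇒ someOne (s ⬝ n))
    (.natE (.lam fun n => .lam fun h =>
        .have_ (le (om ⬝ succ n) (om ⬝ zero)) (J 0 0 nat (c ⬝ zero) (fun z _ =>
          le (om ⬝ succ n) (om ⬝ z)) h zero c0) fun h =>
        less n (con .leTrans ⬝ (om ⬝ succ n) ⬝ (om ⬝ zero) ⬝ (om ⬝ n) ⬝ h ⬝ (o0 ⬝ (om ⬝ n))))
      fun t ih => .lam fun n => .lam fun h => .cases (A t) (B t) (someOne (s ⬝ n)) (st ⬝ t)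
        (fun w => .unpack w fun q w => .unpack w fun p _ =>
          .have_ (le (om ⬝ succ n) (om ⬝ succ (c ⬝ t)))
            (J 0 0 nat (c ⬝ succ t) (fun z _ => le (om ⬝ succ n) (om ⬝ z)) h (succ (c ⬝
              t)) p) fun h =>
          let X := le (om ⬝ succ n) (om ⬝ (c ⬝ t))
          let Y := le (om ⬝ succ (c ⬝ t)) (om ⬝ n)
          .cases (eq 0 nat n (c ⬝ t)) (sum 0 X Y) (someOne (s ⬝ n)) (tri ⬝ om ⬝ o0 ⬝ ol ⬝ n ⬝
            (c ⬝ t))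
            (fun p => .exI <| .pair (d ⬝ t) (J 0 0 nat (c ⬝ t) (fun z _ => eq 0 two (s ⬝ z ⬝
              (d ⬝ t)) digitOne) q n
              (sym nat n (c ⬝ t) p)))
            fun w => .cases X Y (someOne (s ⬝ n)) w (fun h => ih ⬝ n ⬝ h)
              fun k => less n (con .leTrans ⬝ (om ⬝ succ n) ⬝ (om ⬝ succ (c ⬝ t)) ⬝ (om ⬝ n) ⬝ h ⬝
                k))
        (fun w => .unpack w fun _ w => .unpack w fun p _ => ih ⬝ n ⋅
          J 0 0 nat (c ⬝ succ t) (fun z _ => le (om ⬝ succ n) (om ⬝ z)) h (c ⬝ t) p)) fun inv =>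
  let at_ := fun n k => sig 0 nat fun t => prod 0 (eq 0 nat (c ⬝ t) n) (eq 0 nat (d ⬝ t) k)
  -- A search that enters a row with an entry `1` also leaves it.
  .have_ (pi nat fun n => (someOne (s ⬝ n)) ⇒ at_ n zero ⇒ trunc 0 (at_ (succ n) zero))
    (.lam fun n => .lam fun h => .lam fun r =>
      let X := fun k => at_ n k
      let Y := at_ (succ n) zero
      let step := fun (t p : Tm) => (J 0 0 nat (c ⬝ t) (fun z _ => eq 0 nat (c ⬝
        succ t) (succ z)) · n p : Tm → S)
      -- For every column `k`, the search either visits position `(n, k)` or reaches the next row.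
      -- If `k` is the column of a `1`, a visit also leads to the next row.
      .have_ (pi nat fun k => sum 0 (X k) Y)
        (.natE (.inl (X zero) Y r) fun k ih => .cases (X k) Y (sum 0 (X (succ k)) Y) ih
          (fun w => .unpack w fun t w => .unpack w fun p q =>
            .cases (A t) (B t) (sum 0 (X (succ k)) Y) (st ⬝ t)
            (fun w => .unpack w fun _ w => .unpack w fun p' q' => .inr (X (succ k)) Y <|
              .pair (succ t) <|
              .pair (step t p p') q')
            (fun w => .unpack w fun _ w => .unpack w fun p' q' => .inl (X (succ k)) Y <|
              .pair (succ t) <|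
              .pair (J 0 0 nat (c ⬝ t) (fun z _ => eq 0 nat (c ⬝ succ t) z) p' n p)
                (J 0 0 nat (d ⬝ t) (fun z _ => eq 0 nat (d ⬝ succ t) (succ z)) q' k q)))
          (fun w => .inr (X (succ k)) Y w)) fun rk =>
      .exE h fun w => .unpack w fun k e => .cases (X k) Y (trunc 0 Y) (rk ⬝ k)
        (fun w => .unpack w fun t w => .unpack w fun p q => .cases (A t) (B t) (trunc 0 Y) (st ⬝ t)
          (fun w => .unpack w fun _ w => .unpack w fun p' q' => .exI <| .pair (succ t) <|
            .pair (step t p p') q')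
          (fun w => .unpack w fun ne _ => .botE ((ne : S) ⋅
            J 0 0 nat n (fun z _ => eq 0 two (s ⬝ z ⬝ (d ⬝ t)) digitOne)
              (J 0 0 nat k (fun z _ => eq 0 two (s ⬝ n ⬝ z) digitOne) e (d ⬝ t) (sym nat (d ⬝
                t) k q))
              (c ⬝ t) (sym nat (c ⬝ t) n p))))
        (fun w => .exI w)) fun nx =>
  .pair (blim f u) <| .pair
    (.lam fun h => .lam fun n => .unpack (oll ⬝ om ⬝ o0 ⬝ ol ⬝ succ n ⬝ f ⬝ u) fun g _ =>
      -- One successor is lost in passing from the limit to a term of the sequence; the other says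
      -- that the search has gone beyond row `n`.
      .exE (g ⬝ (h ⬝ succ (succ n))) fun w => .unpack w fun k p => inv ⬝ k ⬝ n ⬝ (cf ⬝ succ n ⬝ k ⬝
        p))
    (.lam fun h => .have_ (pi nat fun n => trunc 0 (at_ n zero))
      (.natE (.exI (.pair zero (.pair c0 d0))) fun n ih => .exE ih fun r => nx ⬝ n ⬝ (h ⬝ n) ⬝
        r) fun re =>
      .lam fun n => .exE (re ⬝ n) fun w => .unpack w fun t w => .unpack w fun p _ =>
        con .leCocone ⬝ (om ⬝ n) ⬝ f ⬝ u ⬝ t ⋅ J 0 0 nat (c ⬝ t) (fun z _ => le (om ⬝ z) (f ⬝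
          t)) (fc ⬝ t) n p)

theorem omegaRows_valid : Valid omegaRows :=
  valid_from [search, omegaPath, omegaTri, omegaLeLim, omegaSuc, sucLeSelf] omegaRowsS
    (by decide +kernel) ⟨search_valid, omegaPath_valid, omegaTri_valid, omegaLeLim_valid,
      omegaSuc_valid, sucLeSelf_valid⟩

/-! ### Propositions that are decidable with respect to the supremum of the multiples of `ω` -/

/-- Quantification over the sequences `om` as in `omegaSeq` and their suprema `w`, under countable
choice. -/
def omegaSup (body : (om w : Tm) → Tm) : Tm := omegaSeq fun om => pi brw fun w =>
  (pi brw fun y => iff 0 (le w y) (pi nat fun n => le (om ⬝ n) y)) ⇒ countableChoice 8 ⇒ body om w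

def S.omegaSup (body : (om o0 ol w ow cc : Tm) → S) : S :=
  .omegaSeq fun om o0 ol => .lam fun w => .lam fun ow => .lam fun cc => body om o0 ol w ow cc

/-- The propositions `om m ≤ Y n`, listed along an enumeration of pairs, are semidecidable.
Countable choice makes their binary sequences the rows of a matrix, to which `omegaRows` applies. -/
def supMeet : Tm := omegaSup fun _ w => pi (nat ⇒ brw) fun Y =>
  ex 8 brw fun y => iff 0 (le w y) (pi nat fun n => le w (Y ⬝ n))

def supMeetS : S := .lam fun en => .lam fun sd => .lam fun ro => .omegaSup fun om o0 ol _ ow cc =>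
  .lam fun Y => .unpack en fun e v => .unpack v fun e' sj =>
  let P := fun j => le (om ⬝ (e' ⬝ j)) (Y ⬝ (e ⬝ j))
  let B := fun j s => iff 8 (P j) (someOne s)
  .exE (cc ⬝ (lam nat fun j => sig 8 (nat ⇒ two) fun s => B j s) ⬝
      (lam nat fun j => sd ⬝ om ⬝ o0 ⬝ ol ⬝ cc ⬝ (Y ⬝ (e ⬝ j)) ⬝ (e' ⬝ j))) fun q =>
  .have_ (pi nat fun j => sig 8 (nat ⇒ two) fun s => B j s) q fun q =>
  .have_ (sig 8 matrix fun s => pi nat fun j => B j (s ⬝ j))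
    (.pair (lam nat fun j => fst 8 (nat ⇒ two) (fun s => B j s) (q ⬝ j)) (.lam fun j =>
      .snd (q ⬝ j))) fun v =>
  .unpack v fun s hs => .unpack (ro ⬝ om ⬝ o0 ⬝ ol ⬝ s) fun y v => .unpack v fun f g =>
  .exI <| .pair y <| .pair
    (.lam fun h => .lam fun n => .unpack (ow ⬝ y) fun a _ => .unpack (ow ⬝ (Y ⬝ n)) fun _ b =>
      (b : S) ⋅ .lam fun m => .unpack (sj ⬝ n ⬝ m) fun j t => .unpack t fun p p' => .unpack (hs ⬝
        j) fun _ k =>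
        J 0 0 nat (e' ⬝ j) (fun z _ => le (om ⬝ z) (Y ⬝ n))
          (J 0 0 nat (e ⬝ j) (fun z _ => le (om ⬝ (e' ⬝ j)) (Y ⬝ z)) (k ⬝ (f ⬝ (a ⬝ h) ⬝
            j)) n p) m p')
    (.lam fun h => .unpack (ow ⬝ y) fun _ b => (b : S) ⋅ ((g : S) ⋅ .lam fun j => .unpack (hs ⬝
      j) fun k _ =>
      .unpack (ow ⬝ (Y ⬝ (e ⬝ j))) fun a _ => k ⬝ (a ⬝ (h ⬝ (e ⬝ j)) ⬝ (e' ⬝ j))))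

theorem supMeet_valid : Valid supMeet :=
  valid_from [enumeration, omegaSemidec, omegaRows] supMeetS (by decide +kernel)
    ⟨enumeration_valid, omegaSemidec_valid, omegaRows_valid⟩

/-- Countable choice selects a tree for each proposition and thereby reduces the claim to `supMeet`.
-/
def supDecMeet : Tm := omegaSup fun _ w => pi (nat ⇒ U 8) fun P =>
  (pi nat fun n => ordDec 8 w (P ⬝ n)) ⇒ ordDec 8 w (pi nat fun n => P ⬝ n)

def supDecMeetS : S := .lam fun sm => .omegaSup fun om o0 ol w ow cc => .lam fun P => .lam fun h =>
  let B := fun n y => iff 8 (P ⬝ n) (le w y)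
  .exE (cc ⬝ (lam nat fun n => sig 8 brw fun y => B n y) ⬝ h) fun q =>
  .have_ (pi nat fun n => sig 8 brw fun y => B n y) q fun q =>
  .have_ (sig 8 (nat ⇒ brw) fun Y => pi nat fun n => B n (Y ⬝ n))
    (.pair (lam nat fun n => fst 8 brw (fun y => B n y) (q ⬝ n)) (.lam fun n =>
      .snd (q ⬝ n))) fun v =>
  .unpack v fun Y hY => .exE (sm ⬝ om ⬝ o0 ⬝ ol ⬝ w ⬝ ow ⬝ cc ⬝ Y) fun v => .unpack v fun y v =>
  .unpack v fun f g => .exI <| .pair y <| .pair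
    (.lam fun p => (g : S) ⋅ .lam fun n => .unpack (hY ⬝ n) fun a _ => a ⬝ (p ⬝ n))
    (.lam fun p => .lam fun n => .unpack (hY ⬝ n) fun _ b => b ⬝ (f ⬝ p ⬝ n))

theorem supDecMeet_valid : Valid supDecMeet :=
  valid_from [supMeet] supDecMeetS (by decide +kernel) supMeet_valid

/-- The statement `omegaSqDecMeet`, with `w` in place of `ω²`. -/
def decMeet (i : ℕ) (w : Tm) : Tm :=
  pi (nat ⇒ hProp i) fun P => (pi nat fun n => ordDec i w (holds i (P ⬝ n))) ⇒
    ordDec i w (pi nat fun n => holds i (P ⬝ n))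

/-- The statement `omegaSqDecIsMeet`, with `w` in place of `ω²`. -/
def decIsMeet (i : ℕ) (w : Tm) : Tm :=
  pi (hProp i) fun P => ordDec i w (holds i P) ⇒
    ex (i + 1) (nat ⇒ hProp i) fun Q =>
      prod (i + 1) (pi nat fun n => semidec i (holds i (Q ⬝ n)))
        (iff (i + 1) (holds i P) (pi nat fun n => holds i (Q ⬝ n)))

def supMeetProps : Tm := omegaSup fun _ w => decMeet 8 w

def supMeetPropsS : S := .lam fun dm => .omegaSup fun om o0 ol w ow cc => .lam fun P =>
  dm ⬝ om ⬝ o0 ⬝ ol ⬝ w ⬝ ow ⬝ cc ⬝ lam nat fun n => holds 8 (P ⬝ n)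

/-- The meet is that of the propositions `om n ≤ y`, which live in the lowest universe and are
lifted to the given one. -/
def supIsMeet : Tm := omegaSup fun _ w => decIsMeet 8 w

def supIsMeetS : S := .lam fun sd => .lam fun lp => .omegaSup fun om o0 ol _ ow cc => .lam fun _ =>
    .lam fun h =>
  .exE h fun v => .unpack v fun y v => .unpack v fun f g => .unpack (ow ⬝ y) fun a b =>
  .exI <| .pair (lam nat fun n => pair 9 (U 8) (fun A => isProp 8 A) (le (om ⬝ n) y)
      (lp ⬝ le (om ⬝ n) y ⬝ (con .leProp ⬝ (om ⬝ n) ⬝ y))) <| .pair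
    (.lam fun n => sd ⬝ om ⬝ o0 ⬝ ol ⬝ cc ⬝ y ⬝ n)
    (.pair (.lam fun p => a ⬝ (f ⬝ p)) (.lam fun p => g ⬝ (b ⬝ p)))

theorem supMeetProps_valid : Valid supMeetProps :=
  valid_from [supDecMeet] supMeetPropsS (by decide +kernel) supDecMeet_valid

theorem supIsMeet_valid : Valid supIsMeet :=
  valid_from [omegaSemidec, liftProp 0 8] supIsMeetS (by decide +kernel)
    ⟨omegaSemidec_valid, liftProp_valid⟩

/-! ### Meets of propositions that are decidable with respect to a limit -/

/-- Quantification over the limits of the sequences `om` as in `omegaSeq`. -/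
def omegaLim (body : Tm → Tm) : Tm := pi (nat ⇒ brw) fun om => pi (increasing om) fun u =>
  (pi brw fun y => le (om ⬝ zero) y) ⇒
  (pi nat fun n => pi brw fun y =>
    iff 0 (le (om ⬝ succ n) y) (pi nat fun k => le (addN (om ⬝ n) k) y)) ⇒ body (blim om u)

def limOfSupS : S := .lam fun rf => .lam fun su => .lam fun om => .lam fun u => .lam fun o0 =>
    .lam fun ol =>
  .have_ (pi brw fun y => iff 0 (le (blim om u) y) (pi nat fun n => le (om ⬝ n) y))
    (.lam fun y => .pair
      (.lam fun h => .lam fun n => con .leTrans ⬝ (om ⬝ n) ⬝ blim om u ⬝ y ⬝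
        (con .leCocone ⬝ (om ⬝ n) ⬝ om ⬝ u ⬝ n ⬝ (rf ⬝ (om ⬝ n))) ⬝ h)
      (.lam fun h => con .leLimiting ⬝ om ⬝ u ⬝ y ⬝ h)) fun ow =>
  su ⬝ om ⬝ o0 ⬝ ol ⬝ blim om u ⬝ ow

theorem limMeet_valid : Valid (omegaLim fun w => countableChoice 8 ⇒ decMeet 8 w) :=
  valid_from [leRefl, supMeetProps] limOfSupS (by decide +kernel) ⟨leRefl_valid, supMeetProps_valid⟩

theorem limIsMeet_valid : Valid (omegaLim fun w => countableChoice 8 ⇒ decIsMeet 8 w) :=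
  valid_from [leRefl, supIsMeet] limOfSupS (by decide +kernel) ⟨leRefl_valid, supIsMeet_valid⟩

/-! ### The tree `ω²` -/

def addOmegaLe : Tm := pi reflBrw fun w => pi brw fun y =>
  iff 0 (le (addOmega w) y) (pi nat fun k => le (addNat w k) y)

def addOmegaLeS : S := .lam fun rf => .lam fun w => .lam fun y => .pair
  (.lam fun h => .lam fun k => con .leTrans ⬝ addNat w k ⬝ addOmega w ⬝ y ⬝
     (con .leCocone ⬝ addNat w k ⬝ addNatSeq w ⬝ addNatIncr w ⬝ k ⬝ (rf ⬝ addNat w k)) ⬝ h)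
  (.lam fun h => con .leLimiting ⬝ addNatSeq w ⬝ addNatIncr w ⬝ y ⬝ h)

theorem addOmegaLe_valid : Valid addOmegaLe :=
  valid_from [leRefl] addOmegaLeS (by decide +kernel) leRefl_valid

section omega

variable {p : ℕ} {Γ : Ctx} {A B D a a' b t u : Term} {i : ℕ}

theorem Typed.subst (hb : Typed p (A :: Γ) b B) (ha : Typed p Γ a A) :
    Typed p Γ (b.psub [a] 0) (B.psub [a] 0) := by
  unfold Typed; rw [Term.lv_inst, Term.lv_inst]; exact HasType.subst hb ha

theorem Equal.subst (hb : Equal p (A :: Γ) t u B) (ha : Typed p Γ a A) :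
    Equal p Γ (t.psub [a] 0) (u.psub [a] 0) (B.psub [a] 0) := by
  unfold Equal; rw [Term.lv_inst, Term.lv_inst, Term.lv_inst]; exact DefEq.subst hb ha

def checks (Γ : Ctx) (t A : Term) : Bool := ((fns rules 40).check Γ t A).isOk

def converts (Γ : Ctx) (t u A : Term) : Bool := ((fns rules 40).conv Γ t u A).isOk

theorem typed_of_checks (hΓ : Wf p Γ) (h : checks Γ t A = true) : Typed p Γ t A := by
  obtain ⟨x, h⟩ := Res.isOk_iff.1 h
  exact (fns_ok (rules_ok p) 40).check hΓ h

theorem equal_of_converts (hΓ : Wf p Γ) (h : converts Γ t u A = true) : Equal p Γ t u A := by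
  obtain ⟨x, h⟩ := Res.isOk_iff.1 h
  exact (fns_ok (rules_ok p) 40).conv hΓ h

/-- The variable that is bound at depth `l`. -/
def bvar (l : ℕ) : Tm := fun e => .var (e - (l + 1))

/-- The method of the recursion that defines `omegaMulRefl`. -/
def omegaMulStep : Tm := lam nat fun _ => lam reflBrw fun w =>
  pair 0 brw (fun x => le x x) (addOmega w) (addOmegaRefl w)

/-- The sequence `ω · n`. -/
def omegaMulSeq : Tm := lam nat fun n => omegaMul n

def omegaMulBase : Tm := pair 0 brw (fun x => le x x) bzero (con .leZero ⬝ bzero)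

def recRefl (z s n : Tm) : Tm := con (.natElim 0) ⬝ (lam nat fun _ => reflBrw) ⬝ z ⬝ s ⬝ n

def stepType : Tm := nat ⇒ reflBrw ⇒ reflBrw

def sucLeAddOmega (w : Tm) : Tm :=
  con .leCocone ⬝ bsuc (tree w) ⬝ addNatSeq w ⬝ addNatIncr w ⬝ succ zero ⬝
    (con .leSuc ⬝ tree w ⬝ tree w ⬝ treeRefl w)

/-- The context of a natural number. -/
def natCtx : Ctx := [nat 0]

/-- The context of a natural number and an element of `reflBrw`. -/
def reflCtx : Ctx := [reflBrw 1, nat 0]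

theorem wf_nat : Wf p natCtx :=
  (typed_of_checks (Γ := []) WfCtx.nil (t := nat 0) (A := .univ 0) (by decide +kernel)).wf (i := 0)

theorem wf_refl : Wf p reflCtx :=
  (typed_of_checks wf_nat (t := reflBrw 1) (A := .univ 0) (by decide +kernel)).wf (i := 0)

theorem omegaMulRefl_typed : Typed p natCtx (omegaMulRefl (bvar 0) 1) (reflBrw 1) :=
  typed_of_checks wf_nat (by decide +kernel)

theorem omegaMul_typed : Typed p [nat 1, nat 0] (omegaMul (bvar 1) 2) (brw 2) :=
  typed_of_checks ((typed_of_checks wf_nat (t := nat 1) (A := .univ 0) (by decide +kernel)).wf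
    (i := 0)) (by decide +kernel)

theorem omegaMulSeq_typed : Typed p [] (omegaMulSeq 0) ((nat ⇒ brw) 0) := by
  have h : Typed p reflCtx (tree (bvar 1) 2) (brw 2) := typed_of_checks wf_refl (by decide +kernel)
  have h := h.subst omegaMulRefl_typed
  rw [Term.eqb_eq (t := (tree (bvar 1) 2).psub _ 0) (u :=
    omegaMul (bvar 0) 1) (by decide +kernel)] at h
  exact h.lam

theorem omegaMulSeq_typed_nat : Typed p natCtx (omegaMulSeq 1) ((nat ⇒ brw) 1) :=
  omegaMul_typed.lam

theorem omegaMulSeq_app {t : Term} (ht : Typed p natCtx t (nat 1)) :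
    Equal p natCtx (.app (omegaMulSeq 1) t) ((omegaMul (bvar 1) 2).psub [t] 0) (brw 1) :=
  Equal.beta omegaMul_typed ht

theorem bvar_typed : Typed p natCtx (bvar 0 1) (nat 1) := typed_of_checks wf_nat (by decide +kernel)

theorem succ_typed : Typed p natCtx (succ (bvar 0) 1) (nat 1) :=
  typed_of_checks wf_nat (by decide +kernel)

/-- The computation rule is applied with variables in place of the base and the step of the
recursion, which keeps the terms small; the actual ones are substituted afterwards. -/
theorem recRefl_succ : Equal p natCtx (omegaMul (succ (bvar 0)) 1)
    (tree (omegaMulStep ⬝ bvar 0 ⬝ omegaMulRefl (bvar 0)) 1) (brw 1) := by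
  have hs : Wf p [stepType 2, reflBrw 1, nat 0] :=
    (typed_of_checks wf_refl (t := stepType 2) (A := .univ 0) (by decide +kernel)).wf (i := 0)
  have h : Equal p [stepType 2, reflBrw 1,
    nat 0] (tree (recRefl (bvar 1) (bvar 2) (succ (bvar 0))) 3)
      (tree (bvar 2 ⬝ bvar 0 ⬝ recRefl (bvar 1) (bvar 2) (bvar 0)) 3) (brw 3) :=
    equal_of_converts hs (by decide +kernel)
  have h := (h.subst (a := omegaMulStep 2) (typed_of_checks wf_refl (by decide +kernel))).subst
    (a := omegaMulBase 1) (typed_of_checks wf_nat (by decide +kernel))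
  have e₁ := Term.eqb_eq (t := (((tree (recRefl (bvar 1) (bvar 2) (succ (bvar 0))) 3).psub
    [omegaMulStep 2] 0).psub [omegaMulBase 1] 0)) (u :=
      omegaMul (succ (bvar 0)) 1) (by decide +kernel)
  have e₂ := Term.eqb_eq (t := (((tree (bvar 2 ⬝ bvar 0 ⬝
    recRefl (bvar 1) (bvar 2) (bvar 0)) 3).psub
    [omegaMulStep 2] 0).psub [omegaMulBase 1] 0))
    (u := tree (omegaMulStep ⬝ bvar 0 ⬝ omegaMulRefl (bvar 0)) 1) (by decide +kernel)
  rw [e₁, e₂] at h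
  exact h

/-- The projection of the step is computed for a variable `w` in place of `omegaMulRefl n`, which is
substituted only in the result. -/
theorem omegaMul_succ :
    Equal p natCtx (omegaMul (succ (bvar 0)) 1) (addOmega (omegaMulRefl (bvar 0)) 1)
    (brw 1) := by
  have h : Equal p reflCtx (tree (omegaMulStep ⬝ bvar 0 ⬝
    bvar 1) 2) (addOmega (bvar 1) 2) (brw 2) :=
    equal_of_converts wf_refl (by decide +kernel)
  have h := h.subst omegaMulRefl_typed
  rw [Term.eqb_eq (t := (tree (omegaMulStep ⬝ bvar 0 ⬝ bvar 1) 2).psub _ 0)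
      (u := tree (omegaMulStep ⬝ bvar 0 ⬝ omegaMulRefl (bvar 0)) 1) (by decide +kernel),
    Term.eqb_eq (t := (addOmega (bvar 1) 2).psub _ 0) (u := addOmega (omegaMulRefl (bvar 0)) 1)
      (by decide +kernel)] at h
  exact recRefl_succ.trans h

theorem omegaMulSeq_succ : Equal p natCtx (addOmega (omegaMulRefl (bvar 0)) 1)
    ((omegaMulSeq ⬝ succ (bvar 0)) 1) (brw 1) := by
  have h := omegaMulSeq_app (p := p) succ_typed
  rw [Term.eqb_eq (t := (omegaMul (bvar 1) 2).psub _ 0) (u := omegaMul (succ (bvar 0)) 1)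
    (by decide +kernel)] at h
  exact omegaMul_succ.symm.trans h.symm

theorem omegaMulSeq_var : Equal p natCtx (omegaMul (bvar 0) 1) ((omegaMulSeq ⬝
    bvar 0) 1) (brw 1) := by
  have h := omegaMulSeq_app (p := p) bvar_typed
  rw [Term.eqb_eq (t := (omegaMul (bvar 1) 2).psub _ 0) (u := omegaMul (bvar 0) 1)
    (by decide +kernel)] at h
  exact h.symm

end omega

-- The multiples of `ω` as an instance of the abstract sequence

section omega

variable {p : ℕ}

theorem Typed.weaken {Γ : Ctx} {A B t : Term} {i : ℕ} (h : Typed p Γ t A)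
    (hB : Typed p Γ B (.univ i)) : Typed p (B :: Γ) t.shift A.shift := by
  unfold Typed; rw [Term.lv_shift, Term.lv_shift]; exact HasType.weaken h hB

theorem addOmega_typed : Typed p natCtx (addOmega (omegaMulRefl (bvar 0)) 1) (brw 1) := by
  have h : Typed p reflCtx (addOmega (bvar 1) 2) (brw 2) :=
    typed_of_checks wf_refl (by decide +kernel)
  have h := h.subst omegaMulRefl_typed
  rwa [Term.eqb_eq (t := (addOmega (bvar 1) 2).psub _ 0) (u := addOmega (omegaMulRefl (bvar 0)) 1)
    (by decide +kernel)] at h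

theorem omegaMul_typed_nat : Typed p natCtx (omegaMul (bvar 0) 1) (brw 1) := by
  have h : Typed p reflCtx (tree (bvar 1) 2) (brw 2) := typed_of_checks wf_refl (by decide +kernel)
  have h := h.subst omegaMulRefl_typed
  rwa [Term.eqb_eq (t := (tree (bvar 1) 2).psub _ 0) (u :=
    omegaMul (bvar 0) 1) (by decide +kernel)] at h

theorem seq_var_typed : Typed p natCtx ((omegaMulSeq ⬝ bvar 0) 1) (brw 1) :=
  omegaMulSeq_typed_nat.app bvar_typed

theorem seq_succ_typed : Typed p natCtx ((omegaMulSeq ⬝ succ (bvar 0)) 1) (brw 1) :=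
  omegaMulSeq_typed_nat.app succ_typed

theorem brw_typed : Typed p natCtx (brw 1) (.univ 0) := typed_of_checks wf_nat (by decide +kernel)

/-- The family `D` of two trees, as a function. -/
def family₂ (D : Tm → Tm → Tm) : Tm := lam brw fun a => lam brw fun b => D a b

/-- The substitution of `a` and `b` for two variables of type `brw`. -/
def subst₂ (t a b : Term) : Term := (t.psub [b.shift] 0).psub [a] 0

theorem family₂_app {D : Tm → Tm → Tm}
    (h : converts [brw 2, brw 1, nat 0] ((family₂ D ⬝ bvar 1 ⬝ bvar 2) 3) (D (bvar 1) (bvar 2) 3)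
      (.univ 0) = true) {a b : Tm}
    (h₁ : Term.eqb (subst₂ ((family₂ D ⬝ bvar 1 ⬝ bvar 2) 3) (a 1) (b 1))
      ((family₂ D ⬝ a ⬝ b) 1) = true)
    (h₂ : Term.eqb (subst₂ (D (bvar 1) (bvar 2) 3) (a 1) (b 1)) (D a b 1) = true)
    (ha : Typed p natCtx (a 1) (brw 1)) (hb : Typed p natCtx (b 1) (brw 1)) :
    Equal p natCtx ((family₂ D ⬝ a ⬝ b) 1) (D a b 1) (.univ 0) := by
  have w₁ : Wf p [brw 1, nat 0] := brw_typed.wf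
  have w₂ : Wf p [brw 2, brw 1, nat 0] :=
    (typed_of_checks w₁ (t := brw 2) (A := .univ 0) (by decide +kernel)).wf (i := 0)
  have k := ((equal_of_converts w₂ h).subst (hb.weaken brw_typed)).subst ha
  rw [← Term.eqb_eq h₁, ← Term.eqb_eq h₂]
  exact k

/-- An element of a family for the trees `ω · n` and `ω · n + ω` is an element of the family for
the terms `n` and `n + 1` of the sequence `ω · n`. -/
theorem typed_seq {t : Term} (D : Tm → Tm → Tm)
    (h : (converts [brw 2, brw 1, nat 0] ((family₂ D ⬝ bvar 1 ⬝ bvar 2) 3) (D (bvar 1) (bvar 2) 3)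
      (.univ 0) &&
      checks natCtx (family₂ D 1) ((brw ⇒ brw ⇒ U 0) 1)) = true)
    (e : (Term.eqb (subst₂ ((family₂ D ⬝ bvar 1 ⬝
      bvar 2) 3) (omegaMul (bvar 0) 1) (addOmega (omegaMulRefl (bvar 0)) 1))
      ((family₂ D ⬝ omegaMul (bvar 0) ⬝ addOmega (omegaMulRefl (bvar 0))) 1) &&
      Term.eqb (subst₂ (D (bvar 1) (bvar 2) 3) (omegaMul (bvar 0) 1) (addOmega (omegaMulRefl (bvar 0)) 1))
      (D (omegaMul (bvar 0)) (addOmega (omegaMulRefl (bvar 0))) 1)) = true)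
    (e' : (Term.eqb (subst₂ ((family₂ D ⬝ bvar 1 ⬝ bvar 2) 3) ((omegaMulSeq ⬝
      bvar 0) 1) ((omegaMulSeq ⬝ succ (bvar 0)) 1))
      ((family₂ D ⬝ (omegaMulSeq ⬝ bvar 0) ⬝ (omegaMulSeq ⬝ succ (bvar 0))) 1) &&
      Term.eqb (subst₂ (D (bvar 1) (bvar 2) 3) ((omegaMulSeq ⬝ bvar 0) 1) ((omegaMulSeq ⬝
        succ (bvar 0)) 1))
      (D (omegaMulSeq ⬝ bvar 0) (omegaMulSeq ⬝ succ (bvar 0)) 1)) = true)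
    (ht : HasType (natCtx.map (Term.lv p)) t
      ((D (omegaMul (bvar 0)) (addOmega (omegaMulRefl (bvar 0))) 1).lv p)) :
    HasType (natCtx.map (Term.lv p)) t
      ((D (omegaMulSeq ⬝ bvar 0) (omegaMulSeq ⬝ succ (bvar 0)) 1).lv p) := by
  rw [Bool.and_eq_true] at h e e'
  have hK : Typed p natCtx (family₂ D 1) ((brw ⇒ brw ⇒ U 0) 1) := typed_of_checks wf_nat h.2
  exact ht.conv ((family₂_app h.1 e.1 e.2 omegaMul_typed_nat addOmega_typed).symm.trans
    (((hK.refl.app omegaMulSeq_var).app omegaMulSeq_succ).trans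
      (family₂_app h.1 e'.1 e'.2 seq_var_typed seq_succ_typed)))

/-- As written, the proof concerns `ω·n` and `ω·n + ω`; its type is converted to one about
consecutive terms of the sequence. -/
theorem omegaMulIncr_typed : Typed p [] (omegaMulIncr 0) (increasing omegaMulSeq 0) := by
  have h : Typed p reflCtx (sucLeAddOmega (bvar 1) 2) (le (bsuc (tree (bvar 1))) (addOmega (bvar 1)) 2) :=
    typed_of_checks wf_refl (by decide +kernel)
  have h := h.subst omegaMulRefl_typed
  rw [Term.eqb_eq (t := (sucLeAddOmega (bvar 1) 2).psub _ 0) (u :=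
    sucLeAddOmega (omegaMulRefl (bvar 0)) 1)
      (by decide +kernel),
    Term.eqb_eq (t := (le (bsuc (tree (bvar 1))) (addOmega (bvar 1)) 2).psub _ 0)
      (u := le (bsuc (omegaMul (bvar 0))) (addOmega (omegaMulRefl (bvar 0))) 1) (by decide +kernel)] at h
  exact (typed_seq (fun a b => le (bsuc a) b) (by decide +kernel) (by decide +kernel)
    (by decide +kernel) h).lam

def omegaMulSeqZero : Tm := pi brw fun y => le (omegaMulSeq ⬝ zero) y

theorem omegaMulSeqZero_typed : Typed p [] ((lam brw fun y => con .leZero ⬝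
    y) 0) (omegaMulSeqZero 0) :=
  typed_of_checks WfCtx.nil (by decide +kernel)

def leAddOmega (a b : Tm) : Tm := pi brw fun y => iff 0 (le b y) (pi nat fun k => le (addN a k) y)

def leAddOmega' : Tm := pi brw fun y =>
  iff 0 (le (addOmega (bvar 1)) y) (pi nat fun k => le (addNat (bvar 1) k) y)

/-- `addOmegaLe` at `omegaMulRefl n`, converted in the same way; `addNat w k` and `addN (tree w) k`
are the same raw term. -/
theorem omegaMulSeq_succ_le : ∃ t, HasType [] t
    ((pi nat fun n => leAddOmega (omegaMulSeq ⬝ n) (omegaMulSeq ⬝ succ n)).close.lv p) := by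
  obtain ⟨t, ht⟩ := addOmegaLe_valid p
  have hn : HasType [] ((nat 0).lv p) (.univ 0) :=
    typed_of_checks (p := p) (Γ := []) WfCtx.nil (t := nat 0) (A := .univ 0) (by decide +kernel)
  have h := HasType.weaken ht hn
  have e : (addOmegaLe 0).shift = addOmegaLe 1 := by
    rw [← Term.lift_one]; exact Term.eqb_eq (by decide +kernel)
  have e' := Term.lv_shift p (addOmegaLe 0)
  rw [e] at e'
  rw [Tm.close, ← e'] at h
  have h := HasType.app h omegaMulRefl_typed
  have k := Term.lv_inst p (leAddOmega' 2) (omegaMulRefl (bvar 0) 1)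
  rw [Term.eqb_eq (t := (leAddOmega' 2).psub _ 0)
    (u := leAddOmega (omegaMul (bvar 0)) (addOmega (omegaMulRefl (bvar 0))) 1) (by decide +kernel)] at k
  exact ⟨_, (typed_seq leAddOmega (by decide +kernel) (by decide +kernel) (by decide +kernel)
    (k ▸ h)).lam⟩

end omega

-- The two statements for `ω²`

theorem Valid.app {A : Tm} {B : Tm → Tm} {C : Tm} (h : Valid (pi A B)) (a : Term)
    (ha : ∀ p, Typed p [] a A.close) (hC : Term.eqb ((B (bvar 0) 1).psub [a] 0) C.close = true) :
    Valid C := by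
  intro p
  obtain ⟨t, ht⟩ := h p
  have := HasType.app ht (ha p)
  rw [← Term.eqb_eq hC, Term.lv_inst]
  exact ⟨_, this⟩

theorem decMeet_valid : Valid (countableChoice 8 ⇒ decMeet 8 omegaSq) := by
  have h := limMeet_valid.app (omegaMulSeq 0) (fun _ => omegaMulSeq_typed)
    (C := pi (increasing omegaMulSeq) fun u => omegaMulSeqZero ⇒
      (pi nat fun n => leAddOmega (omegaMulSeq ⬝ n) (omegaMulSeq ⬝ succ n)) ⇒
      countableChoice 8 ⇒ decMeet 8 (blim omegaMulSeq u)) (by decide +kernel)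
  have h := h.app (omegaMulIncr 0) (fun _ => omegaMulIncr_typed)
    (C := omegaMulSeqZero ⇒
      (pi nat fun n => leAddOmega (omegaMulSeq ⬝ n) (omegaMulSeq ⬝ succ n)) ⇒
      countableChoice 8 ⇒ decMeet 8 omegaSq) (by decide +kernel)
  exact (h.mp (fun _ => ⟨_, omegaMulSeqZero_typed⟩) (by decide +kernel)).mp
    (fun _ => omegaMulSeq_succ_le) (by decide +kernel)

theorem decIsMeet_valid : Valid (countableChoice 8 ⇒ decIsMeet 8 omegaSq) := by
  have h := limIsMeet_valid.app (omegaMulSeq 0) (fun _ => omegaMulSeq_typed)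
    (C := pi (increasing omegaMulSeq) fun u => omegaMulSeqZero ⇒
      (pi nat fun n => leAddOmega (omegaMulSeq ⬝ n) (omegaMulSeq ⬝ succ n)) ⇒
      countableChoice 8 ⇒ decIsMeet 8 (blim omegaMulSeq u)) (by decide +kernel)
  have h := h.app (omegaMulIncr 0) (fun _ => omegaMulIncr_typed)
    (C := omegaMulSeqZero ⇒
      (pi nat fun n => leAddOmega (omegaMulSeq ⬝ n) (omegaMulSeq ⬝ succ n)) ⇒
      countableChoice 8 ⇒ decIsMeet 8 omegaSq) (by decide +kernel)
  exact (h.mp (fun _ => ⟨_, omegaMulSeqZero_typed⟩) (by decide +kernel)).mp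
    (fun _ => omegaMulSeq_succ_le) (by decide +kernel)

end HoTT

end

theorem theorem8p6 (i : ℕ) :
    HoTT.Proves (HoTT.arr (HoTT.countableChoice i) (HoTT.omegaSqDecIsMeet i)) ∧
      HoTT.Proves (HoTT.arr (HoTT.countableChoice i) (HoTT.omegaSqDecMeet i)) :=
  -- For the parameter `i`, the codes `8` and `9` are read as `i` and `i + 1`, so the interpreted
  -- types unfold to those of the statement.
  ⟨HoTT.decIsMeet_valid i, HoTT.decMeet_valid i⟩
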